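/- Let $\mathcal S_1,\mathcal S_2,\mathcal Z,\mathcal X_1,\mathcal X_2,\mathcal Y,\hat{\mathcal S}_1,\hat{\mathcal S}_2$ be finite alphabets ($\hat{\mathcal S}_1,\hat{\mathcal S}_2$ nonempty), let $(S_{1i},S_{2i},Z_i)_{i\ge 1}$ be i.i.d. copies of $(S_1,S_2,Z)\sim p(s_1,s_2,z)$, let $p(y|x_1,x_2)$ be a discrete memoryless multiple access channel, and let $d_j:\mathcal S_j\times\hat{\mathcal S}_j\to\mathbb R$, $j=1,2$, be distortion measures. A code of block length $n$ consists of encoders $e_j:\mathcal S_j^n\times\mathcal Z^n\to\mathcal X_j^n$ and decoders $g_j:\mathcal Y^n\times\mathcal Z^n\to\hat{\mathcal S}_j^n$, $j=1,2$; here $Y^n$ is the channel output for the inputs $X_j^n=e_j(S_j^n,Z^n)$, and $\hat S_j^n=g_j(Y^n,Z^n)$. So the side information $Z^n$ is shared by both encoders and the decoder. A pair $(D_1,D_2)\in\mathbb R^2$ is achievable if for every $\varepsilon>0$ and all sufficiently large $n$ there is a code of block length $n$ with $\frac1n\sum_{i=1}^n\mathbb E[d_j(S_{ji},\hat S_{ji})]\le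 D_j+\varepsilon$ for $j=1,2$. It is achievable by separate source and channel coding if for every $\varepsilon>0$ and all sufficiently large $n$ there are integers $M_1,M_2$, source encoders $\mathcal S_j^n\times\mathcal Z^n\to\{1,\dots,M_j\}$, source decoders $\{1,\dots,M_j\}\times\mathcal Z^n\to\hat{\mathcal S}_j^n$, channel encoders $\{1,\dots,M_j\}\to\mathcal X_j^n$ and a channel decoder $\mathcal Y^n\to\{1,\dots,M_1\}\times\{1,\dots,M_2\}$ such that (i) the source codes alone (indices conveyed without error) have average expected distortions at most $D_j+\varepsilon$; (ii) the probability that the channel decoder errs on the message pair is at most $\varepsilon$, both for independent uniform messages and for the messages produced by the source encoders; (iii) the code obtained by concatenation has average expected distortions at most $D_j+\varepsilon$, $j=1,2$. For random variables with values in finite sets put $\mathcal E(S_j|Q)=\min_f\mathbb E[d_j(S_j,f(Q))]$, the minimum being over all functions $f$ from the alphabet of $Q$ to $\hat{\mathcal S}_j$, and define the conditional rate distortion function $$R_{S_j|Z}(D_j)=\min_{p(u_j|s_j,z):\ \mathcal E(S_j|U_j,Z)\le D_j} I(S_j;U_j|Z),\qquad j=1,2,$$ where $U_j$ ranges over random variables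 with finite alphabets, and $R_{S_j|Z}(D_j)=+\infty$ if no $p(u_j|s_j,z)$ satisfies the constraint. Suppose that $S_1-Z-S_2$ is a Markov chain. Then separate source and channel coding is optimal: a pair $(D_1,D_2)$ is achievable if and only if it is achievable by separate source and channel coding. Moreover, $(D_1,D_2)$ is achievable if $$R_{S_1|Z}(D_1)<I(X_1;Y|X_2,Q),\qquad R_{S_2|Z}(D_2)<I(X_2;Y|X_1,Q),$$ $$R_{S_1|Z}(D_1)+R_{S_2|Z}(D_2)<I(X_1,X_2;Y|Q)$$ for some joint distribution $p(x_1,x_2,y,q)=p(y|x_1,x_2)\,p(x_1|q)\,p(x_2|q)\,p(q)$ with $Q$ in a finite alphabet. Conversely, if $(D_1,D_2)$ is achievable, then these three inequalities with $<$ replaced by $\le$ hold for some joint distribution of this form. -/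

import Mathlib

open Filter

noncomputable section

namespace LossyMAC

/-! ### Finite probability and information measures

A probability mass function on a finite type `Ω` is an element of `stdSimplex ℝ Ω`; a random
variable is a function on `Ω`. Information is measured in nats; only comparisons between
information quantities occur, so the base of the logarithm is immaterial. -/

section Information

variable {Ω α β γ : Type*} [Fintype Ω] [Fintype α] [Fintype β] [Fintype γ]

open Classical in
/-- `P(A = a)` for the random variable `A` under the mass function `r`. -/
def law (r : Ω → ℝ) (A : Ω → α) (a : α) : ℝ := ∑ ω, if A ω = a then r ω else 0

/-- Entropy `H(A)`. -/
def entropy (r : Ω → ℝ) (A : Ω → α) : ℝ := ∑ a, Real.negMulLog (law r A a)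

/-- Conditional entropy `H(A | C) = H(A, C) - H(C)`. -/
def condEntropy (r : Ω → ℝ) (A : Ω → α) (C : Ω → γ) : ℝ :=
  entropy r (fun ω => (A ω, C ω)) - entropy r C

/-- Conditional mutual information `I(A ; B | C) = H(A | C) - H(A | B, C)`. -/
def condMutualInfo (r : Ω → ℝ) (A : Ω → α) (B : Ω → β) (C : Ω → γ) : ℝ :=
  condEntropy r A C - condEntropy r A (fun ω => (B ω, C ω))

/-- The Markov chain `A - B - C`: `P(a,b,c) P(b) = P(a,b) P(b,c)`. -/
def IsMarkovChain (r : Ω → ℝ) (A : Ω → α) (B : Ω → β) (C : Ω → γ) : Prop :=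
  ∀ a b c, law r (fun ω => (A ω, B ω, C ω)) (a, b, c) * law r B b =
    law r (fun ω => (A ω, B ω)) (a, b) * law r (fun ω => (B ω, C ω)) (b, c)

end Information

/-! ### The conditional rate distortion function -/

section RateDistortion

/-- `𝓔(S | Q)`: the least expected distortion of an estimate of `S` that is a function of `Q`.
(A minimum over a finite nonempty set when the alphabets are finite and `T` is nonempty.) -/
def minDistortion {Ω σ κ T : Type*} [Fintype Ω] (r : Ω → ℝ) (S : Ω → σ) (Q : Ω → κ)
    (d : σ → T → ℝ) : ℝ :=
  ⨅ f : κ → T, ∑ ω, r ω * d (S ω) (f (Q ω))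

variable {σ ζ T : Type*} [Fintype σ] [Fintype ζ]

/-- The joint law of `(S, Z, U)` when `(S, Z) ∼ r` and `U` is drawn from `V(· | s, z)`. -/
def testLaw {k : ℕ} (r : σ × ζ → ℝ) (V : σ → ζ → Fin k → ℝ) : σ × ζ × Fin k → ℝ :=
  fun a => r (a.1, a.2.1) * V a.1 a.2.1 a.2.2

/-- `R_{S|Z}(D)` for `(S, Z) ∼ r`: the infimum of `I(S ; U | Z)` over all conditional laws
`V(u | s, z)` with `U` in a finite alphabet and `𝓔(S | U, Z) ≤ D`. It is `⊤` if there is no such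
conditional law. -/
def condRateDistortion (r : σ × ζ → ℝ) (d : σ → T → ℝ) (D : ℝ) : EReal :=
  ⨅ (k : ℕ) (V : σ → ζ → Fin k → ℝ) (_ : ∀ s z, V s z ∈ stdSimplex ℝ (Fin k))
    (_ : minDistortion (testLaw r V) (fun a => a.1) (fun a => (a.2.2, a.2.1)) d ≤ D),
    ((condMutualInfo (testLaw r V) (fun a => a.1) (fun a => a.2.2) (fun a => a.2.1) : ℝ) : EReal)

/-- `R_{S₁|Z}(D)` for the source triple `(S₁, S₂, Z) ∼ p`. -/
def rateDist₁ {S₁ S₂ Z T₁ : Type*} [Fintype S₁] [Fintype S₂] [Fintype Z] (p : S₁ × S₂ × Z → ℝ)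
    (d₁ : S₁ → T₁ → ℝ) (D : ℝ) : EReal :=
  condRateDistortion (law p (fun ω => (ω.1, ω.2.2))) d₁ D

/-- `R_{S₂|Z}(D)` for the source triple `(S₁, S₂, Z) ∼ p`. -/
def rateDist₂ {S₁ S₂ Z T₂ : Type*} [Fintype S₁] [Fintype S₂] [Fintype Z] (p : S₁ × S₂ × Z → ℝ)
    (d₂ : S₂ → T₂ → ℝ) (D : ℝ) : EReal :=
  condRateDistortion (law p (fun ω => (ω.2.1, ω.2.2))) d₂ D

end RateDistortion

/-! ### Block codes with side information at both encoders and the decoder -/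

/-- A code of block length `n`: encoder `j` maps `(s_j^n, z^n)` to `x_j^n`, and the decoder maps
`(y^n, z^n)` to the two reconstructions. -/
structure Code (n : ℕ) (S₁ S₂ Z X₁ X₂ Y T₁ T₂ : Type*) where
  enc₁ : (Fin n → S₁) → (Fin n → Z) → (Fin n → X₁)
  enc₂ : (Fin n → S₂) → (Fin n → Z) → (Fin n → X₂)
  dec₁ : (Fin n → Y) → (Fin n → Z) → (Fin n → T₁)
  dec₂ : (Fin n → Y) → (Fin n → Z) → (Fin n → T₂)

/-- A separate source-channel code of block length `n`: for each source, a source code of size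
`M_j` (given `z^n`), and a multiple access channel code of sizes `(M₁, M₂)`. The two parts interact
only through the message indices. -/
structure SepCode (n : ℕ) (S₁ S₂ Z X₁ X₂ Y T₁ T₂ : Type*) where
  M₁ : ℕ
  M₂ : ℕ
  srcEnc₁ : (Fin n → S₁) → (Fin n → Z) → Fin M₁
  srcEnc₂ : (Fin n → S₂) → (Fin n → Z) → Fin M₂
  srcDec₁ : Fin M₁ → (Fin n → Z) → (Fin n → T₁)
  srcDec₂ : Fin M₂ → (Fin n → Z) → (Fin n → T₂)
  chEnc₁ : Fin M₁ → (Fin n → X₁)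
  chEnc₂ : Fin M₂ → (Fin n → X₂)
  chDec : (Fin n → Y) → Fin M₁ × Fin M₂

section Coding

variable {n : ℕ} {S₁ S₂ Z X₁ X₂ Y T₁ T₂ : Type*}

/-- The code obtained by concatenating the source codes with the channel code. -/
def SepCode.toCode (c : SepCode n S₁ S₂ Z X₁ X₂ Y T₁ T₂) : Code n S₁ S₂ Z X₁ X₂ Y T₁ T₂ where
  enc₁ s z := c.chEnc₁ (c.srcEnc₁ s z)
  enc₂ s z := c.chEnc₂ (c.srcEnc₂ s z)
  dec₁ y z := c.srcDec₁ (c.chDec y).1 z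
  dec₂ y z := c.srcDec₂ (c.chDec y).2 z

/-- The component `s₁^n` of a block of source triples. -/
def seq₁ (ω : Fin n → S₁ × S₂ × Z) : Fin n → S₁ := fun i => (ω i).1

/-- The component `s₂^n` of a block of source triples. -/
def seq₂ (ω : Fin n → S₁ × S₂ × Z) : Fin n → S₂ := fun i => (ω i).2.1

/-- The component `z^n` of a block of source triples. -/
def seqZ (ω : Fin n → S₁ × S₂ × Z) : Fin n → Z := fun i => (ω i).2.2

/-- Probability of a source block under the memoryless source `p`. -/
def sourceProb (p : S₁ × S₂ × Z → ℝ) (ω : Fin n → S₁ × S₂ × Z) : ℝ := ∏ i, p (ω i)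

/-- Transition probability `W^n(y^n | x₁^n, x₂^n)` of the memoryless channel `W(y | x₁, x₂)`. -/
def channelProb (W : X₁ → X₂ → Y → ℝ) (x₁ : Fin n → X₁) (x₂ : Fin n → X₂) (y : Fin n → Y) : ℝ :=
  ∏ i, W (x₁ i) (x₂ i) (y i)

/-- Per-letter distortion `(1/n) ∑ d(s_i, t_i)`. -/
def blockDist {σ T : Type*} (d : σ → T → ℝ) (s : Fin n → σ) (t : Fin n → T) : ℝ :=
  (∑ i, d (s i) (t i)) / n

variable [Fintype S₁] [Fintype S₂] [Fintype Z] [Fintype Y]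

/-- Expectation of `F(source block, y^n)` when the channel inputs are produced by the encoders of
the code `c`. -/
def Code.expect (p : S₁ × S₂ × Z → ℝ) (W : X₁ → X₂ → Y → ℝ)
    (c : Code n S₁ S₂ Z X₁ X₂ Y T₁ T₂) (F : (Fin n → S₁ × S₂ × Z) → (Fin n → Y) → ℝ) : ℝ :=
  ∑ ω, sourceProb p ω *
    ∑ y, channelProb W (c.enc₁ (seq₁ ω) (seqZ ω)) (c.enc₂ (seq₂ ω) (seqZ ω)) y * F ω y

/-- The code `c` has expected distortions at most `D₁` and `D₂`. -/
def Code.MeetsDistortion (p : S₁ × S₂ × Z → ℝ) (W : X₁ → X₂ → Y → ℝ)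
    (d₁ : S₁ → T₁ → ℝ) (d₂ : S₂ → T₂ → ℝ) (c : Code n S₁ S₂ Z X₁ X₂ Y T₁ T₂) (D₁ D₂ : ℝ) : Prop :=
  c.expect p W (fun ω y => blockDist d₁ (seq₁ ω) (c.dec₁ y (seqZ ω))) ≤ D₁ ∧
  c.expect p W (fun ω y => blockDist d₂ (seq₂ ω) (c.dec₂ y (seqZ ω))) ≤ D₂

/-- The source codes alone (indices conveyed without error) have expected distortions at most
`D₁` and `D₂`. -/
def SepCode.SourceMeetsDistortion (p : S₁ × S₂ × Z → ℝ) (d₁ : S₁ → T₁ → ℝ) (d₂ : S₂ → T₂ → ℝ)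
    (c : SepCode n S₁ S₂ Z X₁ X₂ Y T₁ T₂) (D₁ D₂ : ℝ) : Prop :=
  ∑ ω, sourceProb p ω *
      blockDist d₁ (seq₁ ω) (c.srcDec₁ (c.srcEnc₁ (seq₁ ω) (seqZ ω)) (seqZ ω)) ≤ D₁ ∧
  ∑ ω, sourceProb p ω *
      blockDist d₂ (seq₂ ω) (c.srcDec₂ (c.srcEnc₂ (seq₂ ω) (seqZ ω)) (seqZ ω)) ≤ D₂

open Classical in
/-- Average error probability of the channel code for independent, uniform messages. -/
def SepCode.uniformError (W : X₁ → X₂ → Y → ℝ) (c : SepCode n S₁ S₂ Z X₁ X₂ Y T₁ T₂) : ℝ :=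
  (∑ m₁, ∑ m₂, ∑ y, channelProb W (c.chEnc₁ m₁) (c.chEnc₂ m₂) y *
    if c.chDec y = (m₁, m₂) then 0 else 1) / (c.M₁ * c.M₂)

open Classical in
/-- Error probability of the channel code for the messages produced by the source encoders. -/
def SepCode.sourceError (p : S₁ × S₂ × Z → ℝ) (W : X₁ → X₂ → Y → ℝ)
    (c : SepCode n S₁ S₂ Z X₁ X₂ Y T₁ T₂) : ℝ :=
  c.toCode.expect p W fun ω y =>
    if c.chDec y = (c.srcEnc₁ (seq₁ ω) (seqZ ω), c.srcEnc₂ (seq₂ ω) (seqZ ω)) then 0 else 1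

/-- `(D₁, D₂)` is achievable: for every `ε > 0` and all large `n` some code of block length `n` has
expected distortions at most `D₁ + ε` and `D₂ + ε`. -/
def Achievable (p : S₁ × S₂ × Z → ℝ) (W : X₁ → X₂ → Y → ℝ)
    (d₁ : S₁ → T₁ → ℝ) (d₂ : S₂ → T₂ → ℝ) (D₁ D₂ : ℝ) : Prop :=
  ∀ ε > 0, ∀ᶠ n : ℕ in atTop, ∃ c : Code n S₁ S₂ Z X₁ X₂ Y T₁ T₂,
    c.MeetsDistortion p W d₁ d₂ (D₁ + ε) (D₂ + ε)

/-- `(D₁, D₂)` is achievable by separate source and channel coding: for every `ε > 0` and all large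
`n` there are source codes with distortions at most `D_j + ε` and a channel code for their index
sets, reliable both for uniform messages and for the messages that the source codes produce, whose
concatenation has distortions at most `D_j + ε`. -/
def SeparatelyAchievable (p : S₁ × S₂ × Z → ℝ) (W : X₁ → X₂ → Y → ℝ)
    (d₁ : S₁ → T₁ → ℝ) (d₂ : S₂ → T₂ → ℝ) (D₁ D₂ : ℝ) : Prop :=
  ∀ ε > 0, ∀ᶠ n : ℕ in atTop, ∃ c : SepCode n S₁ S₂ Z X₁ X₂ Y T₁ T₂,
    c.SourceMeetsDistortion p d₁ d₂ (D₁ + ε) (D₂ + ε) ∧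
    c.uniformError W ≤ ε ∧ c.sourceError p W ≤ ε ∧
    c.toCode.MeetsDistortion p W d₁ d₂ (D₁ + ε) (D₂ + ε)

end Coding

/-! ### The multiple access channel region -/

section Region

variable {X₁ X₂ Y : Type*} {k : ℕ}

/-- The joint law `p(q) p(x₁|q) p(x₂|q) W(y|x₁,x₂)` of `(Q, X₁, X₂, Y)`. -/
def macLaw (W : X₁ → X₂ → Y → ℝ) (pQ : Fin k → ℝ) (P₁ : Fin k → X₁ → ℝ) (P₂ : Fin k → X₂ → ℝ) :
    Fin k × X₁ × X₂ × Y → ℝ :=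
  fun a => pQ a.1 * P₁ a.1 a.2.1 * P₂ a.1 a.2.2.1 * W a.2.1 a.2.2.1 a.2.2.2

variable [Fintype X₁] [Fintype X₂] [Fintype Y]

/-- `I(X₁ ; Y | X₂, Q)`. -/
def macInfo₁ (W : X₁ → X₂ → Y → ℝ) (pQ : Fin k → ℝ) (P₁ : Fin k → X₁ → ℝ)
    (P₂ : Fin k → X₂ → ℝ) : ℝ :=
  condMutualInfo (macLaw W pQ P₁ P₂) (fun a => a.2.1) (fun a => a.2.2.2)
    (fun a => (a.2.2.1, a.1))

/-- `I(X₂ ; Y | X₁, Q)`. -/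
def macInfo₂ (W : X₁ → X₂ → Y → ℝ) (pQ : Fin k → ℝ) (P₁ : Fin k → X₁ → ℝ)
    (P₂ : Fin k → X₂ → ℝ) : ℝ :=
  condMutualInfo (macLaw W pQ P₁ P₂) (fun a => a.2.2.1) (fun a => a.2.2.2)
    (fun a => (a.2.1, a.1))

/-- `I(X₁, X₂ ; Y | Q)`. -/
def macInfo₁₂ (W : X₁ → X₂ → Y → ℝ) (pQ : Fin k → ℝ) (P₁ : Fin k → X₁ → ℝ)
    (P₂ : Fin k → X₂ → ℝ) : ℝ :=
  condMutualInfo (macLaw W pQ P₁ P₂) (fun a => (a.2.1, a.2.2.1)) (fun a => a.2.2.2)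
    (fun a => a.1)

end Region

end LossyMAC

end

/-! Everything passes through one single-letter condition: test channels `V₁`, `V₂` from `(S_j, Z)`
to the reconstruction alphabets meet the distortions, and the point `(I(S₁;T₁|Z), I(S₂;T₂|Z))` lies
in the multiple access region.

Converse. Given `Z^n` the two source blocks are independent. For any code, a uniformly random time
index turns the reconstructions into test channels with `n * testInfo ≤ I(S_j^n; Y^n | Z^n)`
(`exists_testChannel`). Conditional independence bounds these block informations, and their sum, by
differences of output entropies (`condMutualInfo_le_of_indep`, `condMutualInfo_add_le_of_indep`).
Those single-letterize with time-sharing variable `Q` = (time index, whole block `Z^n`)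
(`exists_macLaw`): given `Q` the inputs are independent, so the common side information acts only as
time sharing. The alphabet of `Q` grows with `n`; Carathéodory's theorem in dimension three cuts it
down to four values (`exists_macLaw_four`), and compactness then removes the slack in the
distortions (`Achievable.exists_testChannels`).

Direct part. As `Z^n` is known at both ends, each `z^n` gets its own random covering codebook
(`eventually_exists_sourceCode`). The channel code is random with threshold decoding
(`exists_blockChannelCode`); its error bound holds for every message law, so one code serves the
uniform messages and the source indices together.

Optimality of separation. The converse gives only weak inequalities, the direct part needs strict
ones. Mixing a test channel with a constant output strictly lowers a positive information at small
cost in distortion (`exists_testChannel_lt`). If the information is zero, a single index suffices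
(`exists_estimator_of_testInfo_eq_zero`), and the confusion terms, proportional to `M_j - 1`,
vanish; no strict inequality is then needed for that user or for the sum. Hence boundary points,
even for channels of zero capacity, are reached by separate coding. -/

open Filter

noncomputable section

namespace LossyMAC

set_option linter.unusedSectionVars false

/-! ### Entropy calculus on finite spaces -/

section Entropy

variable {Ω α β γ δ : Type*} [Fintype Ω] [Fintype α] [Fintype β] [Fintype γ] [Fintype δ]

lemma sum_ite_eq_any {ι : Type*} [Fintype ι] (a : ι) (f : ι → ℝ) [∀ i, Decidable (i = a)] :
    (∑ i, if i = a then f i else 0) = f a := by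
  classical
  rw [Finset.sum_eq_single a]
  · simp
  · intro b _ hb; simp [hb]
  · simp

lemma sum_ite_eq_any' {ι : Type*} [Fintype ι] (a : ι) (f : ι → ℝ) [∀ i, Decidable (a = i)] :
    (∑ i, if a = i then f i else 0) = f a := by
  classical
  rw [Finset.sum_eq_single a]
  · simp
  · intro b _ hb; simp [hb.symm]
  · simp

/-- Change of variables, behind most computations below: the mean of a function of `A` may be taken
on `Ω` or on the alphabet of `A`. -/
lemma sum_law_mul (r : Ω → ℝ) (A : Ω → α) (F : α → ℝ) :
    ∑ a, law r A a * F a = ∑ ω, r ω * F (A ω) := by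
  classical
  simp only [law, Finset.sum_mul]
  rw [Finset.sum_comm]
  refine Finset.sum_congr rfl fun ω _ => ?_
  simp only [ite_mul, zero_mul]
  exact sum_ite_eq_any' (A ω) (fun a => r ω * F a)

lemma sum_law (r : Ω → ℝ) (A : Ω → α) : ∑ a, law r A a = ∑ ω, r ω := by
  simpa using sum_law_mul r A (fun _ => 1)

open Classical in
lemma law_eq_sum_mul (r : Ω → ℝ) (A : Ω → α) (a : α) :
    law r A a = ∑ ω, r ω * if A ω = a then 1 else 0 := by
  simp [law]

lemma law_comp (r : Ω → ℝ) (A : Ω → α) (f : α → β) :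
    law (law r A) f = law r (fun ω => f (A ω)) := by
  classical
  funext b
  rw [law_eq_sum_mul, law_eq_sum_mul, sum_law_mul]

lemma law_id (r : Ω → ℝ) : law r (fun ω => ω) = r := by
  classical
  funext a
  exact sum_ite_eq_any a r

lemma law_nonneg {r : Ω → ℝ} (hr : ∀ ω, 0 ≤ r ω) (A : Ω → α) (a : α) : 0 ≤ law r A a := by
  classical
  exact Finset.sum_nonneg fun ω _ => by split_ifs <;> simp [hr]

lemma law_mono {r : Ω → ℝ} (hr : ∀ ω, 0 ≤ r ω) {A : Ω → α} {B : Ω → β} {a : α} {b : β}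
    (h : ∀ ω, A ω = a → B ω = b) : law r A a ≤ law r B b := by
  classical
  refine Finset.sum_le_sum fun ω _ => ?_
  by_cases h1 : A ω = a
  · simp [h1, h ω h1]
  · simp only [h1, if_false]
    split_ifs <;> simp [hr]

lemma le_law {r : Ω → ℝ} (hr : ∀ ω, 0 ≤ r ω) (A : Ω → α) (ω : Ω) : r ω ≤ law r A (A ω) := by
  classical
  have := Finset.single_le_sum (f := fun ω' => if A ω' = A ω then r ω' else 0)
    (fun ω' _ => by split_ifs <;> simp [hr]) (Finset.mem_univ ω)
  simpa [law] using this

lemma law_mem_stdSimplex {r : Ω → ℝ} (hr : r ∈ stdSimplex ℝ Ω) (A : Ω → α) :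
    law r A ∈ stdSimplex ℝ α :=
  ⟨law_nonneg hr.1 A, by rw [sum_law, hr.2]⟩

lemma sum_law_pair (r : Ω → ℝ) (A : Ω → α) (C : Ω → γ) (c : γ) :
    ∑ a, law r (fun ω => (A ω, C ω)) (a, c) = law r C c := by
  classical
  simp only [law]
  rw [Finset.sum_comm]
  refine Finset.sum_congr rfl fun ω _ => ?_
  simp only [Prod.mk.injEq, ite_and]
  exact sum_ite_eq_any' (A ω) (fun _ => if C ω = c then r ω else 0)

/-- Written as a mean over `Ω`, entropy refers to `A` only through the events `A ω' = A ω`, whence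
its invariance under relabelling. -/
lemma entropy_eq_sum (r : Ω → ℝ) (A : Ω → α) :
    entropy r A = -∑ ω, r ω * Real.log (law r A (A ω)) := by
  rw [← sum_law_mul r A (fun a => Real.log (law r A a)), entropy, ← Finset.sum_neg_distrib]
  exact Finset.sum_congr rfl fun a _ => by rw [Real.negMulLog]; ring

/-- Entropy depends only on the partition that the random variable induces. -/
lemma entropy_congr (r : Ω → ℝ) {A : Ω → α} {B : Ω → β}
    (h : ∀ ω ω', A ω = A ω' ↔ B ω = B ω') : entropy r A = entropy r B := by
  rw [entropy_eq_sum, entropy_eq_sum]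
  simp only [law_eq_sum_mul, mul_ite, mul_one, mul_zero]
  congr! 8 with ω _ ω' _
  exact h ω' ω

lemma condEntropy_congr (r : Ω → ℝ) {A : Ω → α} {B : Ω → β} {C : Ω → γ} {C' : Ω → δ}
    (h : ∀ ω ω', A ω = A ω' ↔ B ω = B ω') (h' : ∀ ω ω', C ω = C ω' ↔ C' ω = C' ω') :
    condEntropy r A C = condEntropy r B C' := by
  rw [condEntropy, condEntropy, entropy_congr r h']
  congr 1
  exact entropy_congr r fun ω ω' => by simp only [Prod.mk.injEq, h, h']

lemma entropy_law (r : Ω → ℝ) (A : Ω → α) (f : α → β) :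
    entropy (law r A) f = entropy r (fun ω => f (A ω)) := by
  rw [entropy, entropy, law_comp]

lemma condEntropy_law (r : Ω → ℝ) (A : Ω → α) (f : α → β) (g : α → γ) :
    condEntropy (law r A) f g = condEntropy r (fun ω => f (A ω)) (fun ω => g (A ω)) := by
  rw [condEntropy, condEntropy, entropy_law, entropy_law]

lemma condMutualInfo_law (r : Ω → ℝ) (A : Ω → α) (f : α → β) (g : α → γ) (h : α → δ) :
    condMutualInfo (law r A) f g h =
      condMutualInfo r (fun ω => f (A ω)) (fun ω => g (A ω)) (fun ω => h (A ω)) := by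
  rw [condMutualInfo, condMutualInfo, condEntropy_law, condEntropy_law]

/-- Both sides equal `H(A,C) + H(B,C) - H(A,B,C) - H(C)`. In the converse this trades source
uncertainty for output uncertainty. -/
lemma condMutualInfo_symm (r : Ω → ℝ) (A : Ω → α) (B : Ω → β) (C : Ω → γ) :
    condMutualInfo r A B C = condEntropy r B C - condEntropy r B (fun ω => (A ω, C ω)) := by
  simp only [condMutualInfo, condEntropy]
  rw [entropy_congr r (A := fun ω => (A ω, B ω, C ω)) (B := fun ω => (B ω, A ω, C ω))
    fun ω ω' => by simp only [Prod.mk.injEq]; tauto]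
  ring

/-- Conditional mutual information as the mean of the information density. -/
lemma condMutualInfo_eq_sum (r : Ω → ℝ) (A : Ω → α) (B : Ω → β) (C : Ω → γ) :
    condMutualInfo r A B C = ∑ ω, r ω *
      (Real.log (law r (fun ω => (A ω, B ω, C ω)) (A ω, B ω, C ω)) + Real.log (law r C (C ω))
        - Real.log (law r (fun ω => (A ω, C ω)) (A ω, C ω))
        - Real.log (law r (fun ω => (B ω, C ω)) (B ω, C ω))) := by
  simp only [condMutualInfo, condEntropy, entropy_eq_sum, mul_sub, mul_add,
    Finset.sum_sub_distrib, Finset.sum_add_distrib]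
  ring

/-- Conditional mutual information as a relative entropy. -/
lemma condMutualInfo_eq_sum_klFun {r : Ω → ℝ} (hr : ∀ ω, 0 ≤ r ω)
    (A : Ω → α) (B : Ω → β) (C : Ω → γ) :
    condMutualInfo r A B C = ∑ x : α × β × γ,
      (law r (fun ω => (A ω, C ω)) (x.1, x.2.2) * law r (fun ω => (B ω, C ω)) x.2 / law r C x.2.2) *
      InformationTheory.klFun (law r (fun ω => (A ω, B ω, C ω)) x /
        (law r (fun ω => (A ω, C ω)) (x.1, x.2.2) * law r (fun ω => (B ω, C ω)) x.2 /
          law r C x.2.2)) := by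
  rw [condMutualInfo_eq_sum]
  rw [← sum_law_mul r (fun ω => (A ω, B ω, C ω)) (fun x =>
    Real.log (law r (fun ω => (A ω, B ω, C ω)) x) + Real.log (law r C x.2.2)
        - Real.log (law r (fun ω => (A ω, C ω)) (x.1, x.2.2))
        - Real.log (law r (fun ω => (B ω, C ω)) x.2))]
  -- With `klFun x = x log x + 1 - x`, each term is `m log (m/ν) = ν klFun (m/ν) + (m - ν)`, also
  -- when `m = 0`. The corrections cancel in the sum, as `m` and `ν` have the same total mass.
  have key : ∀ x : α × β × γ, law r (fun ω => (A ω, B ω, C ω)) x * (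
      Real.log (law r (fun ω => (A ω, B ω, C ω)) x) + Real.log (law r C x.2.2)
        - Real.log (law r (fun ω => (A ω, C ω)) (x.1, x.2.2))
        - Real.log (law r (fun ω => (B ω, C ω)) x.2)) =
      (law r (fun ω => (A ω, C ω)) (x.1, x.2.2) * law r (fun ω => (B ω, C ω)) x.2 / law r C x.2.2) *
      InformationTheory.klFun (law r (fun ω => (A ω, B ω, C ω)) x /
        (law r (fun ω => (A ω, C ω)) (x.1, x.2.2) * law r (fun ω => (B ω, C ω)) x.2 /
          law r C x.2.2)) + (law r (fun ω => (A ω, B ω, C ω)) x -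
      (law r (fun ω => (A ω, C ω)) (x.1, x.2.2) * law r (fun ω => (B ω, C ω)) x.2 /
          law r C x.2.2)) := by
    rintro ⟨a, b, c⟩
    have h1 : law r (fun ω => (A ω, B ω, C ω)) (a, b, c) ≤ law r (fun ω => (A ω, C ω)) (a, c) :=
      law_mono hr (by simp +contextual)
    have h2 : law r (fun ω => (A ω, B ω, C ω)) (a, b, c) ≤ law r (fun ω => (B ω, C ω)) (b, c) :=
      law_mono hr (by simp +contextual)
    have h3 : law r (fun ω => (A ω, B ω, C ω)) (a, b, c) ≤ law r C c :=
      law_mono hr (by simp +contextual)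
    have h0 := law_nonneg hr (fun ω => (A ω, B ω, C ω)) (a, b, c)
    simp only
    generalize law r (fun ω => (A ω, B ω, C ω)) (a, b, c) = m at *
    generalize law r (fun ω => (A ω, C ω)) (a, c) = u at *
    generalize law r (fun ω => (B ω, C ω)) (b, c) = v at *
    generalize law r C c = w at *
    rcases h0.eq_or_lt with h | h
    · simp [← h, InformationTheory.klFun_zero]
    · have hu := h.trans_le h1
      have hv := h.trans_le h2
      have hw := h.trans_le h3
      rw [InformationTheory.klFun_apply, Real.log_div h.ne' (by positivity),
        Real.log_div (by positivity) hw.ne', Real.log_mul hu.ne' hv.ne']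
      field_simp
      ring
  rw [Finset.sum_congr rfl fun x _ => key x, Finset.sum_add_distrib, Finset.sum_sub_distrib, sum_law]
  -- Summing over the first coordinate leaves `P(b,c)`. Where `P(c) = 0` the quotient is `0` by
  -- convention, and so is `P(b,c)`.
  have htot : ∑ x : α × β × γ, (law r (fun ω => (A ω, C ω)) (x.1, x.2.2) *
      law r (fun ω => (B ω, C ω)) x.2 / law r C x.2.2) = ∑ ω, r ω := by
    rw [Fintype.sum_prod_type, Finset.sum_comm, ← sum_law r (fun ω => (B ω, C ω))]
    refine Finset.sum_congr rfl fun y _ => ?_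
    simp only
    rw [← Finset.sum_div, ← Finset.sum_mul, sum_law_pair]
    have h2 : law r (fun ω => (B ω, C ω)) y ≤ law r C y.2 :=
      law_mono hr (by rintro ω rfl; rfl)
    have h0 := law_nonneg hr (fun ω => (B ω, C ω)) y
    by_cases h : law r C y.2 = 0
    · rw [h] at h2 ⊢; simp; linarith
    · field_simp
  rw [htot]; ring

lemma condMutualInfo_nonneg {r : Ω → ℝ} (hr : ∀ ω, 0 ≤ r ω)
    (A : Ω → α) (B : Ω → β) (C : Ω → γ) : 0 ≤ condMutualInfo r A B C := by
  rw [condMutualInfo_eq_sum_klFun hr]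
  refine Finset.sum_nonneg fun x _ => ?_
  have h1 := law_nonneg hr (fun ω => (A ω, C ω)) (x.1, x.2.2)
  have h2 := law_nonneg hr (fun ω => (B ω, C ω)) x.2
  have h3 := law_nonneg hr C x.2.2
  have h4 := law_nonneg hr (fun ω => (A ω, B ω, C ω)) x
  exact mul_nonneg (by positivity) (InformationTheory.klFun_nonneg (by positivity))

/-- Equality case: `klFun` vanishes only at `1`, and where the weight is zero a marginal is zero,
which forces the joint mass to vanish too. -/
lemma condMutualInfo_eq_zero_iff {r : Ω → ℝ} (hr : ∀ ω, 0 ≤ r ω)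
    (A : Ω → α) (B : Ω → β) (C : Ω → γ) : condMutualInfo r A B C = 0 ↔
      ∀ a b c, law r (fun ω => (A ω, B ω, C ω)) (a, b, c) * law r C c =
        law r (fun ω => (A ω, C ω)) (a, c) * law r (fun ω => (B ω, C ω)) (b, c) := by
  rw [condMutualInfo_eq_sum_klFun hr, Finset.sum_eq_zero_iff_of_nonneg]
  · simp only [Finset.mem_univ, forall_true_left, Prod.forall]
    refine forall_congr' fun a => forall_congr' fun b => forall_congr' fun c => ?_
    have h1 : law r (fun ω => (A ω, B ω, C ω)) (a, b, c) ≤ law r (fun ω => (A ω, C ω)) (a, c) :=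
      law_mono hr (by simp +contextual)
    have h2 : law r (fun ω => (A ω, B ω, C ω)) (a, b, c) ≤ law r (fun ω => (B ω, C ω)) (b, c) :=
      law_mono hr (by simp +contextual)
    have h3 : law r (fun ω => (A ω, C ω)) (a, c) ≤ law r C c :=
      law_mono hr (by simp +contextual)
    have h0 := law_nonneg hr (fun ω => (A ω, B ω, C ω)) (a, b, c)
    have hu := law_nonneg hr (fun ω => (A ω, C ω)) (a, c)
    have hv := law_nonneg hr (fun ω => (B ω, C ω)) (b, c)
    generalize law r (fun ω => (A ω, B ω, C ω)) (a, b, c) = m at *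
    generalize law r (fun ω => (A ω, C ω)) (a, c) = u at *
    generalize law r (fun ω => (B ω, C ω)) (b, c) = v at *
    generalize law r C c = w at *
    have hw := hu.trans h3
    rw [mul_eq_zero, InformationTheory.klFun_eq_zero_iff (by positivity)]
    by_cases hu0 : u = 0
    · simp [hu0, show m = 0 by linarith]
    by_cases hv0 : v = 0
    · simp [hv0, show m = 0 by linarith]
    have hu' : 0 < u := lt_of_le_of_ne hu (Ne.symm hu0)
    have hw' : 0 < w := hu'.trans_le h3
    have hv' : 0 < v := lt_of_le_of_ne hv (Ne.symm hv0)
    have : u * v / w ≠ 0 := by positivity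
    rw [div_eq_one_iff_eq this, eq_div_iff hw'.ne']
    simp [this]
  · intro x _
    have h1 := law_nonneg hr (fun ω => (A ω, C ω)) (x.1, x.2.2)
    have h2 := law_nonneg hr (fun ω => (B ω, C ω)) x.2
    have h3 := law_nonneg hr C x.2.2
    have h4 := law_nonneg hr (fun ω => (A ω, B ω, C ω)) x
    exact mul_nonneg (by positivity) (InformationTheory.klFun_nonneg (by positivity))

/-- Conditioning on a finer variable reduces entropy. -/
lemma condEntropy_le_of_factor {r : Ω → ℝ} (hr : ∀ ω, 0 ≤ r ω) (A : Ω → α) {B : Ω → β} {C : Ω → γ}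
    (h : ∀ ω ω', B ω = B ω' → C ω = C ω') : condEntropy r A B ≤ condEntropy r A C := by
  have h1 := condMutualInfo_nonneg hr A B C
  rw [condMutualInfo, condEntropy_congr r (A := A) (B := A) (C := fun ω => (B ω, C ω)) (C' := B)
    (fun _ _ => Iff.rfl)] at h1
  · linarith
  · intro a b
    simp only [Prod.mk.injEq, and_iff_left_iff_imp]
    exact h a b

/-- Data processing. -/
lemma condMutualInfo_le_of_factor {r : Ω → ℝ} (hr : ∀ ω, 0 ≤ r ω) (A : Ω → α) {B : Ω → β}
    {B' : Ω → δ} {C : Ω → γ} (h : ∀ ω ω', B ω = B ω' → C ω = C ω' → B' ω = B' ω') :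
    condMutualInfo r A B' C ≤ condMutualInfo r A B C := by
  have := condEntropy_le_of_factor hr A (B := fun ω => (B ω, C ω)) (C := fun ω => (B' ω, C ω))
    (fun ω ω' h' => by
      simp only [Prod.mk.injEq] at h' ⊢
      exact ⟨h ω ω' h'.1 h'.2, h'.2⟩)
  simp only [condMutualInfo]
  linarith

lemma condEntropy_pair (r : Ω → ℝ) (A : Ω → α) (B : Ω → β) (C : Ω → γ) :
    condEntropy r (fun ω => (A ω, B ω)) C =
      condEntropy r A C + condEntropy r B (fun ω => (A ω, C ω)) := by
  simp only [condEntropy]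
  rw [entropy_congr r (A := fun ω => ((A ω, B ω), C ω)) (B := fun ω => (B ω, A ω, C ω))
    fun ω ω' => by simp only [Prod.mk.injEq]; tauto]
  ring

lemma condEntropy_pair_le {r : Ω → ℝ} (hr : ∀ ω, 0 ≤ r ω) (A : Ω → α) (B : Ω → β) (C : Ω → γ) :
    condEntropy r (fun ω => (A ω, B ω)) C ≤ condEntropy r A C + condEntropy r B C := by
  rw [condEntropy_pair]
  have := condEntropy_le_of_factor hr B (B := fun ω => (A ω, C ω)) (C := C)
    (fun ω ω' h' => (Prod.mk.injEq _ _ _ _ ▸ h').2)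
  linarith

/-- Subadditivity of conditional entropy. -/
lemma condEntropy_tuple_le {r : Ω → ℝ} (hr : ∀ ω, 0 ≤ r ω) (C : Ω → γ) :
    ∀ {n : ℕ} (A : Ω → Fin n → α),
      condEntropy r A C ≤ ∑ i, condEntropy r (fun ω => A ω i) C
  | 0, A => by
      simp only [Finset.univ_eq_empty, Finset.sum_empty, condEntropy]
      rw [entropy_congr r (A := fun ω => (A ω, C ω)) (B := C)]
      · simp
      · intro ω ω'
        simp [Subsingleton.elim (A ω) (A ω')]
  | n + 1, A => by
      rw [Fin.sum_univ_succ, condEntropy_congr r (A := A)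
        (B := fun ω => (A ω 0, fun i : Fin n => A ω i.succ)) (C := C) (C' := C) _
        (fun _ _ => Iff.rfl)]
      · have := condEntropy_tuple_le hr C (fun ω (i : Fin n) => A ω i.succ)
        have h2 := condEntropy_pair_le hr (fun ω => A ω 0) (fun ω (i : Fin n) => A ω i.succ) C
        linarith
      · intro ω ω'
        rw [Prod.mk.injEq, funext_iff, Fin.forall_fin_succ, funext_iff]

/-- Entropy of a random variable with a given conditional law. -/
lemma condEntropy_of_kernel {r : Ω → ℝ} {A : Ω → α} {C : Ω → γ} {μ : γ → ℝ} {K : γ → α → ℝ}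
    (hK : ∀ c, ∑ a, K c a = 1)
    (h : ∀ a c, law r (fun ω => (A ω, C ω)) (a, c) = μ c * K c a) :
    condEntropy r A C = ∑ c, μ c * ∑ a, Real.negMulLog (K c a) := by
  have hC : ∀ c, law r C c = μ c := fun c => by
    rw [← sum_law_pair r A C c]
    simp only [h, ← Finset.mul_sum, hK, mul_one]
  simp only [condEntropy, entropy, Fintype.sum_prod_type, h, hC]
  rw [Finset.sum_comm, ← Finset.sum_sub_distrib]
  refine Finset.sum_congr rfl fun c _ => ?_
  simp only [Real.negMulLog_mul, Finset.sum_add_distrib, ← Finset.sum_mul, ← Finset.mul_sum, hK]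
  ring

/-- Neither `w` nor `r` need be normalised. The part with `negMulLog (w i)` is the contribution of
the mixing index and cancels in conditional entropies. -/
lemma entropy_mixture {ι : Type*} [Fintype ι] (w : ι → ℝ) (r : Ω → ℝ) (B : ι → Ω → β) :
    entropy (fun x : ι × Ω => w x.1 * r x.2) (fun x => (B x.1 x.2, x.1)) =
      ∑ i, ((∑ ω, r ω) * Real.negMulLog (w i) + w i * entropy r (B i)) := by
  classical
  have hlaw : ∀ b i, law (fun x : ι × Ω => w x.1 * r x.2) (fun x => (B x.1 x.2, x.1)) (b, i) =
      w i * law r (B i) b := by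
    intro b i
    simp only [law, Fintype.sum_prod_type, Prod.mk.injEq, Finset.mul_sum]
    rw [Finset.sum_comm]
    refine Finset.sum_congr rfl fun ω _ => ?_
    simp only [and_comm (b := _ = i), ite_and]
    rw [sum_ite_eq_any i (fun j => if B j ω = b then w j * r ω else 0)]
    simp
  simp only [entropy, Fintype.sum_prod_type, hlaw]
  rw [Finset.sum_comm]
  refine Finset.sum_congr rfl fun i _ => ?_
  simp only [Real.negMulLog_mul, Finset.sum_add_distrib, ← Finset.sum_mul, ← Finset.mul_sum,
    sum_law]

/-- Conditional entropy given a mixing variable. -/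
lemma condEntropy_mixture {ι : Type*} [Fintype ι] (w : ι → ℝ) (r : Ω → ℝ)
    (A : ι → Ω → α) (C : ι → Ω → γ) :
    condEntropy (fun x : ι × Ω => w x.1 * r x.2) (fun x => A x.1 x.2) (fun x => (C x.1 x.2, x.1)) =
      ∑ i, w i * condEntropy r (A i) (C i) := by
  simp only [condEntropy]
  rw [entropy_mixture w r C, entropy_congr _ (A := fun x : ι × Ω => (A x.1 x.2, C x.1 x.2, x.1))
    (B := fun x => ((A x.1 x.2, C x.1 x.2), x.1)) (fun x x' => by
      simp only [Prod.mk.injEq]; tauto), entropy_mixture w r (fun i ω => (A i ω, C i ω)),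
    ← Finset.sum_sub_distrib]
  exact Finset.sum_congr rfl fun i _ => by ring

/-- `negMulLog` is continuous at `0` as well, so no positivity of the masses is needed. This feeds
the compactness argument of the converse. -/
lemma continuous_entropy {X : Type*} [TopologicalSpace X] {r : X → Ω → ℝ}
    (hr : Continuous r) (A : Ω → α) : Continuous fun x => entropy (r x) A := by
  have hr' : ∀ ω, Continuous fun x => r x ω := fun ω => (continuous_apply ω).comp hr
  simp only [entropy, law_eq_sum_mul]
  exact continuous_finsetSum _ fun a _ => Real.continuous_negMulLog.comp (by fun_prop)

lemma continuous_condMutualInfo {X : Type*} [TopologicalSpace X] {r : X → Ω → ℝ}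
    (hr : Continuous r) (A : Ω → α) (B : Ω → β) (C : Ω → γ) :
    Continuous fun x => condMutualInfo (r x) A B C := by
  simp only [condMutualInfo, condEntropy]
  exact ((continuous_entropy hr _).sub (continuous_entropy hr _)).sub
    ((continuous_entropy hr _).sub (continuous_entropy hr _))

end Entropy

/-! ### Product distributions and the weak law of large numbers -/

section Product

variable {ι α β Ω : Type*} [Fintype ι] [DecidableEq ι] [Fintype α] [Fintype β] [Fintype Ω]

lemma sum_prod_eq_prod_sum (w : ι → α → ℝ) : ∑ f : ι → α, ∏ k, w k (f k) = ∏ k, ∑ x, w k x := by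
  classical
  exact (Fintype.prod_sum w).symm

lemma sum_prod_eq_one {w : ι → α → ℝ} (hw : ∀ k, ∑ x, w k x = 1) :
    ∑ f : ι → α, ∏ k, w k (f k) = 1 := by
  simp [sum_prod_eq_prod_sum, hw]

lemma prod_mem_stdSimplex {w : ι → α → ℝ} (hw : ∀ k, w k ∈ stdSimplex ℝ α) :
    (fun f : ι → α => ∏ k, w k (f k)) ∈ stdSimplex ℝ (ι → α) :=
  ⟨fun _ => Finset.prod_nonneg fun k _ => (hw k).1 _, sum_prod_eq_one fun k => (hw k).2⟩

/-- Expectation of a function of one coordinate under a product distribution. -/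
lemma sum_prod_mul_coord {w : ι → α → ℝ} (hw : ∀ k, ∑ x, w k x = 1) (i : ι) (g : α → ℝ) :
    ∑ f : ι → α, (∏ k, w k (f k)) * g (f i) = ∑ x, w i x * g x := by
  classical
  have h1 : ∀ f : ι → α, (∏ k, w k (f k)) * g (f i) =
      ∏ k, (w k (f k) * if k = i then g (f k) else 1) := by
    intro f
    rw [Finset.prod_mul_distrib]
    simp
  simp only [h1]
  rw [sum_prod_eq_prod_sum (fun k x => w k x * if k = i then g x else 1),
    Finset.prod_eq_single i]
  · simp
  · intro k _ hk; simp [hk, hw]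
  · simp

/-- Independence of distinct coordinates: each factor is absorbed into the product as a function
equal to `1` off its coordinate, and the sum factorises. -/
lemma sum_prod_mul_mul {w : ι → α → ℝ} (hw : ∀ k, ∑ x, w k x = 1) {i j : ι} (hij : i ≠ j)
    (g h : α → ℝ) :
    ∑ f : ι → α, (∏ k, w k (f k)) * (g (f i) * h (f j)) =
      (∑ x, w i x * g x) * ∑ x, w j x * h x := by
  classical
  have h1 : ∀ f : ι → α, (∏ k, w k (f k)) * (g (f i) * h (f j)) =
      ∏ k, (w k (f k) * ((if k = i then g (f k) else 1) * if k = j then h (f k) else 1)) := by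
    intro f
    rw [Finset.prod_mul_distrib, Finset.prod_mul_distrib]
    simp
  simp only [h1]
  rw [sum_prod_eq_prod_sum (fun k x => w k x * ((if k = i then g x else 1) * if k = j then h x else 1)),
    Finset.prod_eq_mul i j hij]
  · simp [hij, hij.symm]
  · intro k _ hk; simp [hk.1, hk.2, hw]
  · simp
  · simp

/-- Expectation of a function of two coordinates under a product distribution. -/
lemma sum_prod_mul_coord₂ {w : ι → α → ℝ} (hw : ∀ k, ∑ x, w k x = 1) {i j : ι} (hij : i ≠ j)
    (g : α → α → ℝ) :
    ∑ f : ι → α, (∏ k, w k (f k)) * g (f i) (f j) = ∑ x, w i x * ∑ y, w j y * g x y := by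
  classical
  have h1 : ∀ f : ι → α, (∏ k, w k (f k)) * g (f i) (f j) =
      ∑ a, (∏ k, w k (f k)) * ((if f i = a then 1 else 0) * g a (f j)) := by
    intro f
    rw [← Finset.mul_sum]
    simp
  simp only [h1]
  rw [Finset.sum_comm]
  refine Finset.sum_congr rfl fun a _ => ?_
  rw [sum_prod_mul_mul hw hij (fun x => if x = a then 1 else 0) (g a)]
  simp

lemma law_prod (p : Ω → ℝ) (g : Ω → α) (a : ι → α) :
    law (fun ω : ι → Ω => ∏ i, p (ω i)) (fun ω i => g (ω i)) a = ∏ i, law p g (a i) := by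
  classical
  simp only [law]
  rw [← sum_prod_eq_prod_sum (fun i x => if g x = a i then p x else 0)]
  refine Finset.sum_congr rfl fun ω _ => ?_
  rw [Finset.prod_ite_zero]
  simp [funext_iff]

/-- Expectation of a function of the letterwise image of an i.i.d. block. -/
lemma sum_prod_comp (p : Ω → ℝ) (g : Ω → α) (G : (ι → α) → ℝ) :
    ∑ ω : ι → Ω, (∏ i, p (ω i)) * G (fun i => g (ω i)) =
      ∑ a : ι → α, (∏ i, law p g (a i)) * G a := by
  simp only [← law_prod p g]
  rw [sum_law_mul]

lemma sum_arrow_prod (G : (ι → α × β) → ℝ) :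
    ∑ f, G f = ∑ a : ι → α, ∑ b : ι → β, G (fun i => (a i, b i)) := by
  classical
  rw [← (Equiv.arrowProdEquivProdArrow ι (fun _ => α) (fun _ => β)).symm.sum_comp, Fintype.sum_prod_type]
  rfl

/-- The entropy of a product distribution is the sum of the entropies. -/
lemma sum_negMulLog_prod {w : ι → α → ℝ} (hw : ∀ k, ∑ x, w k x = 1) :
    ∑ f : ι → α, Real.negMulLog (∏ k, w k (f k)) = ∑ k, ∑ x, Real.negMulLog (w k x) := by
  have h1 : ∀ f : ι → α, Real.negMulLog (∏ k, w k (f k)) =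
      ∑ i, (∏ k, w k (f k)) * (-Real.log (w i (f i))) := by
    intro f
    rw [← Finset.mul_sum, Finset.sum_neg_distrib, Real.negMulLog]
    by_cases h : ∏ k, w k (f k) = 0
    · simp [h]
    · rw [Real.log_prod (fun k _ => by
        intro hk; exact h (Finset.prod_eq_zero (Finset.mem_univ k) hk))]
      ring
  simp only [h1]
  rw [Finset.sum_comm]
  refine Finset.sum_congr rfl fun i _ => ?_
  rw [sum_prod_mul_coord hw i (fun x => -Real.log (w i x))]
  exact Finset.sum_congr rfl fun x _ => by rw [Real.negMulLog]; ring

/-- The probabilistic method: some outcome does no worse than the mean. This extracts deterministic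
codebooks from random ones. -/
lemma exists_le_of_sum_mul_le {w : α → ℝ} (hw : w ∈ stdSimplex ℝ α) {f : α → ℝ} {B : ℝ}
    (h : ∑ x, w x * f x ≤ B) : ∃ x, f x ≤ B := by
  by_contra! hcon
  have hne : ∃ x, 0 < w x := by
    by_contra! h0
    have := Finset.sum_nonpos fun x (_ : x ∈ Finset.univ) => h0 x
    rw [hw.2] at this
    linarith
  obtain ⟨x, hx⟩ := hne
  have : ∑ x, w x * B < ∑ x, w x * f x :=
    Finset.sum_lt_sum (fun y _ => mul_le_mul_of_nonneg_left (hcon y).le (hw.1 y))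
      ⟨x, Finset.mem_univ x, mul_lt_mul_of_pos_left (hcon x) hx⟩
  rw [← Finset.sum_mul, hw.2] at this
  linarith

/-- Variance of a sum of centred independent letters: the cross terms vanish. -/
lemma sum_prod_mul_sq {n : ℕ} {p : Ω → ℝ} (hp : p ∈ stdSimplex ℝ Ω) {g : Ω → ℝ}
    (hg : ∑ ω, p ω * g ω = 0) :
    ∑ ω : Fin n → Ω, (∏ i, p (ω i)) * (∑ i, g (ω i)) ^ 2 = n * ∑ ω, p ω * g ω ^ 2 := by
  have h1 : ∀ ω : Fin n → Ω, (∏ i, p (ω i)) * (∑ i, g (ω i)) ^ 2 =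
      ∑ i, ∑ j, (∏ i, p (ω i)) * (g (ω i) * g (ω j)) := by
    intro ω
    rw [sq, Finset.sum_mul_sum, Finset.mul_sum]
    simp only [Finset.mul_sum]
  simp only [h1]
  rw [Finset.sum_comm]
  have h2 : ∀ i : Fin n, ∑ ω : Fin n → Ω, ∑ j, (∏ i, p (ω i)) * (g (ω i) * g (ω j)) =
      ∑ ω, p ω * g ω ^ 2 := by
    intro i
    rw [Finset.sum_comm, Finset.sum_eq_single i]
    · rw [sum_prod_mul_coord (w := fun _ => p) (fun _ => hp.2) i (fun x => g x * g x)]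
      simp only [sq]
    · intro j _ hj
      rw [sum_prod_mul_mul (w := fun _ => p) (fun _ => hp.2) hj.symm g g, hg, zero_mul]
    · simp
  simp [h2]

open Classical in
/-- Weak law of large numbers. -/
lemma tendsto_prob_deviation {p : Ω → ℝ} (hp : p ∈ stdSimplex ℝ Ω) (f : Ω → ℝ) {δ : ℝ} (hδ : 0 < δ) :
    Tendsto (fun n : ℕ => ∑ ω : Fin n → Ω, (∏ i, p (ω i)) *
      if n * δ < |∑ i, f (ω i) - n * ∑ x, p x * f x| then 1 else 0) atTop (nhds 0) := by
  set μ := ∑ x, p x * f x with hμ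
  set v := ∑ x, p x * (f x - μ) ^ 2 with hv
  have hlim : Tendsto (fun n : ℕ => (v / δ ^ 2) / (n : ℝ)) atTop (nhds 0) :=
    tendsto_const_div_atTop_nhds_zero_nat _
  refine squeeze_zero' (Eventually.of_forall fun n => Finset.sum_nonneg fun ω _ =>
    mul_nonneg (Finset.prod_nonneg fun i _ => hp.1 _) (by split_ifs <;> norm_num)) ?_ hlim
  filter_upwards [eventually_gt_atTop 0] with n hn
  have hn' : (0 : ℝ) < n := by exact_mod_cast hn
  have hz : ∑ ω, p ω * (f ω - μ) = 0 := by
    simp only [mul_sub, Finset.sum_sub_distrib, ← Finset.sum_mul, hp.2, one_mul, ← hμ, sub_self]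
  have hsq := sum_prod_mul_sq (n := n) hp hz
  -- Chebyshev: the indicator of the deviation is at most the squared deviation over `(n δ)²`.
  have hle : ∑ ω : Fin n → Ω, (∏ i, p (ω i)) *
      (if n * δ < |∑ i, f (ω i) - n * μ| then 1 else 0) ≤
      ∑ ω : Fin n → Ω, (∏ i, p (ω i)) * (∑ i, (f (ω i) - μ)) ^ 2 / (n * δ) ^ 2 := by
    refine Finset.sum_le_sum fun ω _ => ?_
    rw [mul_div_assoc]
    refine mul_le_mul_of_nonneg_left ?_ (Finset.prod_nonneg fun i _ => hp.1 _)
    split_ifs with h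
    · rw [one_le_div (by positivity), ← sq_abs (∑ i, (f (ω i) - μ))]
      refine pow_le_pow_left₀ (by positivity) ?_ 2
      simp only [Finset.sum_sub_distrib, Finset.sum_const, Finset.card_univ, Fintype.card_fin,
        nsmul_eq_mul]
      exact h.le
    · positivity
  refine hle.trans_eq ?_
  rw [← Finset.sum_div, hsq]
  field_simp
  rfl

end Product

/-! ### Conditional laws and test channels -/

section Kernel

variable {Ω α β γ : Type*} [Fintype Ω] [Fintype α] [Fintype β] [Fintype γ]

lemma nonempty_of_mem_stdSimplex {r : Ω → ℝ} (hr : r ∈ stdSimplex ℝ Ω) : Nonempty Ω := by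
  by_contra h
  rw [not_nonempty_iff] at h
  simpa using hr.2

lemma law_of_injective (r : Ω → ℝ) {A : Ω → α} (hA : Function.Injective A) (ω : Ω) :
    law r A (A ω) = r ω := by
  classical
  simp only [law, hA.eq_iff]
  exact sum_ite_eq_any ω r

lemma dirac_mem_stdSimplex [DecidableEq α] (a : α) :
    (fun x => if x = a then (1 : ℝ) else 0) ∈ stdSimplex ℝ α :=
  ⟨fun x => by dsimp only; split_ifs <;> norm_num, by simp⟩

/-- Existence of a regular conditional distribution. -/
lemma exists_kernel [Nonempty α] {r : Ω → ℝ} (hr : ∀ ω, 0 ≤ r ω) (A : Ω → α) (C : Ω → γ) :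
    ∃ K : γ → α → ℝ, (∀ c, K c ∈ stdSimplex ℝ α) ∧
      ∀ a c, law r (fun ω => (A ω, C ω)) (a, c) = law r C c * K c a := by
  classical
  obtain ⟨a₀⟩ := ‹Nonempty α›
  -- On values of `C` of probability zero any law will do; a point mass keeps the kernel stochastic
  -- everywhere.
  refine ⟨fun c a => if law r C c = 0 then (if a = a₀ then 1 else 0) else
    law r (fun ω => (A ω, C ω)) (a, c) / law r C c, fun c => ?_, fun a c => ?_⟩
  · by_cases h : law r C c = 0
    · simp only [h, if_true]
      exact dirac_mem_stdSimplex a₀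
    · simp only [h, if_false]
      refine ⟨fun a => div_nonneg (law_nonneg hr _ _) (law_nonneg hr _ _), ?_⟩
      rw [← Finset.sum_div, sum_law_pair, div_self h]
  · by_cases h : law r C c = 0
    · have h1 : law r (fun ω => (A ω, C ω)) (a, c) ≤ law r C c := law_mono hr (by simp +contextual)
      have := law_nonneg hr (fun ω => (A ω, C ω)) (a, c)
      simp only [h, zero_mul]
      linarith
    · simp only [h, if_false]
      field_simp

end Kernel

section TestChannel

variable {σ ζ τ : Type*} [Fintype σ] [Fintype ζ] [Fintype τ]

/-- The joint law of `(S, Z, T)` when `(S, Z) ∼ r` and `T` is drawn from `V(· | s, z)`. -/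
def jointLaw (r : σ × ζ → ℝ) (V : σ → ζ → τ → ℝ) : σ × ζ × τ → ℝ :=
  fun a => r (a.1, a.2.1) * V a.1 a.2.1 a.2.2

/-- `I(S ; T | Z)` for the test channel `V`. -/
def testInfo (r : σ × ζ → ℝ) (V : σ → ζ → τ → ℝ) : ℝ :=
  condMutualInfo (jointLaw r V) (fun a => a.1) (fun a => a.2.2) (fun a => a.2.1)

/-- The expected distortion `E d(S, T)` for the test channel `V`. -/
def testDist (r : σ × ζ → ℝ) (V : σ → ζ → τ → ℝ) (d : σ → τ → ℝ) : ℝ :=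
  ∑ a, jointLaw r V a * d a.1 a.2.2

variable {r : σ × ζ → ℝ} {V : σ → ζ → τ → ℝ}

lemma jointLaw_nonneg (hr : ∀ a, 0 ≤ r a) (hV : ∀ s z, V s z ∈ stdSimplex ℝ τ)
    (a : σ × ζ × τ) : 0 ≤ jointLaw r V a :=
  mul_nonneg (hr _) ((hV _ _).1 _)

lemma jointLaw_mem_stdSimplex (hr : r ∈ stdSimplex ℝ (σ × ζ)) (hV : ∀ s z, V s z ∈ stdSimplex ℝ τ) :
    jointLaw r V ∈ stdSimplex ℝ (σ × ζ × τ) := by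
  refine ⟨jointLaw_nonneg hr.1 hV, ?_⟩
  rw [← hr.2]
  simp only [Fintype.sum_prod_type, jointLaw, ← Finset.mul_sum, (hV _ _).2, mul_one]

lemma law_jointLaw_perm (r : σ × ζ → ℝ) (V : σ → ζ → τ → ℝ) (s : σ) (t : τ) (z : ζ) :
    law (jointLaw r V) (fun a => (a.1, a.2.2, a.2.1)) (s, t, z) = r (s, z) * V s z t :=
  law_of_injective (jointLaw r V) (A := fun a => (a.1, a.2.2, a.2.1))
    (fun a b h => by simp only [Prod.mk.injEq] at h; ext <;> simp [h]) (s, z, t)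

lemma law_jointLaw_source (hV : ∀ s z, V s z ∈ stdSimplex ℝ τ) :
    law (jointLaw r V) (fun a => (a.1, a.2.1)) = r := by
  funext x
  rw [← sum_law_pair (jointLaw r V) (fun a => a.2.2) (fun a => (a.1, a.2.1)) x]
  have h : ∀ t, law (jointLaw r V) (fun a => (a.2.2, a.1, a.2.1)) (t, x) = r x * V x.1 x.2 t :=
    fun t => law_of_injective (jointLaw r V) (A := fun a => (a.2.2, a.1, a.2.1))
      (fun a b h => by simp only [Prod.mk.injEq] at h; ext <;> simp [h]) (x.1, x.2, t)
  simp only [h, ← Finset.mul_sum, (hV _ _).2, mul_one]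

lemma law_jointLaw_side (hV : ∀ s z, V s z ∈ stdSimplex ℝ τ) :
    law (jointLaw r V) (fun a => a.2.1) = law r (fun a => a.2) := by
  rw [← law_jointLaw_source (r := r) hV, law_comp, law_jointLaw_source hV]

/-- The conditional law of the test channel output given the side information. -/
lemma exists_outputKernel (hr : r ∈ stdSimplex ℝ (σ × ζ)) (hV : ∀ s z, V s z ∈ stdSimplex ℝ τ) :
    ∃ q : ζ → τ → ℝ, (∀ z, q z ∈ stdSimplex ℝ τ) ∧
      (∀ t z, law (jointLaw r V) (fun a => (a.2.2, a.2.1)) (t, z) =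
        law r (fun a => a.2) z * q z t) := by
  obtain ⟨⟨_, _, t⟩⟩ := nonempty_of_mem_stdSimplex (jointLaw_mem_stdSimplex hr hV)
  have : Nonempty τ := ⟨t⟩
  obtain ⟨q, hq, h⟩ := exists_kernel (jointLaw_nonneg hr.1 hV) (fun a => a.2.2) (fun a => a.2.1)
  exact ⟨q, hq, fun t z => by rw [h, law_jointLaw_side hV]⟩

/-- On the support of the joint law all four factors are positive, so logarithms of products split.
Off the support the terms carry weight zero. -/
lemma outputKernel_pos (hr : r ∈ stdSimplex ℝ (σ × ζ)) (hV : ∀ s z, V s z ∈ stdSimplex ℝ τ)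
    {q : ζ → τ → ℝ} (hq : ∀ z, q z ∈ stdSimplex ℝ τ)
    (h : ∀ t z, law (jointLaw r V) (fun a => (a.2.2, a.2.1)) (t, z) = law r (fun a => a.2) z * q z t)
    {a : σ × ζ × τ} (ha : jointLaw r V a ≠ 0) :
    0 < r (a.1, a.2.1) ∧ 0 < V a.1 a.2.1 a.2.2 ∧ 0 < law r (fun a => a.2) a.2.1 ∧
      0 < q a.2.1 a.2.2 := by
  have h1 := left_ne_zero_of_mul ha
  have h2 := right_ne_zero_of_mul ha
  have h3 : jointLaw r V a ≤ _ := le_law (jointLaw_nonneg hr.1 hV) (fun a => (a.2.2, a.2.1)) a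
  rw [h] at h3
  have h4 := lt_of_le_of_ne (jointLaw_nonneg hr.1 hV a) ha.symm
  have h5 := h4.trans_le h3
  have h6 := law_nonneg hr.1 (fun a => a.2) a.2.1
  refine ⟨lt_of_le_of_ne (hr.1 _) h1.symm, lt_of_le_of_ne ((hV _ _).1 _) h2.symm,
    lt_of_le_of_ne h6 fun h => ?_, lt_of_le_of_ne ((hq _).1 _) fun h => ?_⟩
  · rw [← h] at h5; simp at h5
  · rw [← h] at h5; simp at h5

/-- `I(S ; T | Z)` as the mean of `log V(T | S, Z) - log q(T | Z)`. -/
lemma testInfo_eq_sum (hr : r ∈ stdSimplex ℝ (σ × ζ)) (hV : ∀ s z, V s z ∈ stdSimplex ℝ τ)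
    {q : ζ → τ → ℝ} (hq : ∀ z, q z ∈ stdSimplex ℝ τ)
    (h : ∀ t z, law (jointLaw r V) (fun a => (a.2.2, a.2.1)) (t, z) =
      law r (fun a => a.2) z * q z t) :
    testInfo r V = ∑ a, jointLaw r V a *
      (Real.log (V a.1 a.2.1 a.2.2) - Real.log (q a.2.1 a.2.2)) := by
  rw [testInfo, condMutualInfo_eq_sum]
  refine Finset.sum_congr rfl fun a _ => ?_
  by_cases ha : jointLaw r V a = 0
  · simp [ha]
  obtain ⟨h1, h2, h3, h4⟩ := outputKernel_pos hr hV hq h ha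
  rw [law_jointLaw_perm, law_jointLaw_side hV, law_jointLaw_source hV, h,
    Real.log_mul h1.ne' h2.ne', Real.log_mul h3.ne' h4.ne']
  ring

/-- A test channel that conveys no information is no better than a function of the side
information. -/
lemma exists_estimator_of_testInfo_eq_zero (hr : r ∈ stdSimplex ℝ (σ × ζ))
    (hV : ∀ s z, V s z ∈ stdSimplex ℝ τ) (h0 : testInfo r V = 0) (d : σ → τ → ℝ) :
    ∃ f : ζ → τ, ∑ x, r x * d x.1 (f x.2) ≤ testDist r V d := by
  obtain ⟨q, hq, h⟩ := exists_outputKernel hr hV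
  have hi := (condMutualInfo_eq_zero_iff (jointLaw_nonneg hr.1 hV) _ _ _).1 h0
  -- Zero information means `S` and `T` are independent given `Z`, so `V(t|s,z)` may be replaced by
  -- `q(t|z)` wherever `r (s, z)` is positive.
  have hrV : ∀ s z t, r (s, z) * V s z t = r (s, z) * q z t := by
    intro s z t
    have := hi s t z
    rw [law_jointLaw_perm, law_jointLaw_side hV, law_jointLaw_source hV, h] at this
    have hle := le_law hr.1 (fun a => a.2) (s, z)
    have hn := hr.1 (s, z)
    by_cases hz : law r (fun a => a.2) z = 0
    · simp only [hz] at hle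
      simp [show r (s, z) = 0 by linarith]
    · exact mul_right_cancel₀ hz (by linarith)
  have hdist : testDist r V d = ∑ z, ∑ t, q z t * ∑ s, r (s, z) * d s t := by
    simp only [testDist, jointLaw, hrV, Fintype.sum_prod_type]
    rw [Finset.sum_comm]
    refine Finset.sum_congr rfl fun z _ => ?_
    rw [Finset.sum_comm]
    refine Finset.sum_congr rfl fun t _ => ?_
    rw [Finset.mul_sum]
    exact Finset.sum_congr rfl fun s _ => by ring
  -- For each `z` the cost is a `q z`-average over letters `t`; some letter is at least as good as
  -- the average.
  choose f hf using fun z => exists_le_of_sum_mul_le (hq z)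
    (f := fun t => ∑ s, r (s, z) * d s t) le_rfl
  refine ⟨f, ?_⟩
  rw [hdist, Fintype.sum_prod_type, Finset.sum_comm]
  exact Finset.sum_le_sum fun z _ => hf z

end TestChannel

/-! ### Source coding with side information -/

section SourceCoding

open Classical in
lemma sum_mul_ite_not {U : Type*} [Fintype U] {w : U → ℝ} (hw : ∑ u, w u = 1) (A : U → Prop) :
    ∑ u, w u * (if A u then (0 : ℝ) else 1) = 1 - ∑ u, w u * if A u then (1 : ℝ) else 0 := by
  rw [eq_sub_iff_add_eq, ← Finset.sum_add_distrib]
  exact (Finset.sum_congr rfl fun u _ => by split_ifs <;> ring).trans hw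

open Classical in
/-- One-shot covering by a random codebook. -/
lemma exists_codebook {S U : Type*} [Fintype S] [Fintype U] {a : S → ℝ} (ha : ∀ s, 0 ≤ a s)
    {V : S → U → ℝ} (hV : ∀ s, V s ∈ stdSimplex ℝ U) {Q : U → ℝ} (hQ : Q ∈ stdSimplex ℝ U)
    {A : S → U → Prop} {K : ℝ} (hK : 0 < K) (hA : ∀ s u, A s u → V s u ≤ K * Q u) (M : ℕ) :
    ∃ c : Fin M → U, ∑ s, a s * (if ∀ m, ¬ A s (c m) then 1 else 0) ≤
      ∑ s, a s * (∑ u, V s u * (if A s u then 0 else 1) + Real.exp (-(M / K))) := by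
  refine exists_le_of_sum_mul_le (prod_mem_stdSimplex (ι := Fin M) (fun _ => hQ)) ?_
  simp only [Finset.mul_sum]
  rw [Finset.sum_comm]
  refine Finset.sum_le_sum fun s _ => ?_
  -- The codewords are independent, so all `M` miss with the `M`-th power of the probability that
  -- one misses.
  have h1 : ∑ c : Fin M → U, (∏ m, Q (c m)) * (a s * if ∀ m, ¬ A s (c m) then 1 else 0) =
      a s * (∑ u, Q u * if A s u then 0 else 1) ^ M := by
    rw [← Finset.card_fin M, ← Finset.prod_const, Finset.card_fin,
      ← sum_prod_eq_prod_sum (fun (_ : Fin M) u => Q u * if A s u then 0 else 1), Finset.mul_sum]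
    refine Finset.sum_congr rfl fun c _ => ?_
    rw [Finset.prod_mul_distrib]
    have : (∏ m, if A s (c m) then (0 : ℝ) else 1) = if ∀ m, ¬ A s (c m) then 1 else 0 := by
      simp only [← ite_not (p := A s _)]
      rw [Finset.prod_ite_zero]
      simp
    rw [this]; ring
  rw [h1]
  refine mul_le_mul_of_nonneg_left ?_ (ha s)
  set x := ∑ u, Q u * if A s u then (1 : ℝ) else 0 with hx
  set y := ∑ u, V s u * if A s u then (1 : ℝ) else 0 with hy
  have hx1 : ∑ u, Q u * (if A s u then (0 : ℝ) else 1) = 1 - x :=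
    sum_mul_ite_not hQ.2 _
  have hy1 : ∑ u, V s u * (if A s u then (0 : ℝ) else 1) = 1 - y :=
    sum_mul_ite_not (hV s).2 _
  -- On `A` the density of `V` against `Q` is at most `K`, so drawing from `Q` instead of `V` costs
  -- at most a factor `K`.
  have hyx : y / K ≤ x := by
    rw [div_le_iff₀ hK, hx, Finset.sum_mul]
    refine Finset.sum_le_sum fun u _ => ?_
    split_ifs with h
    · linarith [hA s u h]
    · simp
  have hy0 : 0 ≤ y := Finset.sum_nonneg fun u _ =>
    mul_nonneg ((hV s).1 u) (by split_ifs <;> norm_num)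
  have hy01 : 0 ≤ 1 - y := hy1 ▸ Finset.sum_nonneg fun u _ =>
    mul_nonneg ((hV s).1 u) (by split_ifs <;> norm_num)
  have hx01 : 0 ≤ 1 - x := hx1 ▸ Finset.sum_nonneg fun u _ =>
    mul_nonneg (hQ.1 u) (by split_ifs <;> norm_num)
  rw [hx1, hy1]
  -- The chord of `exp` between `-(M/K)` and `0`, at weight `y`, splits the failure into the mass `1
  -- - y` outside `A` and a doubly exponentially small rest.
  have hc := convexOn_exp.2 (Set.mem_univ (0 : ℝ)) (Set.mem_univ (-(M / K) : ℝ)) hy01 hy0 (by ring)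
  simp only [smul_eq_mul, mul_zero, Real.exp_zero, mul_one, zero_add] at hc
  calc (1 - x) ^ M ≤ Real.exp (-x) ^ M :=
        pow_le_pow_left₀ hx01 (by linarith [Real.add_one_le_exp (-x)]) M
    _ = Real.exp (-(M * x)) := by rw [← Real.exp_nat_mul]; congr 1; ring
    _ ≤ Real.exp (y * -(M / K)) := by
        refine Real.exp_le_exp.2 ?_
        have := mul_le_mul_of_nonneg_left hyx (Nat.cast_nonneg (α := ℝ) M)
        have e : y * -(M / K) = -(M * (y / K)) := by ring
        rw [e]; linarith
    _ ≤ 1 - y + y * Real.exp (-(M / K)) := hc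
    _ ≤ 1 - y + Real.exp (-(M / K)) := by
        nlinarith [Real.exp_pos (-(M / K : ℝ))]

variable {σ ζ τ : Type*} [Fintype σ] [Fintype ζ] [Fintype τ]

lemma exists_distortion_bound (d : σ → τ → ℝ) : ∃ B, 0 ≤ B ∧ ∀ s t, |d s t| ≤ B := by
  refine ⟨∑ s, ∑ t, |d s t|, Finset.sum_nonneg fun s _ => Finset.sum_nonneg fun t _ => abs_nonneg _,
    fun s t => ?_⟩
  exact (Finset.single_le_sum (f := fun t => |d s t|) (fun _ _ => abs_nonneg _)
    (Finset.mem_univ t)).trans (Finset.single_le_sum (f := fun s => ∑ t, |d s t|)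
      (fun _ _ => Finset.sum_nonneg fun t _ => abs_nonneg _) (Finset.mem_univ s))

lemma abs_blockDist_le {d : σ → τ → ℝ} {B : ℝ} (hB0 : 0 ≤ B) (hB : ∀ s t, |d s t| ≤ B) {n : ℕ}
    (s : Fin n → σ) (t : Fin n → τ) : |blockDist d s t| ≤ B := by
  rw [blockDist, abs_div, Nat.abs_cast]
  refine div_le_of_le_mul₀ (Nat.cast_nonneg _) hB0 ?_
  refine (Finset.abs_sum_le_sum_abs _ _).trans ?_
  refine (Finset.sum_le_sum fun i _ => hB (s i) (t i)).trans ?_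
  simp [mul_comm]

/-- Expected distortion of a letterwise estimate. -/
lemma sum_prod_mul_blockDist {n : ℕ} (hn : 0 < n) {r : σ × ζ → ℝ} (hr : r ∈ stdSimplex ℝ (σ × ζ))
    (d : σ → τ → ℝ) (f : ζ → τ) :
    ∑ ω : Fin n → σ × ζ, (∏ i, r (ω i)) *
      blockDist d (fun i => (ω i).1) (fun i => f (ω i).2) = ∑ x, r x * d x.1 (f x.2) := by
  have hn' : (n : ℝ) ≠ 0 := by positivity
  simp only [blockDist, mul_div_assoc', ← Finset.sum_div, Finset.mul_sum]
  rw [Finset.sum_comm]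
  have : ∀ i : Fin n, ∑ ω : Fin n → σ × ζ, (∏ i, r (ω i)) * d (ω i).1 (f (ω i).2) =
      ∑ x, r x * d x.1 (f x.2) := fun i =>
    sum_prod_mul_coord (w := fun _ => r) (fun _ => hr.2) i (fun x => d x.1 (f x.2))
  simp only [this, Finset.sum_const, Finset.card_univ, Fintype.card_fin, nsmul_eq_mul]
  field_simp

open Classical in
/-- The pairs `(s^n, t^n)` at which either the information density or the distortion exceeds its
threshold are covered by two large deviation events. -/
lemma sum_prod_jointLaw_le {r : σ × ζ → ℝ} (hr : r ∈ stdSimplex ℝ (σ × ζ)) {V : σ → ζ → τ → ℝ}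
    (hV : ∀ s z, V s z ∈ stdSimplex ℝ τ) {q : ζ → τ → ℝ} (hq : ∀ z, q z ∈ stdSimplex ℝ τ)
    (h : ∀ t z, law (jointLaw r V) (fun a => (a.2.2, a.2.1)) (t, z) = law r (fun a => a.2) z * q z t)
    (d : σ → τ → ℝ) {D δ η : ℝ} (hD : testDist r V d ≤ D) {n : ℕ} (hn : 0 < n) :
    ∑ ω : Fin n → σ × ζ × τ, (∏ i, jointLaw r V (ω i)) *
      (if (∏ i, V (ω i).1 (ω i).2.1 (ω i).2.2 ≤ Real.exp (n * (testInfo r V + δ)) *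
          ∏ i, q (ω i).2.1 (ω i).2.2) ∧
        blockDist d (fun i => (ω i).1) (fun i => (ω i).2.2) ≤ D + η then 0 else 1) ≤
    (∑ ω : Fin n → σ × ζ × τ, (∏ i, jointLaw r V (ω i)) * if n * δ <
      |∑ i, (Real.log (V (ω i).1 (ω i).2.1 (ω i).2.2) - Real.log (q (ω i).2.1 (ω i).2.2)) -
        n * ∑ a, jointLaw r V a * (Real.log (V a.1 a.2.1 a.2.2) - Real.log (q a.2.1 a.2.2))|
        then 1 else 0) +
    ∑ ω : Fin n → σ × ζ × τ, (∏ i, jointLaw r V (ω i)) * if n * η <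
      |∑ i, d (ω i).1 (ω i).2.2 - n * ∑ a, jointLaw r V a * d a.1 a.2.2| then 1 else 0 := by
  have hn' : (0 : ℝ) < n := by exact_mod_cast hn
  rw [← Finset.sum_add_distrib]
  refine Finset.sum_le_sum fun ω _ => ?_
  rw [← mul_add]
  have hnn : 0 ≤ ∏ i, jointLaw r V (ω i) := Finset.prod_nonneg fun i _ => jointLaw_nonneg hr.1 hV _
  rcases hnn.eq_or_lt with h0 | h0
  · simp [← h0]
  refine mul_le_mul_of_nonneg_left ?_ hnn
  have hpos := fun i => outputKernel_pos hr hV hq h (a := ω i)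
    (fun hz => h0.ne' (Finset.prod_eq_zero (Finset.mem_univ i) hz))
  have hite : ∀ P : Prop, (0 : ℝ) ≤ if P then 1 else 0 := fun P => by split_ifs <;> norm_num
  by_cases hA : (∏ i, V (ω i).1 (ω i).2.1 (ω i).2.2 ≤ Real.exp (n * (testInfo r V + δ)) *
      ∏ i, q (ω i).2.1 (ω i).2.2) ∧ blockDist d (fun i => (ω i).1) (fun i => (ω i).2.2) ≤ D + η
  · rw [if_pos hA]
    exact add_nonneg (hite _) (hite _)
  rw [if_neg hA]
  rw [not_and_or, not_le, not_le] at hA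
  rcases hA with hA | hA
  · refine le_add_of_le_of_nonneg (le_of_eq (if_pos ?_).symm) (hite _)
    refine lt_of_lt_of_le ?_ (le_abs_self _)
    rw [← testInfo_eq_sum hr hV hq h, Finset.sum_sub_distrib,
      ← Real.log_prod (fun i _ => (hpos i).2.1.ne'), ← Real.log_prod (fun i _ => (hpos i).2.2.2.ne')]
    have hqp : 0 < ∏ i, q (ω i).2.1 (ω i).2.2 := Finset.prod_pos fun i _ => (hpos i).2.2.2
    have := Real.log_lt_log (by positivity) hA
    rw [Real.log_mul (Real.exp_pos _).ne' hqp.ne', Real.log_exp] at this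
    linarith
  · refine le_add_of_nonneg_of_le (hite _) (le_of_eq (if_pos ?_).symm)
    refine lt_of_lt_of_le ?_ (le_abs_self _)
    rw [blockDist, lt_div_iff₀ hn'] at hA
    rw [testDist] at hD
    have := mul_le_mul_of_nonneg_left hD hn'.le
    linarith

/-- Achievability of the conditional rate distortion trade-off. -/
theorem eventually_exists_sourceCode {r : σ × ζ → ℝ} (hr : r ∈ stdSimplex ℝ (σ × ζ))
    {V : σ → ζ → τ → ℝ} (hV : ∀ s z, V s z ∈ stdSimplex ℝ τ) (d : σ → τ → ℝ) {ρ D ε : ℝ}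
    (hρ : testInfo r V < ρ) (hD : testDist r V d ≤ D) (hε : 0 < ε) :
    ∀ᶠ n : ℕ in atTop, ∃ M : ℕ, 0 < M ∧ (M : ℝ) - 1 ≤ Real.exp (n * ρ) ∧
      ∃ (enc : (Fin n → σ) → (Fin n → ζ) → Fin M) (dec : Fin M → (Fin n → ζ) → (Fin n → τ)),
        ∑ ω : Fin n → σ × ζ, (∏ i, r (ω i)) * blockDist d (fun i => (ω i).1)
          (dec (enc (fun i => (ω i).1) (fun i => (ω i).2)) (fun i => (ω i).2)) ≤ D + ε := by
  classical
  obtain ⟨q, hq, h⟩ := exists_outputKernel hr hV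
  obtain ⟨B, hB0, hB⟩ := exists_distortion_bound d
  -- Half the gap goes into the density threshold `K = exp (n (I + δ))`; the other half gives `M / K
  -- ≥ exp (n δ)`.
  set δ := (ρ - testInfo r V) / 2 with hδ
  have hδ0 : 0 < δ := by rw [hδ]; linarith
  have t1 := tendsto_prob_deviation (jointLaw_mem_stdSimplex hr hV)
    (fun a => Real.log (V a.1 a.2.1 a.2.2) - Real.log (q a.2.1 a.2.2)) hδ0
  have t2 := tendsto_prob_deviation (jointLaw_mem_stdSimplex hr hV)
    (fun a => d a.1 a.2.2) (half_pos hε)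
  have t3 : Tendsto (fun n : ℕ => Real.exp (-Real.exp (n * δ))) atTop (nhds 0) := by
    refine Real.tendsto_exp_neg_atTop_nhds_zero.comp (Real.tendsto_exp_atTop.comp ?_)
    exact tendsto_natCast_atTop_atTop.atTop_mul_const hδ0
  -- `B + |D| + ε` bounds the excess of any block distortion over `D + ε/2`, hence the price of a
  -- covering failure.
  have t4 := ((t1.add t2).add t3).const_mul (B + |D| + ε)
  simp only [add_zero, mul_zero] at t4
  filter_upwards [t4.eventually (gt_mem_nhds (half_pos hε)), eventually_gt_atTop 0] with n hn hn0
  have hbad := sum_prod_jointLaw_le hr hV hq h d (δ := δ) (η := ε / 2) hD hn0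
  set K := Real.exp (n * (testInfo r V + δ)) with hK
  have hK0 : 0 < K := Real.exp_pos _
  have hM0 : 0 < ⌈Real.exp (n * ρ)⌉₊ := Nat.ceil_pos.2 (Real.exp_pos _)
  set M := ⌈Real.exp (n * ρ)⌉₊ with hM
  obtain ⟨A, hAdef⟩ : ∃ A : (Fin n → ζ) → (Fin n → σ) → (Fin n → τ) → Prop, ∀ z s u, A z s u ↔
      (∏ i, V (s i) (z i) (u i) ≤ K * ∏ i, q (z i) (u i)) ∧ blockDist d s u ≤ D + ε / 2 :=
    ⟨_, fun _ _ _ => Iff.rfl⟩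
  -- Both ends know `z`, so each `z` has its own codebook and no binning is required.
  have hcb := fun z : Fin n → ζ => exists_codebook (a := fun s : Fin n → σ => ∏ i, r (s i, z i))
    (fun s => Finset.prod_nonneg fun i _ => hr.1 _)
    (V := fun s u => ∏ i, V (s i) (z i) (u i)) (fun s => prod_mem_stdSimplex fun i => hV (s i) (z i))
    (prod_mem_stdSimplex fun i => hq (z i)) (A := A z) hK0 (fun s u hA => ((hAdef _ _ _).1 hA).1) M
  choose c hc using hcb
  -- The ceiling exceeds `exp (n ρ)` by less than one, hence the form `M - 1`. The encoder sends an
  -- index whose codeword lies in `A`, and `0` if there is none.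
  refine ⟨M, hM0, by linarith [Nat.ceil_lt_add_one (Real.exp_pos (n * ρ)).le],
    fun s z => if hm : ∃ m, A z s (c z m) then hm.choose else ⟨0, hM0⟩, fun m z => c z m, ?_⟩
  have hfail : ∑ z : Fin n → ζ, ∑ s : Fin n → σ, (∏ i, r (s i, z i)) *
      (if ∀ m, ¬ A z s (c z m) then 1 else 0) ≤ ε / 2 / (B + |D| + ε) := by
    refine (Finset.sum_le_sum fun z _ => hc z).trans ?_
    have hsum1 : ∑ z : Fin n → ζ, ∑ s : Fin n → σ, ∏ i, r (s i, z i) = 1 := by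
      rw [Finset.sum_comm, ← sum_arrow_prod (fun ω : Fin n → σ × ζ => ∏ i, r (ω i))]
      exact sum_prod_eq_one (w := fun _ => r) fun _ => hr.2
    have hexp : Real.exp (-(M / K)) ≤ Real.exp (-Real.exp (n * δ)) := by
      refine Real.exp_le_exp.2 (neg_le_neg ?_)
      rw [le_div_iff₀ hK0, hK, ← Real.exp_add]
      refine le_trans (Real.exp_le_exp.2 (le_of_eq ?_)) (Nat.le_ceil _)
      rw [hδ]; ring
    have hfirst : ∑ z : Fin n → ζ, ∑ s : Fin n → σ, (∏ i, r (s i, z i)) *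
        (∑ u : Fin n → τ, (∏ i, V (s i) (z i) (u i)) * if A z s u then 0 else 1) =
        ∑ ω : Fin n → σ × ζ × τ, (∏ i, jointLaw r V (ω i)) *
          (if (∏ i, V (ω i).1 (ω i).2.1 (ω i).2.2 ≤ K * ∏ i, q (ω i).2.1 (ω i).2.2) ∧
            blockDist d (fun i => (ω i).1) (fun i => (ω i).2.2) ≤ D + ε / 2 then 0 else 1) := by
      rw [sum_arrow_prod, Finset.sum_comm]
      refine Finset.sum_congr rfl fun s _ => ?_
      rw [sum_arrow_prod]
      refine Finset.sum_congr rfl fun z _ => ?_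
      rw [Finset.mul_sum]
      refine Finset.sum_congr rfl fun u _ => ?_
      simp only [jointLaw, Finset.prod_mul_distrib, mul_assoc]
      congr 2
      exact if_congr (hAdef z s u) rfl rfl
    simp only [mul_add, Finset.sum_add_distrib, ← Finset.sum_mul, hsum1, one_mul]
    rw [hfirst, le_div_iff₀ (by positivity), mul_comm]
    refine le_trans (mul_le_mul_of_nonneg_left ?_ (by positivity)) hn.le
    exact add_le_add hbad hexp
  rw [sum_arrow_prod, Finset.sum_comm]
  have hpt : ∀ (z : Fin n → ζ) (s : Fin n → σ),
      blockDist d s (c z (if hm : ∃ m, A z s (c z m) then hm.choose else ⟨0, hM0⟩)) ≤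
      D + ε / 2 + (B + |D| + ε) * if ∀ m, ¬ A z s (c z m) then 1 else 0 := by
    intro z s
    by_cases hm : ∃ m, A z s (c z m)
    · rw [dif_pos hm, if_neg (by push Not; exact hm)]
      linarith [((hAdef _ _ _).1 hm.choose_spec).2]
    · rw [dif_neg hm, if_pos (by push Not at hm; exact hm)]
      have := (abs_le.1 (abs_blockDist_le hB0 hB s (c z ⟨0, hM0⟩))).2
      linarith [neg_abs_le D]
  have hsum1 : ∑ z : Fin n → ζ, ∑ s : Fin n → σ, ∏ i, r (s i, z i) = 1 := by
    rw [Finset.sum_comm, ← sum_arrow_prod (fun ω : Fin n → σ × ζ => ∏ i, r (ω i))]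
    exact sum_prod_eq_one (w := fun _ => r) fun _ => hr.2
  calc _ ≤ ∑ z : Fin n → ζ, ∑ s : Fin n → σ, (∏ i, r (s i, z i)) *
        (D + ε / 2 + (B + |D| + ε) * if ∀ m, ¬ A z s (c z m) then 1 else 0) :=
        Finset.sum_le_sum fun z _ => Finset.sum_le_sum fun s _ =>
          mul_le_mul_of_nonneg_left (hpt z s) (Finset.prod_nonneg fun i _ => hr.1 _)
    _ = D + ε / 2 + (B + |D| + ε) * ∑ z : Fin n → ζ, ∑ s : Fin n → σ, (∏ i, r (s i, z i)) *
          (if ∀ m, ¬ A z s (c z m) then 1 else 0) := by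
        simp only [mul_add, Finset.sum_add_distrib, ← Finset.sum_mul, hsum1, one_mul,
          Finset.mul_sum]
        congr 1
        exact Finset.sum_congr rfl fun z _ => Finset.sum_congr rfl fun s _ => by ring
    _ ≤ D + ε / 2 + (B + |D| + ε) * (ε / 2 / (B + |D| + ε)) := by gcongr
    _ = D + ε := by field_simp; ring

end SourceCoding

/-! ### Information densities -/

section Density

variable {Ω α β γ : Type*} [Fintype Ω] [Fintype α] [Fintype β] [Fintype γ]

open Classical in
/-- The indicator of a proposition. -/
def ind (P : Prop) : ℝ := if P then 1 else 0

lemma ind_nonneg (P : Prop) : 0 ≤ ind P := by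
  unfold ind; split_ifs <;> norm_num

lemma ind_of {P : Prop} (h : P) : ind P = 1 := if_pos h

lemma ind_of_not {P : Prop} (h : ¬ P) : ind P = 0 := if_neg h

lemma ind_le_one (P : Prop) : ind P ≤ 1 := by
  unfold ind; split_ifs <;> norm_num

/-- Here `m`, `c` are the laws of `(A, C)`, `C` at the sample point, `k` plays the conditional law
of `B` given `(A, C)`, and `g` that of `B` given `C`. -/
lemma density_pos {r : Ω → ℝ} (hr : ∀ ω, 0 ≤ r ω) {A : Ω → α} {B : Ω → β} {C : Ω → γ}
    {m k c g : Ω → ℝ} (hrk : ∀ ω, r ω = m ω * k ω)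
    (hAC : ∀ ω, law r (fun ω => (A ω, C ω)) (A ω, C ω) = m ω)
    (hC : ∀ ω, law r C (C ω) = c ω)
    (hBC : ∀ ω, law r (fun ω => (B ω, C ω)) (B ω, C ω) = c ω * g ω) {ω : Ω} (hω : r ω ≠ 0) :
    0 < m ω ∧ 0 < k ω ∧ 0 < c ω ∧ 0 < g ω := by
  have h0 := lt_of_le_of_ne (hr ω) hω.symm
  have h1 := h0.trans_le (le_law hr (fun ω => (A ω, C ω)) ω)
  have h2 := h0.trans_le (le_law hr (fun ω => (B ω, C ω)) ω)
  have h3 := h0.trans_le (le_law hr C ω)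
  rw [hAC] at h1
  rw [hBC] at h2
  rw [hC] at h3
  rw [hrk] at h0
  exact ⟨h1, (pos_iff_pos_of_mul_pos h0).1 h1, h3, (pos_iff_pos_of_mul_pos h2).1 h3⟩

/-- One computation for the three channel informations: `k` is always `W`, only the reference law
`g` changes. By injectivity the joint mass of `(A, B, C)` is `r` itself. -/
lemma condMutualInfo_eq_sum_density {r : Ω → ℝ} (hr : ∀ ω, 0 ≤ r ω) {A : Ω → α} {B : Ω → β}
    {C : Ω → γ} (hinj : Function.Injective fun ω => (A ω, B ω, C ω))
    {m k c g : Ω → ℝ} (hrk : ∀ ω, r ω = m ω * k ω)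
    (hAC : ∀ ω, law r (fun ω => (A ω, C ω)) (A ω, C ω) = m ω)
    (hC : ∀ ω, law r C (C ω) = c ω)
    (hBC : ∀ ω, law r (fun ω => (B ω, C ω)) (B ω, C ω) = c ω * g ω) :
    condMutualInfo r A B C = ∑ ω, r ω * (Real.log (k ω) - Real.log (g ω)) := by
  rw [condMutualInfo_eq_sum]
  refine Finset.sum_congr rfl fun ω _ => ?_
  by_cases hω : r ω = 0
  · simp [hω]
  obtain ⟨h1, h2, h3, h4⟩ := density_pos hr hrk hAC hC hBC hω
  rw [law_of_injective r hinj ω, hAC, hC, hBC, hrk, Real.log_mul h1.ne' h2.ne',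
    Real.log_mul h3.ne' h4.ne']
  ring

/-- The information density of an i.i.d. block is rarely far below its mean. -/
lemma tendsto_prob_density_lt {r : Ω → ℝ} (hr : r ∈ stdSimplex ℝ Ω) {k g : Ω → ℝ}
    (hkg : ∀ ω, r ω ≠ 0 → 0 < k ω ∧ 0 < g ω) {I δ : ℝ}
    (hI : I = ∑ ω, r ω * (Real.log (k ω) - Real.log (g ω))) (hδ : 0 < δ) :
    Tendsto (fun n : ℕ => ∑ ω : Fin n → Ω, (∏ i, r (ω i)) *
      ind (∏ i, k (ω i) < Real.exp (n * (I - δ)) * ∏ i, g (ω i))) atTop (nhds 0) := by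
  classical
  refine squeeze_zero (fun n => Finset.sum_nonneg fun ω _ =>
    mul_nonneg (Finset.prod_nonneg fun i _ => hr.1 _) (ind_nonneg _)) (fun n => ?_)
    (tendsto_prob_deviation hr (fun ω => Real.log (k ω) - Real.log (g ω)) hδ)
  refine Finset.sum_le_sum fun ω _ => ?_
  have hnn : 0 ≤ ∏ i, r (ω i) := Finset.prod_nonneg fun i _ => hr.1 _
  rcases hnn.eq_or_lt with h0 | h0
  · simp [← h0]
  refine mul_le_mul_of_nonneg_left ?_ hnn
  have hpos := fun i => hkg (ω i) (fun hz => h0.ne' (Finset.prod_eq_zero (Finset.mem_univ i) hz))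
  by_cases h : ∏ i, k (ω i) < Real.exp (n * (I - δ)) * ∏ i, g (ω i)
  · rw [ind_of h, if_pos]
    rw [← hI, Finset.sum_sub_distrib, ← Real.log_prod (fun i _ => (hpos i).1.ne'),
      ← Real.log_prod (fun i _ => (hpos i).2.ne')]
    have hgp : 0 < ∏ i, g (ω i) := Finset.prod_pos fun i _ => (hpos i).2
    have hkp : 0 < ∏ i, k (ω i) := Finset.prod_pos fun i _ => (hpos i).1
    have := Real.log_lt_log hkp h
    rw [Real.log_mul (Real.exp_pos _).ne' hgp.ne', Real.log_exp] at this
    refine lt_of_lt_of_le ?_ (neg_le_abs _)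
    linarith
  · rw [ind_of_not h]
    split_ifs <;> norm_num

end Density

/-! ### Information quantities of the multiple access channel -/

section MacInfo

variable {X₁ X₂ Y : Type*} [Fintype X₁] [Fintype X₂] [Fintype Y]

/-- The law of the output given the input of the second user. -/
def outLaw₁ (W : X₁ → X₂ → Y → ℝ) (P₁ : X₁ → ℝ) (x₂ : X₂) (y : Y) : ℝ := ∑ x, P₁ x * W x x₂ y

/-- The law of the output given the input of the first user. -/
def outLaw₂ (W : X₁ → X₂ → Y → ℝ) (P₂ : X₂ → ℝ) (x₁ : X₁) (y : Y) : ℝ := ∑ x, P₂ x * W x₁ x y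

/-- The law of the output. -/
def outLaw₁₂ (W : X₁ → X₂ → Y → ℝ) (P₁ : X₁ → ℝ) (P₂ : X₂ → ℝ) (y : Y) : ℝ :=
  ∑ x : X₁ × X₂, P₁ x.1 * P₂ x.2 * W x.1 x.2 y

variable {k : ℕ} {W : X₁ → X₂ → Y → ℝ} {pQ : Fin k → ℝ} {P₁ : Fin k → X₁ → ℝ} {P₂ : Fin k → X₂ → ℝ}

lemma macLaw_nonneg (hW : ∀ x₁ x₂, W x₁ x₂ ∈ stdSimplex ℝ Y) (hQ : pQ ∈ stdSimplex ℝ (Fin k))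
    (h₁ : ∀ q, P₁ q ∈ stdSimplex ℝ X₁) (h₂ : ∀ q, P₂ q ∈ stdSimplex ℝ X₂)
    (a : Fin k × X₁ × X₂ × Y) : 0 ≤ macLaw W pQ P₁ P₂ a :=
  mul_nonneg (mul_nonneg (mul_nonneg (hQ.1 _) ((h₁ _).1 _)) ((h₂ _).1 _)) ((hW _ _).1 _)

lemma macLaw_mem_stdSimplex (hW : ∀ x₁ x₂, W x₁ x₂ ∈ stdSimplex ℝ Y)
    (hQ : pQ ∈ stdSimplex ℝ (Fin k))
    (h₁ : ∀ q, P₁ q ∈ stdSimplex ℝ X₁) (h₂ : ∀ q, P₂ q ∈ stdSimplex ℝ X₂) :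
    macLaw W pQ P₁ P₂ ∈ stdSimplex ℝ (Fin k × X₁ × X₂ × Y) := by
  refine ⟨macLaw_nonneg hW hQ h₁ h₂, ?_⟩
  simp only [macLaw, Fintype.sum_prod_type, ← Finset.mul_sum, (hW _ _).2, (h₁ _).2, (h₂ _).2,
    mul_one, hQ.2]

lemma law_macLaw_inputs (hW : ∀ x₁ x₂, W x₁ x₂ ∈ stdSimplex ℝ Y) (q : Fin k) (x₁ : X₁) (x₂ : X₂) :
    law (macLaw W pQ P₁ P₂) (fun a => (a.1, a.2.1, a.2.2.1)) (q, x₁, x₂) =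
      pQ q * P₁ q x₁ * P₂ q x₂ := by
  rw [← sum_law_pair _ (fun a => a.2.2.2)]
  have h : ∀ y, law (macLaw W pQ P₁ P₂) (fun a => (a.2.2.2, a.1, a.2.1, a.2.2.1)) (y, q, x₁, x₂) =
      macLaw W pQ P₁ P₂ (q, x₁, x₂, y) := fun y =>
    law_of_injective _ (A := fun a : Fin k × X₁ × X₂ × Y => (a.2.2.2, a.1, a.2.1, a.2.2.1))
      (fun a b h => by simp only [Prod.mk.injEq] at h; ext <;> simp [h]) (q, x₁, x₂, y)
  simp only [h, macLaw, ← Finset.mul_sum, (hW _ _).2, mul_one]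

lemma law_congr_iff {Ω α β : Type*} [Fintype Ω] (r : Ω → ℝ) {A : Ω → α} {B : Ω → β} {a : α} {b : β}
    (h : ∀ ω, A ω = a ↔ B ω = b) : law r A a = law r B b := by
  classical
  unfold law
  exact Finset.sum_congr rfl fun ω _ => if_congr (h ω) rfl rfl

lemma law_macLaw_first (hW : ∀ x₁ x₂, W x₁ x₂ ∈ stdSimplex ℝ Y)
    (h₂ : ∀ q, P₂ q ∈ stdSimplex ℝ X₂) (q : Fin k) (x₁ : X₁) :
    law (macLaw W pQ P₁ P₂) (fun a => (a.2.1, a.1)) (x₁, q) = pQ q * P₁ q x₁ := by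
  rw [← sum_law_pair _ (fun a => a.2.2.1)]
  have h : ∀ x₂, law (macLaw W pQ P₁ P₂) (fun a => (a.2.2.1, a.2.1, a.1)) (x₂, x₁, q) =
      pQ q * P₁ q x₁ * P₂ q x₂ := fun x₂ => by
    rw [← law_macLaw_inputs hW]
    exact law_congr_iff _ fun a => by simp only [Prod.mk.injEq]; tauto
  simp only [h, ← Finset.mul_sum, (h₂ _).2, mul_one]

lemma law_macLaw_second (hW : ∀ x₁ x₂, W x₁ x₂ ∈ stdSimplex ℝ Y)
    (h₁ : ∀ q, P₁ q ∈ stdSimplex ℝ X₁) (q : Fin k) (x₂ : X₂) :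
    law (macLaw W pQ P₁ P₂) (fun a => (a.2.2.1, a.1)) (x₂, q) = pQ q * P₂ q x₂ := by
  rw [← sum_law_pair _ (fun a => a.2.1)]
  have h : ∀ x₁, law (macLaw W pQ P₁ P₂) (fun a => (a.2.1, a.2.2.1, a.1)) (x₁, x₂, q) =
      P₁ q x₁ * (pQ q * P₂ q x₂) := fun x₁ => by
    rw [show P₁ q x₁ * (pQ q * P₂ q x₂) = pQ q * P₁ q x₁ * P₂ q x₂ by ring,
      ← law_macLaw_inputs hW]
    exact law_congr_iff _ fun a => by simp only [Prod.mk.injEq]; tauto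
  simp only [h, ← Finset.sum_mul, (h₁ _).2, one_mul]

lemma law_macLaw_side (hW : ∀ x₁ x₂, W x₁ x₂ ∈ stdSimplex ℝ Y)
    (h₁ : ∀ q, P₁ q ∈ stdSimplex ℝ X₁) (h₂ : ∀ q, P₂ q ∈ stdSimplex ℝ X₂) (q : Fin k) :
    law (macLaw W pQ P₁ P₂) (fun a => a.1) q = pQ q := by
  rw [← sum_law_pair _ (fun a => a.2.1)]
  simp only [law_macLaw_first hW h₂, ← Finset.mul_sum, (h₁ _).2, mul_one]

lemma law_macLaw_out₁ (q : Fin k) (x₂ : X₂) (y : Y) :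
    law (macLaw W pQ P₁ P₂) (fun a => (a.2.2.2, a.2.2.1, a.1)) (y, x₂, q) =
      pQ q * P₂ q x₂ * outLaw₁ W (P₁ q) x₂ y := by
  rw [← sum_law_pair _ (fun a => a.2.1)]
  have h : ∀ x₁, law (macLaw W pQ P₁ P₂) (fun a => (a.2.1, a.2.2.2, a.2.2.1, a.1)) (x₁, y, x₂, q) =
      macLaw W pQ P₁ P₂ (q, x₁, x₂, y) := fun x₁ =>
    law_of_injective _ (A := fun a : Fin k × X₁ × X₂ × Y => (a.2.1, a.2.2.2, a.2.2.1, a.1))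
      (fun a b h => by simp only [Prod.mk.injEq] at h; ext <;> simp [h]) (q, x₁, x₂, y)
  simp only [h, macLaw, outLaw₁, Finset.mul_sum]
  exact Finset.sum_congr rfl fun x _ => by ring

lemma law_macLaw_out₂ (q : Fin k) (x₁ : X₁) (y : Y) :
    law (macLaw W pQ P₁ P₂) (fun a => (a.2.2.2, a.2.1, a.1)) (y, x₁, q) =
      pQ q * P₁ q x₁ * outLaw₂ W (P₂ q) x₁ y := by
  rw [← sum_law_pair _ (fun a => a.2.2.1)]
  have h : ∀ x₂, law (macLaw W pQ P₁ P₂) (fun a => (a.2.2.1, a.2.2.2, a.2.1, a.1)) (x₂, y, x₁, q) =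
      macLaw W pQ P₁ P₂ (q, x₁, x₂, y) := fun x₂ =>
    law_of_injective _ (A := fun a : Fin k × X₁ × X₂ × Y => (a.2.2.1, a.2.2.2, a.2.1, a.1))
      (fun a b h => by simp only [Prod.mk.injEq] at h; ext <;> simp [h]) (q, x₁, x₂, y)
  simp only [h, macLaw, outLaw₂, Finset.mul_sum]
  exact Finset.sum_congr rfl fun x _ => by ring

lemma law_macLaw_out₁₂ (q : Fin k) (y : Y) :
    law (macLaw W pQ P₁ P₂) (fun a => (a.2.2.2, a.1)) (y, q) =
      pQ q * outLaw₁₂ W (P₁ q) (P₂ q) y := by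
  rw [← sum_law_pair _ (fun a => (a.2.1, a.2.2.1))]
  have h : ∀ x : X₁ × X₂, law (macLaw W pQ P₁ P₂)
      (fun a => ((a.2.1, a.2.2.1), a.2.2.2, a.1)) (x, y, q) =
      macLaw W pQ P₁ P₂ (q, x.1, x.2, y) := fun x =>
    law_of_injective _ (A := fun a : Fin k × X₁ × X₂ × Y => ((a.2.1, a.2.2.1), a.2.2.2, a.1))
      (fun a b h => by simp only [Prod.mk.injEq] at h; ext <;> simp [h]) (q, x.1, x.2, y)
  simp only [h, macLaw, outLaw₁₂, Finset.mul_sum]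
  exact Finset.sum_congr rfl fun x _ => by ring

lemma law_macLaw_inputs₁ (hW : ∀ x₁ x₂, W x₁ x₂ ∈ stdSimplex ℝ Y) (a : Fin k × X₁ × X₂ × Y) :
    law (macLaw W pQ P₁ P₂) (fun a => (a.2.1, a.2.2.1, a.1)) (a.2.1, a.2.2.1, a.1) =
      pQ a.1 * P₁ a.1 a.2.1 * P₂ a.1 a.2.2.1 := by
  rw [← law_macLaw_inputs hW]
  exact law_congr_iff _ fun a => by simp only [Prod.mk.injEq]; tauto

lemma law_macLaw_inputs₂ (hW : ∀ x₁ x₂, W x₁ x₂ ∈ stdSimplex ℝ Y) (a : Fin k × X₁ × X₂ × Y) :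
    law (macLaw W pQ P₁ P₂) (fun a => (a.2.2.1, a.2.1, a.1)) (a.2.2.1, a.2.1, a.1) =
      pQ a.1 * P₁ a.1 a.2.1 * P₂ a.1 a.2.2.1 := by
  rw [← law_macLaw_inputs hW]
  exact law_congr_iff _ fun a => by simp only [Prod.mk.injEq]; tauto

lemma law_macLaw_inputs₁₂ (hW : ∀ x₁ x₂, W x₁ x₂ ∈ stdSimplex ℝ Y) (a : Fin k × X₁ × X₂ × Y) :
    law (macLaw W pQ P₁ P₂) (fun a => ((a.2.1, a.2.2.1), a.1)) ((a.2.1, a.2.2.1), a.1) =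
      pQ a.1 * P₁ a.1 a.2.1 * P₂ a.1 a.2.2.1 := by
  rw [← law_macLaw_inputs hW]
  exact law_congr_iff _ fun a => by simp only [Prod.mk.injEq]; tauto

lemma macDensity₁_pos (hW : ∀ x₁ x₂, W x₁ x₂ ∈ stdSimplex ℝ Y) (hQ : pQ ∈ stdSimplex ℝ (Fin k))
    (h₁ : ∀ q, P₁ q ∈ stdSimplex ℝ X₁) (h₂ : ∀ q, P₂ q ∈ stdSimplex ℝ X₂)
    {a : Fin k × X₁ × X₂ × Y} (ha : macLaw W pQ P₁ P₂ a ≠ 0) :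
    0 < W a.2.1 a.2.2.1 a.2.2.2 ∧ 0 < outLaw₁ W (P₁ a.1) a.2.2.1 a.2.2.2 := by
  obtain ⟨-, h, -, h'⟩ := density_pos (macLaw_nonneg hW hQ h₁ h₂) (A := fun a => a.2.1)
    (B := fun a => a.2.2.2) (C := fun a => (a.2.2.1, a.1))
    (k := fun a => W a.2.1 a.2.2.1 a.2.2.2) (g := fun a => outLaw₁ W (P₁ a.1) a.2.2.1 a.2.2.2)
    (fun _ => rfl) (law_macLaw_inputs₁ hW) (fun _ => law_macLaw_second hW h₁ _ _)
    (fun _ => law_macLaw_out₁ _ _ _) ha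
  exact ⟨h, h'⟩

lemma macInfo₁_eq_sum (hW : ∀ x₁ x₂, W x₁ x₂ ∈ stdSimplex ℝ Y) (hQ : pQ ∈ stdSimplex ℝ (Fin k))
    (h₁ : ∀ q, P₁ q ∈ stdSimplex ℝ X₁) (h₂ : ∀ q, P₂ q ∈ stdSimplex ℝ X₂) :
    macInfo₁ W pQ P₁ P₂ = ∑ a, macLaw W pQ P₁ P₂ a *
    (Real.log (W a.2.1 a.2.2.1 a.2.2.2) - Real.log (outLaw₁ W (P₁ a.1) a.2.2.1 a.2.2.2)) :=
  condMutualInfo_eq_sum_density (macLaw_nonneg hW hQ h₁ h₂)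
    (fun a b h => by simp only [Prod.mk.injEq] at h; ext <;> simp [h])
    (fun _ => rfl) (law_macLaw_inputs₁ hW) (fun _ => law_macLaw_second hW h₁ _ _)
    (fun _ => law_macLaw_out₁ _ _ _)

lemma macDensity₂_pos (hW : ∀ x₁ x₂, W x₁ x₂ ∈ stdSimplex ℝ Y) (hQ : pQ ∈ stdSimplex ℝ (Fin k))
    (h₁ : ∀ q, P₁ q ∈ stdSimplex ℝ X₁) (h₂ : ∀ q, P₂ q ∈ stdSimplex ℝ X₂)
    {a : Fin k × X₁ × X₂ × Y} (ha : macLaw W pQ P₁ P₂ a ≠ 0) :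
    0 < W a.2.1 a.2.2.1 a.2.2.2 ∧ 0 < outLaw₂ W (P₂ a.1) a.2.1 a.2.2.2 := by
  obtain ⟨-, h, -, h'⟩ := density_pos (macLaw_nonneg hW hQ h₁ h₂) (A := fun a => a.2.2.1)
    (B := fun a => a.2.2.2) (C := fun a => (a.2.1, a.1))
    (k := fun a => W a.2.1 a.2.2.1 a.2.2.2) (g := fun a => outLaw₂ W (P₂ a.1) a.2.1 a.2.2.2)
    (fun _ => rfl) (law_macLaw_inputs₂ hW) (fun _ => law_macLaw_first hW h₂ _ _)
    (fun _ => law_macLaw_out₂ _ _ _) ha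
  exact ⟨h, h'⟩

lemma macInfo₂_eq_sum (hW : ∀ x₁ x₂, W x₁ x₂ ∈ stdSimplex ℝ Y) (hQ : pQ ∈ stdSimplex ℝ (Fin k))
    (h₁ : ∀ q, P₁ q ∈ stdSimplex ℝ X₁) (h₂ : ∀ q, P₂ q ∈ stdSimplex ℝ X₂) :
    macInfo₂ W pQ P₁ P₂ = ∑ a, macLaw W pQ P₁ P₂ a *
    (Real.log (W a.2.1 a.2.2.1 a.2.2.2) - Real.log (outLaw₂ W (P₂ a.1) a.2.1 a.2.2.2)) :=
  condMutualInfo_eq_sum_density (macLaw_nonneg hW hQ h₁ h₂)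
    (fun a b h => by simp only [Prod.mk.injEq] at h; ext <;> simp [h])
    (fun _ => rfl) (law_macLaw_inputs₂ hW) (fun _ => law_macLaw_first hW h₂ _ _)
    (fun _ => law_macLaw_out₂ _ _ _)

lemma macDensity₁₂_pos (hW : ∀ x₁ x₂, W x₁ x₂ ∈ stdSimplex ℝ Y) (hQ : pQ ∈ stdSimplex ℝ (Fin k))
    (h₁ : ∀ q, P₁ q ∈ stdSimplex ℝ X₁) (h₂ : ∀ q, P₂ q ∈ stdSimplex ℝ X₂)
    {a : Fin k × X₁ × X₂ × Y} (ha : macLaw W pQ P₁ P₂ a ≠ 0) :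
    0 < W a.2.1 a.2.2.1 a.2.2.2 ∧ 0 < outLaw₁₂ W (P₁ a.1) (P₂ a.1) a.2.2.2 := by
  obtain ⟨-, h, -, h'⟩ := density_pos (macLaw_nonneg hW hQ h₁ h₂) (A := fun a => (a.2.1, a.2.2.1))
    (B := fun a => a.2.2.2) (C := fun a => a.1)
    (k := fun a => W a.2.1 a.2.2.1 a.2.2.2) (g := fun a => outLaw₁₂ W (P₁ a.1) (P₂ a.1) a.2.2.2)
    (fun _ => rfl) (law_macLaw_inputs₁₂ hW) (fun _ => law_macLaw_side hW h₁ h₂ _)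
    (fun _ => law_macLaw_out₁₂ _ _) ha
  exact ⟨h, h'⟩

lemma macInfo₁₂_eq_sum (hW : ∀ x₁ x₂, W x₁ x₂ ∈ stdSimplex ℝ Y) (hQ : pQ ∈ stdSimplex ℝ (Fin k))
    (h₁ : ∀ q, P₁ q ∈ stdSimplex ℝ X₁) (h₂ : ∀ q, P₂ q ∈ stdSimplex ℝ X₂) :
    macInfo₁₂ W pQ P₁ P₂ = ∑ a, macLaw W pQ P₁ P₂ a *
    (Real.log (W a.2.1 a.2.2.1 a.2.2.2) - Real.log (outLaw₁₂ W (P₁ a.1) (P₂ a.1) a.2.2.2)) :=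
  condMutualInfo_eq_sum_density (macLaw_nonneg hW hQ h₁ h₂)
    (fun a b h => by simp only [Prod.mk.injEq] at h; ext <;> simp [h])
    (fun _ => rfl) (law_macLaw_inputs₁₂ hW) (fun _ => law_macLaw_side hW h₁ h₂ _)
    (fun _ => law_macLaw_out₁₂ _ _)

end MacInfo

/-! ### Random coding for the multiple access channel -/

section OneShot

variable {X₁ X₂ Y : Type*} [Fintype X₁] [Fintype X₂] [Fintype Y]

lemma sum_mul_sum_swap {α β : Type*} [Fintype α] [Fintype β] (P : α → ℝ) (Q : β → ℝ)
    (f : α → β → ℝ) :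
    ∑ a, P a * ∑ b, Q b * f a b = ∑ b, Q b * ∑ a, P a * f a b := by
  simp only [Finset.mul_sum]
  rw [Finset.sum_comm]
  exact Finset.sum_congr rfl fun b _ => Finset.sum_congr rfl fun a _ => by ring

lemma mul_ind_le {P : Prop} {G w K : ℝ} (hK : 0 < K) (hw : 0 ≤ w) (h : P → K * G ≤ w) :
    G * ind P ≤ w / K := by
  by_cases hP : P
  · rw [ind_of hP, mul_one, le_div_iff₀ hK, mul_comm]
    exact h hP
  · rw [ind_of_not hP, mul_zero]
    positivity

lemma sum_mul_le_of_le {α : Type*} [Fintype α] {P : α → ℝ} (hP : P ∈ stdSimplex ℝ α) {f : α → ℝ}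
    {B : ℝ} (h : ∀ a, f a ≤ B) : ∑ a, P a * f a ≤ B := by
  refine (Finset.sum_le_sum fun a _ => mul_le_mul_of_nonneg_left (h a) (hP.1 a)).trans_eq ?_
  rw [← Finset.sum_mul, hP.2, one_mul]

/-- Change of measure: on the acceptance region `G ≤ w / K`, and `w` has total mass one. -/
lemma sum_mul_ind_le {w G : Y → ℝ} (hw : w ∈ stdSimplex ℝ Y) {A : Y → Prop} {K : ℝ} (hK : 0 < K)
    (h : ∀ y, A y → K * G y ≤ w y) : ∑ y, G y * ind (A y) ≤ 1 / K := by
  refine (Finset.sum_le_sum fun y _ => mul_ind_le hK (hw.1 y) (h y)).trans_eq ?_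
  rw [← Finset.sum_div, hw.2]

variable {W : X₁ → X₂ → Y → ℝ} {P₁ : X₁ → ℝ} {P₂ : X₂ → ℝ} {A : X₁ → X₂ → Y → Prop} {K : ℝ}

/-- Probability that a wrong message of the first user looks right. -/
lemma confusion₁_le (hW : ∀ x₁ x₂, W x₁ x₂ ∈ stdSimplex ℝ Y) (h₁ : P₁ ∈ stdSimplex ℝ X₁)
    (h₂ : P₂ ∈ stdSimplex ℝ X₂) (hK : 0 < K)
    (hA : ∀ x₁ x₂ y, A x₁ x₂ y → K * outLaw₁ W P₁ x₂ y ≤ W x₁ x₂ y) :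
    ∑ x, P₁ x * ∑ x', P₁ x' * ∑ u, P₂ u * ∑ y, W x u y * ind (A x' u y) ≤ 1 / K := by
  rw [sum_mul_sum_swap]
  refine sum_mul_le_of_le h₁ fun x' => ?_
  rw [sum_mul_sum_swap]
  refine sum_mul_le_of_le h₂ fun u => ?_
  -- The transmitted word `x` is independent of the competitor `x'`; averaging over it turns `W x u`
  -- into the output law `outLaw₁`.
  refine le_trans (le_of_eq ?_) (sum_mul_ind_le (hW x' u) hK (fun y => hA x' u y))
  simp only [outLaw₁, Finset.sum_mul, Finset.mul_sum, mul_assoc]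
  rw [Finset.sum_comm]

/-- Probability that a wrong message of the second user looks right. -/
lemma confusion₂_le (hW : ∀ x₁ x₂, W x₁ x₂ ∈ stdSimplex ℝ Y) (h₁ : P₁ ∈ stdSimplex ℝ X₁)
    (h₂ : P₂ ∈ stdSimplex ℝ X₂) (hK : 0 < K)
    (hA : ∀ x₁ x₂ y, A x₁ x₂ y → K * outLaw₂ W P₂ x₁ y ≤ W x₁ x₂ y) :
    ∑ x, P₁ x * ∑ u, P₂ u * ∑ u', P₂ u' * ∑ y, W x u y * ind (A x u' y) ≤ 1 / K := by
  refine sum_mul_le_of_le h₁ fun x => ?_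
  rw [sum_mul_sum_swap]
  refine sum_mul_le_of_le h₂ fun u' => ?_
  refine le_trans (le_of_eq ?_) (sum_mul_ind_le (hW x u') hK (fun y => hA x u' y))
  simp only [outLaw₂, Finset.sum_mul, Finset.mul_sum, mul_assoc]
  rw [Finset.sum_comm]

/-- Probability that a pair of wrong messages looks right. -/
lemma confusion₁₂_le (hW : ∀ x₁ x₂, W x₁ x₂ ∈ stdSimplex ℝ Y) (h₁ : P₁ ∈ stdSimplex ℝ X₁)
    (h₂ : P₂ ∈ stdSimplex ℝ X₂) (hK : 0 < K)
    (hA : ∀ x₁ x₂ y, A x₁ x₂ y → K * outLaw₁₂ W P₁ P₂ y ≤ W x₁ x₂ y) :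
    ∑ x, P₁ x * ∑ x', P₁ x' * ∑ u, P₂ u * ∑ u', P₂ u' * ∑ y, W x u y * ind (A x' u' y) ≤ 1 / K := by
  rw [sum_mul_sum_swap]
  refine sum_mul_le_of_le h₁ fun x' => ?_
  refine (Finset.sum_congr rfl fun x _ =>
    congrArg (HMul.hMul (P₁ x)) (sum_mul_sum_swap P₂ P₂ _)).trans_le ?_
  rw [sum_mul_sum_swap]
  refine sum_mul_le_of_le h₂ fun u' => ?_
  refine le_trans (le_of_eq ?_) (sum_mul_ind_le (hW x' u') hK (fun y => hA x' u' y))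
  simp only [outLaw₁₂, Finset.sum_mul, Finset.mul_sum, mul_assoc, Fintype.sum_prod_type]
  rw [Finset.sum_comm]
  simp only [Finset.sum_comm (γ := Y)]
  rw [Finset.sum_comm]

/-! ### Random codebooks averaged in the union bound, and threshold decoding -/

section Average

variable {M₁ M₂ : ℕ}

/-- The union bound on the error probability of threshold decoding. -/
def unionBound (W : X₁ → X₂ → Y → ℝ) (A : X₁ → X₂ → Y → Prop) (c₁ : Fin M₁ → X₁)
    (c₂ : Fin M₂ → X₂) (m₁ : Fin M₁) (m₂ : Fin M₂) : ℝ :=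
  ∑ y, W (c₁ m₁) (c₂ m₂) y * ind (¬ A (c₁ m₁) (c₂ m₂) y) +
  ∑ m₁' with m₁' ≠ m₁, ∑ y, W (c₁ m₁) (c₂ m₂) y * ind (A (c₁ m₁') (c₂ m₂) y) +
  ∑ m₂' with m₂' ≠ m₂, ∑ y, W (c₁ m₁) (c₂ m₂) y * ind (A (c₁ m₁) (c₂ m₂') y) +
  ∑ m₁' with m₁' ≠ m₁, ∑ m₂' with m₂' ≠ m₂,
    ∑ y, W (c₁ m₁) (c₂ m₂) y * ind (A (c₁ m₁') (c₂ m₂') y)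

/-- The exact count matters: a user with only one message has no competitors, so its confusion terms
vanish whatever the channel. -/
lemma card_ne (m₁ : Fin M₁) : ((Finset.univ.filter (· ≠ m₁)).card : ℝ) = (M₁ : ℝ) - 1 := by
  have h0 : 0 < M₁ := m₁.pos
  rw [Finset.filter_ne', Finset.card_erase_of_mem (Finset.mem_univ _), Finset.card_univ,
    Fintype.card_fin, Nat.cast_sub h0, Nat.cast_one]

/-- The union bound averaged over independent random codebooks. -/
lemma sum_unionBound_le (hW : ∀ x₁ x₂, W x₁ x₂ ∈ stdSimplex ℝ Y) (h₁ : P₁ ∈ stdSimplex ℝ X₁)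
    (h₂ : P₂ ∈ stdSimplex ℝ X₂) {K₁ K₂ K₁₂ : ℝ} (hK₁ : 0 < K₁) (hK₂ : 0 < K₂) (hK₁₂ : 0 < K₁₂)
    (hA₁ : ∀ x₁ x₂ y, A x₁ x₂ y → K₁ * outLaw₁ W P₁ x₂ y ≤ W x₁ x₂ y)
    (hA₂ : ∀ x₁ x₂ y, A x₁ x₂ y → K₂ * outLaw₂ W P₂ x₁ y ≤ W x₁ x₂ y)
    (hA₁₂ : ∀ x₁ x₂ y, A x₁ x₂ y → K₁₂ * outLaw₁₂ W P₁ P₂ y ≤ W x₁ x₂ y)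
    (m₁ : Fin M₁) (m₂ : Fin M₂) :
    ∑ c₁ : Fin M₁ → X₁, (∏ m, P₁ (c₁ m)) * ∑ c₂ : Fin M₂ → X₂, (∏ m, P₂ (c₂ m)) *
      unionBound W A c₁ c₂ m₁ m₂ ≤
    ∑ x₁, P₁ x₁ * ∑ x₂, P₂ x₂ * ∑ y, W x₁ x₂ y * ind (¬ A x₁ x₂ y) +
      ((M₁ : ℝ) - 1) / K₁ + ((M₂ : ℝ) - 1) / K₂ + ((M₁ : ℝ) - 1) * ((M₂ : ℝ) - 1) / K₁₂ := by
  -- Each term of the union bound involves at most two codewords per user; the remaining ones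
  -- integrate out, and distinct messages have independent codewords.
  have one₁ : ∀ (i : Fin M₁) (g : X₁ → ℝ),
      ∑ f : Fin M₁ → X₁, (∏ m, P₁ (f m)) * g (f i) = ∑ x, P₁ x * g x := fun i g =>
    sum_prod_mul_coord (w := fun _ => P₁) (fun _ => h₁.2) i g
  have one₂ : ∀ (i : Fin M₂) (g : X₂ → ℝ),
      ∑ f : Fin M₂ → X₂, (∏ m, P₂ (f m)) * g (f i) = ∑ x, P₂ x * g x := fun i g =>
    sum_prod_mul_coord (w := fun _ => P₂) (fun _ => h₂.2) i g
  have two₁ : ∀ {i j : Fin M₁} (_ : i ≠ j) (g : X₁ → X₁ → ℝ),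
      ∑ f : Fin M₁ → X₁, (∏ m, P₁ (f m)) * g (f i) (f j) = ∑ x, P₁ x * ∑ y, P₁ y * g x y :=
    fun hij g => sum_prod_mul_coord₂ (w := fun _ => P₁) (fun _ => h₁.2) hij g
  have two₂ : ∀ {i j : Fin M₂} (_ : i ≠ j) (g : X₂ → X₂ → ℝ),
      ∑ f : Fin M₂ → X₂, (∏ m, P₂ (f m)) * g (f i) (f j) = ∑ x, P₂ x * ∑ y, P₂ y * g x y :=
    fun hij g => sum_prod_mul_coord₂ (w := fun _ => P₂) (fun _ => h₂.2) hij g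
  simp only [unionBound, mul_add, Finset.sum_add_distrib]
  refine add_le_add (add_le_add (add_le_add (le_of_eq ?_) ?_) ?_) ?_
  · rw [← one₁ m₁ (fun x₁ => ∑ x, P₂ x * ∑ y, W x₁ x y * ind (¬ A x₁ x y))]
    exact Finset.sum_congr rfl fun c₁ _ => congrArg _
      (one₂ m₂ (fun x => ∑ y, W (c₁ m₁) x y * ind (¬ A (c₁ m₁) x y)))
  · rw [← card_ne m₁, div_eq_mul_one_div, ← nsmul_eq_mul, ← Finset.sum_const]
    simp only [Finset.mul_sum (Finset.univ.filter _)]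
    simp only [Finset.sum_comm (s := Finset.univ) (t := Finset.univ.filter (· ≠ m₁)),
      Finset.mul_sum (Finset.univ.filter _)]
    refine Finset.sum_le_sum fun m₁' hm => ?_
    rw [Finset.mem_filter] at hm
    refine le_trans (le_of_eq ?_) (confusion₁_le hW h₁ h₂ hK₁ hA₁)
    rw [← two₁ hm.2.symm (fun x x' => ∑ u, P₂ u * ∑ y, W x u y * ind (A x' u y))]
    exact Finset.sum_congr rfl fun c₁ _ => congrArg _
      (one₂ m₂ (fun u => ∑ y, W (c₁ m₁) u y * ind (A (c₁ m₁') u y)))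
  · rw [← card_ne m₂, div_eq_mul_one_div, ← nsmul_eq_mul, ← Finset.sum_const]
    simp only [Finset.mul_sum (Finset.univ.filter _)]
    simp only [Finset.sum_comm (s := Finset.univ) (t := Finset.univ.filter (· ≠ m₂)),
      Finset.mul_sum (Finset.univ.filter _)]
    refine Finset.sum_le_sum fun m₂' hm => ?_
    rw [Finset.mem_filter] at hm
    refine le_trans (le_of_eq ?_) (confusion₂_le hW h₁ h₂ hK₂ hA₂)
    rw [← one₁ m₁ (fun x => ∑ u, P₂ u * ∑ u', P₂ u' * ∑ y, W x u y * ind (A x u' y))]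
    exact Finset.sum_congr rfl fun c₁ _ => congrArg _
      (two₂ hm.2.symm (fun u u' => ∑ y, W (c₁ m₁) u y * ind (A (c₁ m₁) u' y)))
  · rw [← card_ne m₁, ← card_ne m₂, div_eq_mul_one_div, mul_assoc, ← nsmul_eq_mul, ← nsmul_eq_mul,
      ← Finset.sum_const, ← Finset.sum_const]
    simp only [Finset.mul_sum (Finset.univ.filter _)]
    simp only [Finset.sum_comm (s := Finset.univ) (t := Finset.univ.filter (· ≠ m₁)),
      Finset.mul_sum (Finset.univ.filter _)]
    simp only [Finset.sum_comm (s := Finset.univ) (t := Finset.univ.filter (· ≠ m₂)),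
      Finset.mul_sum (Finset.univ.filter _)]
    refine Finset.sum_le_sum fun m₁' hm => Finset.sum_le_sum fun m₂' hm' => ?_
    rw [Finset.mem_filter] at hm hm'
    refine le_trans (le_of_eq ?_) (confusion₁₂_le hW h₁ h₂ hK₁₂ hA₁₂)
    rw [← two₁ hm.2.symm (fun x x' => ∑ u, P₂ u * ∑ u', P₂ u' * ∑ y, W x u y * ind (A x' u' y))]
    exact Finset.sum_congr rfl fun c₁ _ => congrArg _
      (two₂ hm'.2.symm (fun u v => ∑ y, W (c₁ m₁) u y * ind (A (c₁ m₁') v y)))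

/-- Threshold decoding obeys the union bound. -/
lemma exists_decoder (hW : ∀ x₁ x₂, W x₁ x₂ ∈ stdSimplex ℝ Y) (A : X₁ → X₂ → Y → Prop)
    (hM₁ : 0 < M₁) (hM₂ : 0 < M₂) (c₁ : Fin M₁ → X₁) (c₂ : Fin M₂ → X₂) :
    ∃ dec : Y → Fin M₁ × Fin M₂, ∀ m₁ m₂,
      ∑ y, W (c₁ m₁) (c₂ m₂) y * ind (dec y ≠ (m₁, m₂)) ≤ unionBound W A c₁ c₂ m₁ m₂ := by
  classical
  -- The decoder returns any accepted pair; uniqueness is not required, and the default `(0, 0)`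
  -- only occurs when the true pair is rejected too.
  refine ⟨fun y => if h : ∃ m : Fin M₁ × Fin M₂, A (c₁ m.1) (c₂ m.2) y then h.choose
    else (⟨0, hM₁⟩, ⟨0, hM₂⟩), fun m₁ m₂ => ?_⟩
  have hpt : ∀ y, ind ((if h : ∃ m : Fin M₁ × Fin M₂, A (c₁ m.1) (c₂ m.2) y then h.choose
      else (⟨0, hM₁⟩, ⟨0, hM₂⟩)) ≠ (m₁, m₂)) ≤ ind (¬ A (c₁ m₁) (c₂ m₂) y) +
      ∑ m₁' with m₁' ≠ m₁, ind (A (c₁ m₁') (c₂ m₂) y) +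
      ∑ m₂' with m₂' ≠ m₂, ind (A (c₁ m₁) (c₂ m₂') y) +
      ∑ m₁' with m₁' ≠ m₁, ∑ m₂' with m₂' ≠ m₂, ind (A (c₁ m₁') (c₂ m₂') y) := by
    intro y
    have n0 := ind_nonneg (¬ A (c₁ m₁) (c₂ m₂) y)
    have n1 : 0 ≤ ∑ m₁' with m₁' ≠ m₁, ind (A (c₁ m₁') (c₂ m₂) y) :=
      Finset.sum_nonneg fun _ _ => ind_nonneg _
    have n2 : 0 ≤ ∑ m₂' with m₂' ≠ m₂, ind (A (c₁ m₁) (c₂ m₂') y) :=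
      Finset.sum_nonneg fun _ _ => ind_nonneg _
    have n3 : 0 ≤ ∑ m₁' with m₁' ≠ m₁, ∑ m₂' with m₂' ≠ m₂, ind (A (c₁ m₁') (c₂ m₂') y) :=
      Finset.sum_nonneg fun _ _ => Finset.sum_nonneg fun _ _ => ind_nonneg _
    by_cases hA : A (c₁ m₁) (c₂ m₂) y
    swap
    · rw [ind_of hA]
      linarith [ind_le_one ((if h : ∃ m : Fin M₁ × Fin M₂, A (c₁ m.1) (c₂ m.2) y then h.choose
        else (⟨0, hM₁⟩, ⟨0, hM₂⟩)) ≠ (m₁, m₂))]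
    have hex : ∃ m : Fin M₁ × Fin M₂, A (c₁ m.1) (c₂ m.2) y := ⟨(m₁, m₂), hA⟩
    rw [dif_pos hex]
    have hc := hex.choose_spec
    by_cases hne : hex.choose ≠ (m₁, m₂)
    swap
    · rw [ind_of_not hne]; linarith
    rw [ind_of hne]
    generalize hex.choose = m at hc hne
    obtain ⟨a, b⟩ := m
    simp only at hc
    -- A wrong accepted pair differs from the true one in the second index, the first, or both; the
    -- corresponding sum contains a term equal to `1`.
    by_cases ha : a = m₁
    · subst ha
      have hb : b ≠ m₂ := fun h => hne (by rw [h])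
      have := Finset.single_le_sum (f := fun m₂' => ind (A (c₁ a) (c₂ m₂') y))
        (s := Finset.univ.filter (· ≠ m₂)) (fun _ _ => ind_nonneg _)
        (Finset.mem_filter.2 ⟨Finset.mem_univ b, hb⟩)
      simp only [ind_of hc] at this
      linarith
    · have ha' : a ∈ Finset.univ.filter (· ≠ m₁) :=
        Finset.mem_filter.2 ⟨Finset.mem_univ a, ha⟩
      by_cases hb : b = m₂
      · subst hb
        have := Finset.single_le_sum (f := fun m₁' => ind (A (c₁ m₁') (c₂ b) y))
          (s := Finset.univ.filter (· ≠ m₁)) (fun _ _ => ind_nonneg _) ha'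
        simp only [ind_of hc] at this
        linarith
      · have h1 := Finset.single_le_sum (f := fun m₂' => ind (A (c₁ a) (c₂ m₂') y))
          (s := Finset.univ.filter (· ≠ m₂)) (fun _ _ => ind_nonneg _)
          (Finset.mem_filter.2 ⟨Finset.mem_univ b, hb⟩)
        have h2 := Finset.single_le_sum
          (f := fun m₁' => ∑ m₂' with m₂' ≠ m₂, ind (A (c₁ m₁') (c₂ m₂') y))
          (s := Finset.univ.filter (· ≠ m₁))
          (fun _ _ => Finset.sum_nonneg fun _ _ => ind_nonneg _) ha'
        simp only [ind_of hc] at h1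
        linarith
  refine (Finset.sum_le_sum fun y _ =>
    mul_le_mul_of_nonneg_left (hpt y) ((hW _ _).1 y)).trans_eq ?_
  simp only [unionBound, mul_add, Finset.sum_add_distrib, Finset.mul_sum]
  congr 1
  · congr 1
    · congr 1
      exact Finset.sum_comm
    · exact Finset.sum_comm
  · rw [Finset.sum_comm]
    exact Finset.sum_congr rfl fun _ _ => Finset.sum_comm

end Average

/-- One-shot coding theorem for the multiple access channel with a shared random state. -/
theorem exists_channelCode {Q : Type*} [Fintype Q] {PQ : Q → ℝ} (hQ : PQ ∈ stdSimplex ℝ Q)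
    {P₁ : Q → X₁ → ℝ} {P₂ : Q → X₂ → ℝ}
    (hW : ∀ x₁ x₂, W x₁ x₂ ∈ stdSimplex ℝ Y) (h₁ : ∀ q, P₁ q ∈ stdSimplex ℝ X₁)
    (h₂ : ∀ q, P₂ q ∈ stdSimplex ℝ X₂) {K₁ K₂ K₁₂ : ℝ} (hK₁ : 0 < K₁) (hK₂ : 0 < K₂)
    (hK₁₂ : 0 < K₁₂) {A : Q → X₁ → X₂ → Y → Prop}
    (hA₁ : ∀ q x₁ x₂ y, A q x₁ x₂ y → K₁ * outLaw₁ W (P₁ q) x₂ y ≤ W x₁ x₂ y)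
    (hA₂ : ∀ q x₁ x₂ y, A q x₁ x₂ y → K₂ * outLaw₂ W (P₂ q) x₁ y ≤ W x₁ x₂ y)
    (hA₁₂ : ∀ q x₁ x₂ y, A q x₁ x₂ y → K₁₂ * outLaw₁₂ W (P₁ q) (P₂ q) y ≤ W x₁ x₂ y)
    {M₁ M₂ : ℕ} (hM₁ : 0 < M₁) (hM₂ : 0 < M₂) {μ : Fin M₁ → Fin M₂ → ℝ} (hμ : ∀ m₁ m₂, 0 ≤ μ m₁ m₂) :
    ∃ (c₁ : Fin M₁ → X₁) (c₂ : Fin M₂ → X₂) (dec : Y → Fin M₁ × Fin M₂),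
      ∑ m₁, ∑ m₂, μ m₁ m₂ * ∑ y, W (c₁ m₁) (c₂ m₂) y * ind (dec y ≠ (m₁, m₂)) ≤
      (∑ m₁, ∑ m₂, μ m₁ m₂) *
        (∑ q, PQ q * (∑ x₁, P₁ q x₁ * ∑ x₂, P₂ q x₂ * ∑ y, W x₁ x₂ y * ind (¬ A q x₁ x₂ y)) +
        ((M₁ : ℝ) - 1) / K₁ + ((M₂ : ℝ) - 1) / K₂ + ((M₁ : ℝ) - 1) * ((M₂ : ℝ) - 1) / K₁₂) := by
  set e := ((M₁ : ℝ) - 1) / K₁ + ((M₂ : ℝ) - 1) / K₂ + ((M₁ : ℝ) - 1) * ((M₂ : ℝ) - 1) / K₁₂ with he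
  set a : Q → ℝ := fun q =>
    ∑ x₁, P₁ q x₁ * ∑ x₂, P₂ q x₂ * ∑ y, W x₁ x₂ y * ind (¬ A q x₁ x₂ y) with ha
  have havg : ∀ q, ∑ c₁ : Fin M₁ → X₁, (∏ m, P₁ q (c₁ m)) *
      ∑ c₂ : Fin M₂ → X₂, (∏ m, P₂ q (c₂ m)) *
      (∑ m₁, ∑ m₂, μ m₁ m₂ * unionBound W (A q) c₁ c₂ m₁ m₂) ≤
      (∑ m₁, ∑ m₂, μ m₁ m₂) * (a q + e) := by
    intro q
    have hswap : ∑ c₁ : Fin M₁ → X₁, (∏ m, P₁ q (c₁ m)) *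
        ∑ c₂ : Fin M₂ → X₂, (∏ m, P₂ q (c₂ m)) *
        (∑ m₁, ∑ m₂, μ m₁ m₂ * unionBound W (A q) c₁ c₂ m₁ m₂) =
        ∑ m₁, ∑ m₂, μ m₁ m₂ * ∑ c₁ : Fin M₁ → X₁, (∏ m, P₁ q (c₁ m)) *
          ∑ c₂ : Fin M₂ → X₂, (∏ m, P₂ q (c₂ m)) * unionBound W (A q) c₁ c₂ m₁ m₂ := by
      have e1 : ∀ F : Fin M₁ → Fin M₂ → ℝ, ∑ m₁, ∑ m₂, μ m₁ m₂ * F m₁ m₂ =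
          ∑ m : Fin M₁ × Fin M₂, μ m.1 m.2 * F m.1 m.2 := fun F => by
        rw [Fintype.sum_prod_type]
      simp only [e1, sum_mul_sum_swap (fun c₂ : Fin M₂ → X₂ => ∏ m, P₂ q (c₂ m))]
      rw [sum_mul_sum_swap]
    rw [hswap]
    simp only [Finset.sum_mul]
    refine Finset.sum_le_sum fun m₁ _ => Finset.sum_le_sum fun m₂ _ =>
      mul_le_mul_of_nonneg_left ?_ (hμ m₁ m₂)
    refine (sum_unionBound_le hW (h₁ q) (h₂ q) hK₁ hK₂ hK₁₂ (hA₁ q) (hA₂ q) (hA₁₂ q)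
      m₁ m₂).trans_eq ?_
    simp only [ha, he]
    ring
  have hsum : ∑ q, PQ q * (∑ c₁ : Fin M₁ → X₁, (∏ m, P₁ q (c₁ m)) *
      ∑ c₂ : Fin M₂ → X₂, (∏ m, P₂ q (c₂ m)) *
      (∑ m₁, ∑ m₂, μ m₁ m₂ * unionBound W (A q) c₁ c₂ m₁ m₂)) ≤
      (∑ m₁, ∑ m₂, μ m₁ m₂) * (∑ q, PQ q * a q + e) := by
    refine (Finset.sum_le_sum fun q _ => mul_le_mul_of_nonneg_left (havg q) (hQ.1 q)).trans_eq ?_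
    simp only [mul_add, Finset.sum_add_distrib, ← Finset.sum_mul, hQ.2, one_mul]
    congr 1
    rw [Finset.mul_sum]
    exact Finset.sum_congr rfl fun q _ => by ring
  -- Derandomisation in turn: the shared state, then the codebook of each user.
  obtain ⟨q, hq⟩ := exists_le_of_sum_mul_le hQ hsum
  obtain ⟨c₁, hc₁⟩ := exists_le_of_sum_mul_le (prod_mem_stdSimplex fun _ => h₁ q) hq
  obtain ⟨c₂, hc₂⟩ := exists_le_of_sum_mul_le (prod_mem_stdSimplex fun _ => h₂ q) hc₁
  obtain ⟨dec, hdec⟩ := exists_decoder hW (A q) hM₁ hM₂ c₁ c₂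
  refine ⟨c₁, c₂, dec, ?_⟩
  refine (Finset.sum_le_sum fun m₁ _ => Finset.sum_le_sum fun m₂ _ =>
    mul_le_mul_of_nonneg_left (hdec m₁ m₂) (hμ m₁ m₂)).trans (hc₂.trans_eq ?_)
  rw [he]
  ring

end OneShot

/-! ### Block codes for the multiple access channel -/

section BlockChannel

variable {X₁ X₂ Y : Type*} [Fintype X₁] [Fintype X₂] [Fintype Y]
  {k : ℕ} {W : X₁ → X₂ → Y → ℝ} {pQ : Fin k → ℝ} {P₁ : Fin k → X₁ → ℝ} {P₂ : Fin k → X₂ → ℝ}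

lemma channelProb_mem_stdSimplex (hW : ∀ x₁ x₂, W x₁ x₂ ∈ stdSimplex ℝ Y) {n : ℕ}
    (x₁ : Fin n → X₁) (x₂ : Fin n → X₂) : channelProb W x₁ x₂ ∈ stdSimplex ℝ (Fin n → Y) :=
  prod_mem_stdSimplex fun i => hW (x₁ i) (x₂ i)

/-- Given the state sequence, input law and channel are both products, hence so is the output law.
Block thresholds thereby become thresholds on sums of letter densities. -/
lemma outLaw₁_channelProb {n : ℕ} (q : Fin n → Fin k) (x₂ : Fin n → X₂) (y : Fin n → Y) :
    outLaw₁ (channelProb W) (fun x : Fin n → X₁ => ∏ i, P₁ (q i) (x i)) x₂ y =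
      ∏ i, outLaw₁ W (P₁ (q i)) (x₂ i) (y i) := by
  simp only [outLaw₁, channelProb, ← Finset.prod_mul_distrib]
  exact sum_prod_eq_prod_sum (fun i x => P₁ (q i) x * W x (x₂ i) (y i))

lemma outLaw₂_channelProb {n : ℕ} (q : Fin n → Fin k) (x₁ : Fin n → X₁) (y : Fin n → Y) :
    outLaw₂ (channelProb W) (fun x : Fin n → X₂ => ∏ i, P₂ (q i) (x i)) x₁ y =
      ∏ i, outLaw₂ W (P₂ (q i)) (x₁ i) (y i) := by
  simp only [outLaw₂, channelProb, ← Finset.prod_mul_distrib]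
  exact sum_prod_eq_prod_sum (fun i x => P₂ (q i) x * W (x₁ i) x (y i))

lemma outLaw₁₂_channelProb {n : ℕ} (q : Fin n → Fin k) (y : Fin n → Y) :
    outLaw₁₂ (channelProb W) (fun x : Fin n → X₁ => ∏ i, P₁ (q i) (x i))
        (fun x : Fin n → X₂ => ∏ i, P₂ (q i) (x i)) y =
      ∏ i, outLaw₁₂ W (P₁ (q i)) (P₂ (q i)) (y i) := by
  simp only [outLaw₁₂, channelProb, ← Finset.prod_mul_distrib]
  rw [Fintype.sum_prod_type,
    ← sum_prod_eq_prod_sum (fun i (x : X₁ × X₂) => P₁ (q i) x.1 * P₂ (q i) x.2 * W x.1 x.2 (y i)),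
    sum_arrow_prod]

lemma sum_prod_macLaw {n : ℕ} (F : (Fin n → Fin k) → (Fin n → X₁) → (Fin n → X₂) → (Fin n → Y) → ℝ) :
    ∑ ω : Fin n → Fin k × X₁ × X₂ × Y, (∏ i, macLaw W pQ P₁ P₂ (ω i)) *
      F (fun i => (ω i).1) (fun i => (ω i).2.1) (fun i => (ω i).2.2.1) (fun i => (ω i).2.2.2) =
    ∑ q : Fin n → Fin k, (∏ i, pQ (q i)) * ∑ x₁ : Fin n → X₁, (∏ i, P₁ (q i) (x₁ i)) *
      ∑ x₂ : Fin n → X₂, (∏ i, P₂ (q i) (x₂ i)) * ∑ y, channelProb W x₁ x₂ y * F q x₁ x₂ y := by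
  simp only [sum_arrow_prod, macLaw, Finset.prod_mul_distrib, Finset.mul_sum, channelProb, mul_assoc]

lemma ind_or_or_le (P Q R : Prop) : ind (P ∨ Q ∨ R) ≤ ind P + ind Q + ind R := by
  have hP := ind_nonneg P
  have hQ := ind_nonneg Q
  have hR := ind_nonneg R
  by_cases h : P ∨ Q ∨ R
  · rw [ind_of h]
    rcases h with h | h | h <;> rw [ind_of h] <;> linarith
  · rw [ind_of_not h]
    linarith

/-- Coding theorem for the multiple access channel, with an explicit dependence of the error
probability on the numbers of messages and for arbitrary message statistics. -/
theorem exists_blockChannelCode (hW : ∀ x₁ x₂, W x₁ x₂ ∈ stdSimplex ℝ Y)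
    (hQ : pQ ∈ stdSimplex ℝ (Fin k)) (h₁ : ∀ q, P₁ q ∈ stdSimplex ℝ X₁)
    (h₂ : ∀ q, P₂ q ∈ stdSimplex ℝ X₂) {δ : ℝ} (hδ : 0 < δ) :
    ∃ κ : ℕ → ℝ, Tendsto κ atTop (nhds 0) ∧
      ∀ (n M₁ M₂ : ℕ) (_ : 0 < M₁) (_ : 0 < M₂) (μ : Fin M₁ → Fin M₂ → ℝ) (_ : ∀ m₁ m₂, 0 ≤ μ m₁ m₂),
      ∃ (c₁ : Fin M₁ → Fin n → X₁) (c₂ : Fin M₂ → Fin n → X₂) (dec : (Fin n → Y) → Fin M₁ × Fin M₂),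
      ∑ m₁, ∑ m₂, μ m₁ m₂ * ∑ y, channelProb W (c₁ m₁) (c₂ m₂) y * ind (dec y ≠ (m₁, m₂)) ≤
      (∑ m₁, ∑ m₂, μ m₁ m₂) * (κ n +
        ((M₁ : ℝ) - 1) / Real.exp (n * (macInfo₁ W pQ P₁ P₂ - δ)) +
        ((M₂ : ℝ) - 1) / Real.exp (n * (macInfo₂ W pQ P₁ P₂ - δ)) +
        ((M₁ : ℝ) - 1) * ((M₂ : ℝ) - 1) / Real.exp (n * (macInfo₁₂ W pQ P₁ P₂ - δ))) := by
  have hmac := macLaw_mem_stdSimplex hW hQ h₁ h₂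
  have t₁ := tendsto_prob_density_lt hmac (fun _ => macDensity₁_pos hW hQ h₁ h₂)
    (macInfo₁_eq_sum hW hQ h₁ h₂) hδ
  have t₂ := tendsto_prob_density_lt hmac (fun _ => macDensity₂_pos hW hQ h₁ h₂)
    (macInfo₂_eq_sum hW hQ h₁ h₂) hδ
  have t₁₂ := tendsto_prob_density_lt hmac (fun _ => macDensity₁₂_pos hW hQ h₁ h₂)
    (macInfo₁₂_eq_sum hW hQ h₁ h₂) hδ
  have t := (t₁.add t₂).add t₁₂
  simp only [add_zero] at t
  -- `κ n` is the sum of the probabilities that one of the three densities falls `δ` below its mean;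
  -- it involves neither the message numbers nor their law.
  refine ⟨_, t, fun n M₁ M₂ hM₁ hM₂ μ hμ => ?_⟩
  -- The block channel is treated as a one-shot channel whose letters are blocks and whose shared
  -- state is the time-sharing sequence.
  obtain ⟨c₁, c₂, dec, h⟩ := exists_channelCode (Q := Fin n → Fin k) (X₁ := Fin n → X₁)
    (X₂ := Fin n → X₂) (Y := Fin n → Y) (W := channelProb W)
    (prod_mem_stdSimplex fun _ => hQ) (P₁ := fun q x => ∏ i, P₁ (q i) (x i))
    (P₂ := fun q x => ∏ i, P₂ (q i) (x i)) (channelProb_mem_stdSimplex hW)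
    (fun q => prod_mem_stdSimplex fun i => h₁ (q i)) (fun q => prod_mem_stdSimplex fun i => h₂ (q i))
    (Real.exp_pos (n * (macInfo₁ W pQ P₁ P₂ - δ))) (Real.exp_pos (n * (macInfo₂ W pQ P₁ P₂ - δ)))
    (Real.exp_pos (n * (macInfo₁₂ W pQ P₁ P₂ - δ)))
    (A := fun q x₁ x₂ y =>
      Real.exp (n * (macInfo₁ W pQ P₁ P₂ - δ)) * ∏ i, outLaw₁ W (P₁ (q i)) (x₂ i) (y i) ≤
        channelProb W x₁ x₂ y ∧
      Real.exp (n * (macInfo₂ W pQ P₁ P₂ - δ)) * ∏ i, outLaw₂ W (P₂ (q i)) (x₁ i) (y i) ≤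
        channelProb W x₁ x₂ y ∧
      Real.exp (n * (macInfo₁₂ W pQ P₁ P₂ - δ)) * ∏ i, outLaw₁₂ W (P₁ (q i)) (P₂ (q i)) (y i) ≤
        channelProb W x₁ x₂ y)
    (fun q x₁ x₂ y hA => by rw [outLaw₁_channelProb]; exact hA.1)
    (fun q x₁ x₂ y hA => by rw [outLaw₂_channelProb]; exact hA.2.1)
    (fun q x₁ x₂ y hA => by rw [outLaw₁₂_channelProb]; exact hA.2.2) hM₁ hM₂ hμ
  refine ⟨c₁, c₂, dec, h.trans ?_⟩
  refine mul_le_mul_of_nonneg_left ?_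
    (Finset.sum_nonneg fun _ _ => Finset.sum_nonneg fun _ _ => hμ _ _)
  refine add_le_add (add_le_add (add_le_add ?_ le_rfl) le_rfl) le_rfl
  rw [← sum_prod_macLaw, ← Finset.sum_add_distrib, ← Finset.sum_add_distrib]
  refine Finset.sum_le_sum fun ω _ => ?_
  rw [← mul_add, ← mul_add]
  refine mul_le_mul_of_nonneg_left ?_ (Finset.prod_nonneg fun i _ => hmac.1 _)
  refine (le_of_eq ?_ : _ ≤ ind (_ ∨ _ ∨ _)).trans (ind_or_or_le _ _ _)
  simp only [channelProb, not_and_or, not_le]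

end BlockChannel

/-! ### Separate source and channel coding -/

section Separate

variable {σ ζ τ : Type*} [Fintype σ] [Fintype ζ] [Fintype τ]

/-- The memoryless source `(S, Z) ∼ r` has source codes, with side information `Z^n` at both ends,
of distortion close to `D` and with at most `1 + e n` codewords. -/
def SourceCodable (r : σ × ζ → ℝ) (d : σ → τ → ℝ) (D : ℝ) (e : ℕ → ℝ) : Prop :=
  ∀ ε > 0, ∀ᶠ n : ℕ in atTop, ∃ M : ℕ, 0 < M ∧ (M : ℝ) - 1 ≤ e n ∧
    ∃ (enc : (Fin n → σ) → (Fin n → ζ) → Fin M) (dec : Fin M → (Fin n → ζ) → (Fin n → τ)),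
      ∑ ω : Fin n → σ × ζ, (∏ i, r (ω i)) * blockDist d (fun i => (ω i).1)
        (dec (enc (fun i => (ω i).1) (fun i => (ω i).2)) (fun i => (ω i).2)) ≤ D + ε

lemma sourceCodable_of_testInfo_lt {r : σ × ζ → ℝ} (hr : r ∈ stdSimplex ℝ (σ × ζ))
    {V : σ → ζ → τ → ℝ} (hV : ∀ s z, V s z ∈ stdSimplex ℝ τ) {d : σ → τ → ℝ} {ρ D : ℝ}
    (hρ : testInfo r V < ρ) (hD : testDist r V d ≤ D) :
    SourceCodable r d D (fun n => Real.exp (n * ρ)) := fun _ hε =>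
  eventually_exists_sourceCode hr hV d hρ hD hε

/-- A letterwise estimate from `z` alone needs one index only, so the bound on `M - 1` is exactly
`0`. A small positive rate would not do when the channel conveys nothing. -/
lemma sourceCodable_of_testInfo_eq_zero {r : σ × ζ → ℝ} (hr : r ∈ stdSimplex ℝ (σ × ζ))
    {V : σ → ζ → τ → ℝ} (hV : ∀ s z, V s z ∈ stdSimplex ℝ τ) {d : σ → τ → ℝ} {D : ℝ}
    (h0 : testInfo r V = 0) (hD : testDist r V d ≤ D) :
    SourceCodable r d D (fun _ => 0) := by
  intro ε hε
  obtain ⟨f, hf⟩ := exists_estimator_of_testInfo_eq_zero hr hV h0 d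
  filter_upwards [eventually_gt_atTop 0] with n hn
  refine ⟨1, one_pos, by simp, fun _ _ => 0, fun _ z i => f (z i), ?_⟩
  rw [sum_prod_mul_blockDist hn hr d f]
  linarith

variable {S₁ S₂ Z X₁ X₂ Y T₁ T₂ : Type*} [Fintype S₁] [Fintype S₂] [Fintype Z]
  [Fintype X₁] [Fintype X₂] [Fintype Y] [Fintype T₁] [Fintype T₂]

lemma ite_zero_one_eq_ind (P : Prop) [Decidable P] : (if P then (0 : ℝ) else 1) = ind (¬ P) := by
  by_cases h : P
  · rw [if_pos h, ind_of_not (not_not.2 h)]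
  · rw [if_neg h, ind_of h]

lemma sourceProb_mem_stdSimplex {p : S₁ × S₂ × Z → ℝ} (hp : p ∈ stdSimplex ℝ (S₁ × S₂ × Z)) (n : ℕ) :
    (sourceProb p : (Fin n → S₁ × S₂ × Z) → ℝ) ∈ stdSimplex ℝ (Fin n → S₁ × S₂ × Z) :=
  prod_mem_stdSimplex (w := fun _ => p) fun _ => hp

/-- Decoding errors of small probability hardly affect a bounded cost. -/
lemma Code.expect_le_add {n : ℕ} {p : S₁ × S₂ × Z → ℝ} (hp : p ∈ stdSimplex ℝ (S₁ × S₂ × Z))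
    {W : X₁ → X₂ → Y → ℝ} (hW : ∀ x₁ x₂, W x₁ x₂ ∈ stdSimplex ℝ Y)
    (c : Code n S₁ S₂ Z X₁ X₂ Y T₁ T₂) {F G : (Fin n → S₁ × S₂ × Z) → (Fin n → Y) → ℝ}
    {H : (Fin n → S₁ × S₂ × Z) → ℝ} {B : ℝ} (h : ∀ ω y, F ω y ≤ H ω + B * G ω y) :
    c.expect p W F ≤ ∑ ω, sourceProb p ω * H ω + B * c.expect p W G := by
  unfold Code.expect
  rw [Finset.mul_sum, ← Finset.sum_add_distrib]
  refine Finset.sum_le_sum fun ω _ => ?_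
  have hc := channelProb_mem_stdSimplex hW (c.enc₁ (seq₁ ω) (seqZ ω)) (c.enc₂ (seq₂ ω) (seqZ ω))
  have : ∑ y, channelProb W (c.enc₁ (seq₁ ω) (seqZ ω)) (c.enc₂ (seq₂ ω) (seqZ ω)) y * F ω y ≤
      H ω + B * ∑ y, channelProb W (c.enc₁ (seq₁ ω) (seqZ ω)) (c.enc₂ (seq₂ ω) (seqZ ω)) y * G ω y := by
    refine (Finset.sum_le_sum fun y _ => mul_le_mul_of_nonneg_left (h ω y) (hc.1 y)).trans_eq ?_
    simp only [mul_add, Finset.sum_add_distrib, ← Finset.sum_mul, hc.2, one_mul, Finset.mul_sum]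
    congr 1
    exact Finset.sum_congr rfl fun y _ => by ring
  refine (mul_le_mul_of_nonneg_left this ((sourceProb_mem_stdSimplex hp n).1 ω)).trans_eq ?_
  ring

/-- Source codes followed by a channel code. -/
theorem separatelyAchievable_of_sourceCodable {p : S₁ × S₂ × Z → ℝ}
    (hp : p ∈ stdSimplex ℝ (S₁ × S₂ × Z)) {W : X₁ → X₂ → Y → ℝ}
    (hW : ∀ x₁ x₂, W x₁ x₂ ∈ stdSimplex ℝ Y) {d₁ : S₁ → T₁ → ℝ} {d₂ : S₂ → T₂ → ℝ} {D₁ D₂ : ℝ}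
    {e₁ e₂ : ℕ → ℝ} (hs₁ : SourceCodable (law p fun ω => (ω.1, ω.2.2)) d₁ D₁ e₁)
    (hs₂ : SourceCodable (law p fun ω => (ω.2.1, ω.2.2)) d₂ D₂ e₂)
    {k : ℕ} {pQ : Fin k → ℝ} {P₁ : Fin k → X₁ → ℝ} {P₂ : Fin k → X₂ → ℝ}
    (hQ : pQ ∈ stdSimplex ℝ (Fin k)) (h₁ : ∀ q, P₁ q ∈ stdSimplex ℝ X₁)
    (h₂ : ∀ q, P₂ q ∈ stdSimplex ℝ X₂) {δ : ℝ} (hδ : 0 < δ)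
    (ht₁ : Tendsto (fun n : ℕ => e₁ n / Real.exp (n * (macInfo₁ W pQ P₁ P₂ - δ))) atTop (nhds 0))
    (ht₂ : Tendsto (fun n : ℕ => e₂ n / Real.exp (n * (macInfo₂ W pQ P₁ P₂ - δ))) atTop (nhds 0))
    (ht₁₂ : Tendsto (fun n : ℕ => e₁ n * e₂ n / Real.exp (n * (macInfo₁₂ W pQ P₁ P₂ - δ)))
      atTop (nhds 0)) :
    SeparatelyAchievable p W d₁ d₂ D₁ D₂ := by
  classical
  intro ε hε
  obtain ⟨κ, hκ, hcode⟩ := exists_blockChannelCode hW hQ h₁ h₂ hδ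
  obtain ⟨B₁, hB₁0, hB₁⟩ := exists_distortion_bound d₁
  obtain ⟨B₂, hB₂0, hB₂⟩ := exists_distortion_bound d₂
  -- `η` is both below the tolerated error `ε` and so small that errors add at most `2 B_j η ≤ ε /
  -- 2` to each distortion.
  set η := min ε (ε / 2 / (2 * B₁ + 2 * B₂ + 1)) with hη
  have hη0 : 0 < η := by positivity
  have hηε : η ≤ ε := min_le_left _ _
  have hηB : (2 * B₁ + 2 * B₂ + 1) * η ≤ ε / 2 := by
    have : η ≤ ε / 2 / (2 * B₁ + 2 * B₂ + 1) := min_le_right _ _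
    rwa [le_div_iff₀ (by positivity), mul_comm] at this
  have ht := (((hκ.add ht₁).add ht₂).add ht₁₂).const_mul 2
  simp only [add_zero, mul_zero] at ht
  filter_upwards [ht.eventually (gt_mem_nhds hη0), hs₁ (ε / 2) (half_pos hε),
    hs₂ (ε / 2) (half_pos hε)] with n hn hn₁ hn₂
  obtain ⟨M₁, hM₁, hMe₁, enc₁, dec₁, hd₁⟩ := hn₁
  obtain ⟨M₂, hM₂, hMe₂, enc₂, dec₂, hd₂⟩ := hn₂
  have hM₁' : (0 : ℝ) < M₁ := by exact_mod_cast hM₁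
  have hM₂' : (0 : ℝ) < M₂ := by exact_mod_cast hM₂
  set msg : (Fin n → S₁ × S₂ × Z) → Fin M₁ × Fin M₂ := fun ω =>
    (enc₁ (seq₁ ω) (seqZ ω), enc₂ (seq₂ ω) (seqZ ω)) with hmsg
  have hsp := sourceProb_mem_stdSimplex hp n
  set ν : Fin M₁ → Fin M₂ → ℝ := fun m₁ m₂ => law (sourceProb p) msg (m₁, m₂) with hν
  have hν0 : ∀ m₁ m₂, 0 ≤ ν m₁ m₂ := fun m₁ m₂ => law_nonneg hsp.1 _ _
  -- The channel code is chosen for the uniform law plus the law `ν` of the source indices, of total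
  -- mass `2`: a small combined error makes both errors small.
  obtain ⟨c₁, c₂, dec, herr⟩ := hcode n M₁ M₂ hM₁ hM₂ (fun m₁ m₂ => 1 / ((M₁ : ℝ) * M₂) + ν m₁ m₂)
    (fun m₁ m₂ => add_nonneg (by positivity) (hν0 m₁ m₂))
  have hνsum : ∑ m₁, ∑ m₂, ν m₁ m₂ = 1 := by
    rw [← Fintype.sum_prod_type' (fun m₁ m₂ => ν m₁ m₂)]
    exact (sum_law _ _).trans hsp.2
  have htot : ∑ m₁ : Fin M₁, ∑ m₂ : Fin M₂, (1 / ((M₁ : ℝ) * M₂) + ν m₁ m₂) = 2 := by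
    simp only [Finset.sum_add_distrib, hνsum, Finset.sum_const, Finset.card_univ, Fintype.card_fin,
      nsmul_eq_mul]
    field_simp
    norm_num
  rw [htot] at herr
  let c : SepCode n S₁ S₂ Z X₁ X₂ Y T₁ T₂ :=
    { M₁ := M₁, M₂ := M₂, srcEnc₁ := enc₁, srcEnc₂ := enc₂, srcDec₁ := dec₁, srcDec₂ := dec₂,
      chEnc₁ := c₁, chEnc₂ := c₂, chDec := dec }
  set E : Fin M₁ → Fin M₂ → ℝ := fun m₁ m₂ =>
    ∑ y, channelProb W (c₁ m₁) (c₂ m₂) y * ind (dec y ≠ (m₁, m₂)) with hE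
  have hE0 : ∀ m₁ m₂, 0 ≤ E m₁ m₂ := fun m₁ m₂ => Finset.sum_nonneg fun y _ =>
    mul_nonneg ((channelProb_mem_stdSimplex hW _ _).1 y) (ind_nonneg _)
  have hunif : c.uniformError W = ∑ m₁, ∑ m₂, 1 / ((M₁ : ℝ) * M₂) * E m₁ m₂ := by
    simp only [SepCode.uniformError, ite_zero_one_eq_ind, ← Finset.mul_sum, hE, c, ne_eq]
    ring
  have hsrc : c.sourceError p W = ∑ m₁, ∑ m₂, ν m₁ m₂ * E m₁ m₂ := by
    rw [← Fintype.sum_prod_type' (fun m₁ m₂ => ν m₁ m₂ * E m₁ m₂)]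
    refine Eq.trans ?_ (sum_law_mul (sourceProb p) msg (fun m => E m.1 m.2)).symm
    simp only [SepCode.sourceError, Code.expect, ite_zero_one_eq_ind, hE, c, ne_eq, SepCode.toCode,
      hmsg]
  have hsum : c.uniformError W + c.sourceError p W ≤ η := by
    rw [hunif, hsrc, ← Finset.sum_add_distrib]
    simp only [← Finset.sum_add_distrib, ← add_mul]
    refine (herr.trans ?_).trans hn.le
    have hm1 : (0 : ℝ) ≤ (M₁ : ℝ) - 1 := by
      have : (1 : ℝ) ≤ M₁ := by exact_mod_cast hM₁
      linarith
    have hm2 : (0 : ℝ) ≤ (M₂ : ℝ) - 1 := by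
      have : (1 : ℝ) ≤ M₂ := by exact_mod_cast hM₂
      linarith
    have : 0 ≤ e₁ n := hm1.trans hMe₁
    gcongr
  have hu0 : 0 ≤ c.uniformError W := by
    rw [hunif]
    exact Finset.sum_nonneg fun _ _ => Finset.sum_nonneg fun _ _ =>
      mul_nonneg (by positivity) (hE0 _ _)
  have hs0 : 0 ≤ c.sourceError p W := by
    rw [hsrc]
    exact Finset.sum_nonneg fun _ _ => Finset.sum_nonneg fun _ _ => mul_nonneg (hν0 _ _) (hE0 _ _)
  have hsd₁ : ∑ ω, sourceProb p ω * blockDist d₁ (seq₁ ω) (c.srcDec₁ (c.srcEnc₁ (seq₁ ω) (seqZ ω))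
      (seqZ ω)) ≤ D₁ + ε / 2 := by
    refine le_trans (le_of_eq ?_) hd₁
    exact sum_prod_comp p (fun ω => (ω.1, ω.2.2)) (fun a : Fin n → S₁ × Z =>
      blockDist d₁ (fun i => (a i).1)
        (dec₁ (enc₁ (fun i => (a i).1) (fun i => (a i).2)) (fun i => (a i).2)))
  have hsd₂ : ∑ ω, sourceProb p ω * blockDist d₂ (seq₂ ω) (c.srcDec₂ (c.srcEnc₂ (seq₂ ω) (seqZ ω))
      (seqZ ω)) ≤ D₂ + ε / 2 := by
    refine le_trans (le_of_eq ?_) hd₂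
    exact sum_prod_comp p (fun ω => (ω.2.1, ω.2.2)) (fun a : Fin n → S₂ × Z =>
      blockDist d₂ (fun i => (a i).1)
        (dec₂ (enc₂ (fun i => (a i).1) (fun i => (a i).2)) (fun i => (a i).2)))
  -- Without a decoding error both reconstructions agree; otherwise the block distortions differ by
  -- at most `2 B₁`.
  have hcomb₁ : c.toCode.expect p W (fun ω y => blockDist d₁ (seq₁ ω) (c.toCode.dec₁ y (seqZ ω))) ≤
      _ + 2 * B₁ * c.sourceError p W := Code.expect_le_add hp hW c.toCode
    (H := fun ω => blockDist d₁ (seq₁ ω) (c.srcDec₁ (c.srcEnc₁ (seq₁ ω) (seqZ ω)) (seqZ ω))) (by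
      intro ω y
      simp only [SepCode.toCode]
      split_ifs with h
      · rw [h]; simp
      · have b1 := abs_le.1 (abs_blockDist_le hB₁0 hB₁ (seq₁ ω) (c.srcDec₁ (c.chDec y).1 (seqZ ω)))
        have b2 := abs_le.1 (abs_blockDist_le hB₁0 hB₁ (seq₁ ω)
          (c.srcDec₁ (c.srcEnc₁ (seq₁ ω) (seqZ ω)) (seqZ ω)))
        linarith)
  have hcomb₂ : c.toCode.expect p W (fun ω y => blockDist d₂ (seq₂ ω) (c.toCode.dec₂ y (seqZ ω))) ≤
      _ + 2 * B₂ * c.sourceError p W := Code.expect_le_add hp hW c.toCode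
    (H := fun ω => blockDist d₂ (seq₂ ω) (c.srcDec₂ (c.srcEnc₂ (seq₂ ω) (seqZ ω)) (seqZ ω))) (by
      intro ω y
      simp only [SepCode.toCode]
      split_ifs with h
      · rw [h]; simp
      · have b1 := abs_le.1 (abs_blockDist_le hB₂0 hB₂ (seq₂ ω) (c.srcDec₂ (c.chDec y).2 (seqZ ω)))
        have b2 := abs_le.1 (abs_blockDist_le hB₂0 hB₂ (seq₂ ω)
          (c.srcDec₂ (c.srcEnc₂ (seq₂ ω) (seqZ ω)) (seqZ ω)))
        linarith)
  have hsη : c.sourceError p W ≤ η := by linarith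
  refine ⟨c, ⟨by linarith, by linarith⟩, by linarith, by linarith, ?_, ?_⟩
  · have := mul_le_mul_of_nonneg_left hsη (by positivity : 0 ≤ 2 * B₁)
    have h2 : 0 ≤ (2 * B₂ + 1) * η := by positivity
    linarith
  · have := mul_le_mul_of_nonneg_left hsη (by positivity : 0 ≤ 2 * B₂)
    have h2 : 0 ≤ (2 * B₁ + 1) * η := by positivity
    linarith

/-- The slack in the definition absorbs a small relaxation of the distortions, which leaves room to
perturb test channels. -/
lemma separatelyAchievable_of_forall {p : S₁ × S₂ × Z → ℝ} {W : X₁ → X₂ → Y → ℝ}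
    {d₁ : S₁ → T₁ → ℝ} {d₂ : S₂ → T₂ → ℝ} {D₁ D₂ : ℝ}
    (h : ∀ ε > 0, SeparatelyAchievable p W d₁ d₂ (D₁ + ε) (D₂ + ε)) :
    SeparatelyAchievable p W d₁ d₂ D₁ D₂ := by
  intro ε hε
  filter_upwards [h (ε / 2) (half_pos hε) (ε / 2) (half_pos hε)] with n ⟨c, h1, h2, h3, h4⟩
  rw [add_assoc, add_assoc, add_halves] at h1 h4
  exact ⟨c, h1, h2.trans (by linarith), h3.trans (by linarith), h4⟩

lemma SeparatelyAchievable.achievable {p : S₁ × S₂ × Z → ℝ} {W : X₁ → X₂ → Y → ℝ}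
    {d₁ : S₁ → T₁ → ℝ} {d₂ : S₂ → T₂ → ℝ} {D₁ D₂ : ℝ}
    (h : SeparatelyAchievable p W d₁ d₂ D₁ D₂) : Achievable p W d₁ d₂ D₁ D₂ := by
  intro ε hε
  filter_upwards [h ε hε] with n ⟨c, _, _, _, h4⟩
  exact ⟨c.toCode, h4⟩

end Separate

/-! ### Converse: information inequalities for a block -/

section BlockInequalities

variable {Ω α₁ α₂ β γ ξ : Type*} [Fintype Ω] [Fintype α₁] [Fintype α₂] [Fintype β] [Fintype γ]
  [Fintype ξ] {r : Ω → ℝ} {S₁ : Ω → α₁} {S₂ : Ω → α₂} {Y : Ω → β} {Z : Ω → γ}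

lemma condMutualInfo_comm (r : Ω → ℝ) (A : Ω → α₁) (B : Ω → α₂) (C : Ω → γ) :
    condMutualInfo r A B C = condMutualInfo r B A C := by
  rw [condMutualInfo_symm, condMutualInfo]

/-- If the sources are conditionally independent, knowing the other user's input can only help. -/
lemma condMutualInfo_le_of_indep (hr : ∀ ω, 0 ≤ r ω) (hind : condMutualInfo r S₁ S₂ Z = 0)
    {X₂ : Ω → ξ} (hX : ∀ ω ω', S₂ ω = S₂ ω' → Z ω = Z ω' → X₂ ω = X₂ ω') :
    condMutualInfo r S₁ Y Z ≤ condEntropy r Y (fun ω => (X₂ ω, Z ω)) -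
      condEntropy r Y (fun ω => (S₁ ω, S₂ ω, Z ω)) := by
  -- By independence `H(S₁|Z) = H(S₁|S₂,Z) ≤ H(S₁|X₂,Z)`, while `H(S₁|Y,Z) ≥ H(S₁|Y,X₂,Z)`. So the
  -- information is at most `I(S₁;Y|X₂,Z)`, and conditioning on `S₂` in place of `X₂` lowers its
  -- negative term.
  have h1 : condEntropy r S₁ (fun ω => (S₂ ω, Z ω)) ≤ condEntropy r S₁ (fun ω => (X₂ ω, Z ω)) :=
    condEntropy_le_of_factor hr S₁ fun ω ω' h => by
      simp only [Prod.mk.injEq] at h ⊢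
      exact ⟨hX ω ω' h.1 h.2, h.2⟩
  have h2 : condEntropy r S₁ (fun ω => (Y ω, X₂ ω, Z ω)) ≤ condEntropy r S₁ (fun ω => (Y ω, Z ω)) :=
    condEntropy_le_of_factor hr S₁ fun ω ω' h => by
      simp only [Prod.mk.injEq] at h ⊢
      exact ⟨h.1, h.2.2⟩
  have h3 : condEntropy r Y (fun ω => (S₁ ω, S₂ ω, Z ω)) ≤
      condEntropy r Y (fun ω => (S₁ ω, X₂ ω, Z ω)) :=
    condEntropy_le_of_factor hr Y fun ω ω' h => by
      simp only [Prod.mk.injEq] at h ⊢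
      exact ⟨h.1, hX ω ω' h.2.1 h.2.2, h.2.2⟩
  have h4 := condMutualInfo_symm r S₁ Y (fun ω => (X₂ ω, Z ω))
  simp only [condMutualInfo] at hind h4 ⊢
  linarith

/-- Independence adds the prior entropies exactly, while the posterior entropies are subadditive; so
the two informations sum to at most `I(S₁,S₂;Y|Z)`. -/
lemma condMutualInfo_add_le_of_indep (hr : ∀ ω, 0 ≤ r ω) (hind : condMutualInfo r S₁ S₂ Z = 0) :
    condMutualInfo r S₁ Y Z + condMutualInfo r S₂ Y Z ≤ condEntropy r Y Z -
      condEntropy r Y (fun ω => (S₁ ω, S₂ ω, Z ω)) := by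
  have h1 := condEntropy_pair r S₁ S₂ Z
  have h2 := condEntropy_pair_le hr S₁ S₂ (fun ω => (Y ω, Z ω))
  have h3 := condMutualInfo_symm r (fun ω => (S₁ ω, S₂ ω)) Y Z
  have h4 : condEntropy r Y (fun ω => ((S₁ ω, S₂ ω), Z ω)) =
      condEntropy r Y (fun ω => (S₁ ω, S₂ ω, Z ω)) :=
    condEntropy_congr r (fun _ _ => Iff.rfl) fun ω ω' => by simp only [Prod.mk.injEq]; tauto
  rw [condMutualInfo_symm] at hind
  rw [h4] at h3
  simp only [condMutualInfo] at h3 ⊢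
  linarith

end BlockInequalities

/-! ### Converse: single-letter test channels -/

section TimeSharing

variable {Ω σ ζ τ β : Type*} [Fintype Ω] [Fintype σ] [Fintype ζ] [Fintype τ] [Fintype β] {n : ℕ}

lemma law_mixture {ι α : Type*} [Fintype ι] [Fintype α] (w : ι → ℝ) (r : Ω → ℝ) (A : ι → Ω → α)
    (a : α) : law (fun x : ι × Ω => w x.1 * r x.2) (fun x => A x.1 x.2) a =
      ∑ i, w i * law r (A i) a := by
  classical
  simp only [law_eq_sum_mul, Fintype.sum_prod_type, Finset.mul_sum, mul_assoc]

lemma law_coord_of_iid {α : Type*} [Fintype α] {r : Ω → ℝ} {p : α → ℝ} (hp : p ∈ stdSimplex ℝ α)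
    {A : Ω → Fin n → α} (h : law r A = fun x => ∏ i, p (x i)) (i : Fin n) :
    law r (fun ω => A ω i) = p := by
  classical
  funext a
  rw [← law_comp r A (fun x => x i), h, law_eq_sum_mul,
    sum_prod_mul_coord (w := fun _ => p) (fun _ => hp.2) i (fun x => if x = a then 1 else 0)]
  simp

lemma entropy_of_iid {α : Type*} [Fintype α] {r : Ω → ℝ} {p : α → ℝ} (hp : p ∈ stdSimplex ℝ α)
    {A : Ω → Fin n → α} (h : law r A = fun x => ∏ i, p (x i)) :
    entropy r A = n * ∑ a, Real.negMulLog (p a) := by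
  rw [entropy, h, sum_negMulLog_prod (w := fun _ => p) (fun _ => hp.2)]
  simp

/-- A block of memoryless pairs has additive conditional entropy. -/
lemma condEntropy_of_iid {r : Ω → ℝ} {p : σ × ζ → ℝ} (hp : p ∈ stdSimplex ℝ (σ × ζ))
    {S : Ω → Fin n → σ} {Z : Ω → Fin n → ζ}
    (h : law r (fun ω i => (S ω i, Z ω i)) = fun x => ∏ i, p (x i)) :
    condEntropy r S Z = n * condEntropy p (fun a => a.1) (fun a => a.2) := by
  have hZ : law r Z = fun z => ∏ i, law p (fun a => a.2) (z i) := by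
    funext z
    rw [← law_prod, ← h, law_comp]
  have h1 : entropy r (fun ω => (S ω, Z ω)) = n * ∑ a, Real.negMulLog (p a) := by
    rw [← entropy_of_iid hp h]
    refine entropy_congr r fun ω ω' => ?_
    simp only [Prod.mk.injEq, funext_iff]
    exact ⟨fun h i => ⟨h.1 i, h.2 i⟩, fun h => ⟨fun i => (h i).1, fun i => (h i).2⟩⟩
  have h2 : entropy p (fun a => (a.1, a.2)) = ∑ a, Real.negMulLog (p a) := by
    rw [entropy, show (fun a : σ × ζ => (a.1, a.2)) = fun a => a from rfl, law_id]
  rw [condEntropy, condEntropy, h1, h2, entropy_of_iid (law_mem_stdSimplex hp _) hZ, entropy]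
  ring

/-- Time sharing turns a block code into a single-letter test channel. -/
theorem exists_testChannel [Nonempty τ] (hn : 0 < n) {r : Ω → ℝ} (hr : r ∈ stdSimplex ℝ Ω)
    {p : σ × ζ → ℝ} (hp : p ∈ stdSimplex ℝ (σ × ζ))
    {S : Ω → Fin n → σ} {Z : Ω → Fin n → ζ} {Y : Ω → β} {T : Ω → Fin n → τ}
    (h : law r (fun ω i => (S ω i, Z ω i)) = fun x => ∏ i, p (x i))
    (hT : ∀ ω ω', Y ω = Y ω' → Z ω = Z ω' → T ω = T ω') :
    ∃ V : σ → ζ → τ → ℝ, (∀ s z, V s z ∈ stdSimplex ℝ τ) ∧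
      (∀ d : σ → τ → ℝ, testDist p V d = ∑ ω, r ω * blockDist d (S ω) (T ω)) ∧
      n * testInfo p V ≤ condMutualInfo r S Y Z := by
  have hn' : (0 : ℝ) < n := by exact_mod_cast hn
  -- A uniform time index is adjoined, independent of the block. As the pairs are i.i.d., the pair
  -- at the random time still has law `p`.
  set r' : Fin n × Ω → ℝ := fun x => (fun _ => 1 / (n : ℝ)) x.1 * r x.2 with hr'
  have hr'0 : ∀ x, 0 ≤ r' x := fun x => mul_nonneg (by positivity) (hr.1 _)
  have hSZ : law r' (fun x => (S x.2 x.1, Z x.2 x.1)) = p := by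
    funext a
    refine (law_mixture (fun _ => 1 / (n : ℝ)) r (fun i ω => (S ω i, Z ω i)) a).trans ?_
    simp only [law_coord_of_iid hp h]
    simp only [Finset.sum_const, Finset.card_univ, Fintype.card_fin, nsmul_eq_mul]
    field_simp
  -- The test channel: the conditional law of the reconstruction letter at the random time given the
  -- source pair at that time.
  obtain ⟨K, hK, hKlaw⟩ := exists_kernel hr'0 (fun x => T x.2 x.1)
    (fun x => (S x.2 x.1, Z x.2 x.1))
  have hjoint : jointLaw p (fun s z => K (s, z)) =
      law r' (fun x => (S x.2 x.1, Z x.2 x.1, T x.2 x.1)) := by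
    funext ⟨s, z, t⟩
    have := hKlaw t (s, z)
    rw [hSZ] at this
    rw [jointLaw, ← this]
    exact law_congr_iff _ fun x => by simp only [Prod.mk.injEq]; tauto
  refine ⟨fun s z => K (s, z), fun s z => hK (s, z), fun d => ?_, ?_⟩
  · rw [testDist, hjoint, sum_law_mul _ _ (fun a : σ × ζ × τ => d a.1 a.2.2), Fintype.sum_prod_type,
      Finset.sum_comm]
    refine Finset.sum_congr rfl fun ω _ => ?_
    simp only [hr', blockDist, ← Finset.mul_sum]
    ring
  · have h1 : testInfo p (fun s z => K (s, z)) =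
        condEntropy p (fun a => a.1) (fun a => a.2) -
        condEntropy r' (fun x => S x.2 x.1) (fun x => (T x.2 x.1, Z x.2 x.1)) := by
      rw [testInfo, hjoint, condMutualInfo_law, condMutualInfo]
      congr 1
      rw [← hSZ, condEntropy_law]
    -- Forgetting the time index only raises the uncertainty about the letter. Each letter is in
    -- turn less certain given `(T_i, Z_i)` than given `(Y, Z)`, as `T` is a function of the latter.
    have h2 : ∑ i, 1 / (n : ℝ) * condEntropy r (fun ω => S ω i) (fun ω => (T ω i, Z ω i)) ≤
        condEntropy r' (fun x => S x.2 x.1) (fun x => (T x.2 x.1, Z x.2 x.1)) := by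
      rw [← condEntropy_mixture (fun _ => 1 / (n : ℝ)) r (fun i ω => S ω i)
        (fun i ω => (T ω i, Z ω i))]
      exact condEntropy_le_of_factor hr'0 _ fun x x' hx => (Prod.mk.injEq _ _ _ _ ▸ hx).1
    have h3 : ∀ i, condEntropy r (fun ω => S ω i) (fun ω => (Y ω, Z ω)) ≤
        condEntropy r (fun ω => S ω i) (fun ω => (T ω i, Z ω i)) := fun i =>
      condEntropy_le_of_factor hr.1 _ fun ω ω' hx => by
        simp only [Prod.mk.injEq] at hx ⊢
        exact ⟨by rw [hT ω ω' hx.1 hx.2], by rw [hx.2]⟩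
    have h4 := condEntropy_tuple_le hr.1 (fun ω => (Y ω, Z ω)) S
    have h5 := h4.trans (Finset.sum_le_sum fun i _ => h3 i)
    rw [← Finset.mul_sum] at h2
    rw [condMutualInfo, condEntropy_of_iid hp h, h1, mul_sub]
    have h6 := mul_le_mul_of_nonneg_left h2 hn'.le
    rw [← mul_assoc, mul_one_div_cancel hn'.ne', one_mul] at h6
    linarith

end TimeSharing

/-! ### Converse: the channel output -/

section Output

variable {Θ Y δ : Type*} [Fintype Θ] [Fintype Y] [Fintype δ] {n : ℕ}

/-- The joint law of `θ ∼ ρ` and a block `y^n` with independent letters `y_i ∼ w θ i`. -/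
def outputLaw (ρ : Θ → ℝ) (w : Θ → Fin n → Y → ℝ) : Θ × (Fin n → Y) → ℝ :=
  fun x => ρ x.1 * ∏ i, w x.1 i (x.2 i)

variable {ρ : Θ → ℝ} {w : Θ → Fin n → Y → ℝ}

lemma outputLaw_mem_stdSimplex (hρ : ρ ∈ stdSimplex ℝ Θ) (hw : ∀ θ i, w θ i ∈ stdSimplex ℝ Y) :
    outputLaw ρ w ∈ stdSimplex ℝ (Θ × (Fin n → Y)) := by
  refine ⟨fun x => mul_nonneg (hρ.1 _) (Finset.prod_nonneg fun i _ => (hw _ _).1 _), ?_⟩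
  rw [Fintype.sum_prod_type]
  simp only [outputLaw, ← Finset.mul_sum, sum_prod_eq_one fun i => (hw _ i).2, mul_one, hρ.2]

lemma law_outputLaw (hw : ∀ θ i, w θ i ∈ stdSimplex ℝ Y) (D : Θ → δ) :
    law (outputLaw ρ w) (fun x => D x.1) = law ρ D := by
  classical
  funext d
  rw [law_eq_sum_mul, law_eq_sum_mul, Fintype.sum_prod_type]
  refine Finset.sum_congr rfl fun θ _ => ?_
  refine (Finset.sum_mul _ (fun y => outputLaw ρ w (θ, y)) (if D θ = d then 1 else 0)).symm.trans ?_
  simp only [outputLaw, ← Finset.mul_sum, sum_prod_eq_one fun i => (hw θ i).2, mul_one]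

/-- `D` may be any statistic of `θ` that determines the law of the `i`-th letter; given `D` the
letter has that law and the rest of `θ` is irrelevant. -/
lemma law_outputLaw_coord (hw : ∀ θ i, w θ i ∈ stdSimplex ℝ Y) {D : Θ → δ} {K : δ → Y → ℝ}
    {i : Fin n} (hK : ∀ θ, w θ i = K (D θ)) (y : Y) (d : δ) :
    law (outputLaw ρ w) (fun x => (x.2 i, D x.1)) (y, d) = law ρ D d * K d y := by
  classical
  rw [law_eq_sum_mul, law_eq_sum_mul, Fintype.sum_prod_type, Finset.sum_mul]
  refine Finset.sum_congr rfl fun θ _ => ?_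
  have h := sum_prod_mul_coord (w := w θ) (fun k => (hw θ k).2) i (fun x => if x = y then 1 else 0)
  simp only [mul_ite, mul_one, mul_zero, Finset.sum_ite_eq', Finset.mem_univ, if_true] at h
  by_cases hd : D θ = d
  · simp only [outputLaw, Prod.mk.injEq, hd, and_true, if_true, mul_one, mul_ite, mul_zero]
    rw [← hd, ← hK, ← h, Finset.mul_sum]
    exact Finset.sum_congr rfl fun x _ => by split_ifs <;> simp
  · simp [hd]

lemma condEntropy_outputLaw_coord (hw : ∀ θ i, w θ i ∈ stdSimplex ℝ Y) {D : Θ → δ} {K : δ → Y → ℝ}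
    {i : Fin n} (hKs : ∀ d, ∑ y, K d y = 1) (hK : ∀ θ, w θ i = K (D θ)) :
    condEntropy (outputLaw ρ w) (fun x => x.2 i) (fun x => D x.1) =
      ∑ θ, ρ θ * ∑ y, Real.negMulLog (w θ i y) := by
  rw [condEntropy_of_kernel hKs (law_outputLaw_coord hw hK), sum_law_mul]
  simp only [hK]

lemma condEntropy_outputLaw (hw : ∀ θ i, w θ i ∈ stdSimplex ℝ Y) {D : Θ → δ}
    (hD : Function.Injective D) :
    condEntropy (outputLaw ρ w) (fun x => x.2) (fun x => D x.1) =
      ∑ θ, ρ θ * ∑ i, ∑ y, Real.negMulLog (w θ i y) := by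
  rw [condEntropy_congr _ (A := fun x : Θ × (Fin n → Y) => x.2) (B := fun x => x.2)
    (C := fun x => D x.1) (C' := fun x => x.1) (fun _ _ => Iff.rfl) (fun _ _ => hD.eq_iff),
    condEntropy_of_kernel (μ := ρ) (K := fun θ y => ∏ i, w θ i (y i))
      (fun θ => sum_prod_eq_one fun i => (hw θ i).2)]
  · exact Finset.sum_congr rfl fun θ _ => by rw [sum_negMulLog_prod fun i => (hw θ i).2]
  · intro y θ
    exact law_of_injective (outputLaw ρ w) (A := fun x : Θ × (Fin n → Y) => (x.2, x.1))
      (fun a b h => by simp only [Prod.mk.injEq] at h; ext1 <;> simp [h]) (θ, y)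

end Output

lemma nat_mul_condEntropy_mixture {Ω α γ : Type*} [Fintype Ω] [Fintype α] [Fintype γ] {n : ℕ}
    (hn : 0 < n) (r : Ω → ℝ) (A : Fin n → Ω → α) (C : Fin n → Ω → γ) :
    n * condEntropy (fun x : Fin n × Ω => (fun _ => 1 / (n : ℝ)) x.1 * r x.2) (fun x => A x.1 x.2)
      (fun x => (C x.1 x.2, x.1)) = ∑ i, condEntropy r (A i) (C i) := by
  have hn' : (n : ℝ) ≠ 0 := by positivity
  rw [condEntropy_mixture (fun _ => 1 / (n : ℝ)) r A C, ← Finset.mul_sum,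
    ← mul_assoc, mul_one_div_cancel hn', one_mul]

/-! ### Converse: single-letterizing the multiple access channel -/

section MacConverse

variable {C A₁ A₂ X₁ X₂ Y : Type*} [Fintype C] [Fintype A₁] [Fintype A₂] [Fintype X₁] [Fintype X₂]
  [Fintype Y] {n : ℕ} {lam : C → ℝ} {α : C → A₁ → ℝ} {β : C → A₂ → ℝ} {W : X₁ → X₂ → Y → ℝ}
  {f₁ : A₁ → C → Fin n → X₁} {f₂ : A₂ → C → Fin n → X₂}

/-- The law of `(Z, S₁, S₂)` when `S₁` and `S₂` are conditionally independent given `Z`. -/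
def indepLaw (lam : C → ℝ) (α : C → A₁ → ℝ) (β : C → A₂ → ℝ) : C × A₁ × A₂ → ℝ :=
  fun θ => lam θ.1 * α θ.1 θ.2.1 * β θ.1 θ.2.2

lemma indepLaw_mem_stdSimplex (hl : lam ∈ stdSimplex ℝ C) (hα : ∀ c, α c ∈ stdSimplex ℝ A₁)
    (hβ : ∀ c, β c ∈ stdSimplex ℝ A₂) : indepLaw lam α β ∈ stdSimplex ℝ (C × A₁ × A₂) := by
  refine ⟨fun θ => mul_nonneg (mul_nonneg (hl.1 _) ((hα _).1 _)) ((hβ _).1 _), ?_⟩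
  simp only [indepLaw, Fintype.sum_prod_type, ← Finset.mul_sum, (hα _).2, (hβ _).2, mul_one, hl.2]

open Classical in
-- Encoders act separately on sources independent given `c`, so the inputs stay independent given
-- `c`. This yields the product form `p(x₁|q) p(x₂|q)`.
lemma law_indepLaw_inputs (lam : C → ℝ) (α : C → A₁ → ℝ) (β : C → A₂ → ℝ) (g₁ : A₁ → C → X₁)
    (g₂ : A₂ → C → X₂) (c : C) (x₁ : X₁) (x₂ : X₂) :
    law (indepLaw lam α β) (fun θ => (θ.1, g₁ θ.2.1 θ.1, g₂ θ.2.2 θ.1)) (c, x₁, x₂) =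
      lam c * (∑ s, α c s * if g₁ s c = x₁ then 1 else 0) *
        ∑ s, β c s * if g₂ s c = x₂ then 1 else 0 := by
  rw [law_eq_sum_mul]
  simp only [Fintype.sum_prod_type, indepLaw, Prod.mk.injEq]
  rw [Finset.sum_eq_single c]
  · rw [mul_assoc, Finset.sum_mul, Finset.mul_sum]
    refine Finset.sum_congr rfl fun s _ => ?_
    rw [Finset.mul_sum, Finset.mul_sum]
    refine Finset.sum_congr rfl fun s' _ => ?_
    by_cases h1 : g₁ s c = x₁ <;> by_cases h2 : g₂ s' c = x₂ <;> simp [h1, h2, mul_assoc]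
  · intro b _ hb
    simp [hb]
  · simp

lemma condMutualInfo_indepLaw (hl : lam ∈ stdSimplex ℝ C) (hα : ∀ c, α c ∈ stdSimplex ℝ A₁)
    (hβ : ∀ c, β c ∈ stdSimplex ℝ A₂) :
    condMutualInfo (indepLaw lam α β) (fun θ => θ.2.1) (fun θ => θ.2.2) (fun θ => θ.1) = 0 := by
  rw [condMutualInfo_eq_zero_iff (indepLaw_mem_stdSimplex hl hα hβ).1]
  have h3 : ∀ a b c, law (indepLaw lam α β) (fun θ => (θ.2.1, θ.2.2, θ.1)) (a, b, c) =
      lam c * α c a * β c b := fun a b c =>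
    law_of_injective (indepLaw lam α β) (A := fun θ => (θ.2.1, θ.2.2, θ.1))
      (fun x y h => by simp only [Prod.mk.injEq] at h; ext <;> simp [h]) (c, a, b)
  have h2 : ∀ b c, law (indepLaw lam α β) (fun θ => (θ.2.2, θ.1)) (b, c) = lam c * β c b := by
    intro b c
    rw [← sum_law_pair _ (fun θ => θ.2.1)]
    simp only [h3, ← Finset.sum_mul, ← Finset.mul_sum, (hα c).2, mul_one]
  have h1 : ∀ a c, law (indepLaw lam α β) (fun θ => (θ.2.1, θ.1)) (a, c) = lam c * α c a := by
    intro a c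
    rw [← sum_law_pair _ (fun θ => θ.2.2)]
    have : ∀ b, law (indepLaw lam α β) (fun θ => (θ.2.2, θ.2.1, θ.1)) (b, a, c) =
        lam c * α c a * β c b := fun b => by
      rw [← h3]
      exact law_congr_iff _ fun x => by simp only [Prod.mk.injEq]; tauto
    simp only [this, ← Finset.mul_sum, (hβ c).2, mul_one]
  have h0 : ∀ c, law (indepLaw lam α β) (fun θ => θ.1) c = lam c := by
    intro c
    rw [← sum_law_pair _ (fun θ => θ.2.2)]
    simp only [h2, ← Finset.mul_sum, (hβ c).2, mul_one]
  intro a b c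
  rw [h0, h1, h2, h3]
  ring

/-- The law of the sources, the side information and the channel output block. -/
def codeLaw (lam : C → ℝ) (α : C → A₁ → ℝ) (β : C → A₂ → ℝ) (W : X₁ → X₂ → Y → ℝ)
    (f₁ : A₁ → C → Fin n → X₁) (f₂ : A₂ → C → Fin n → X₂) : (C × A₁ × A₂) × (Fin n → Y) → ℝ :=
  outputLaw (indepLaw lam α β) (fun θ i => W (f₁ θ.2.1 θ.1 i) (f₂ θ.2.2 θ.1 i))

/-- Time sharing turns the information conveyed by a block code over the multiple access channel
into single-letter information quantities. -/
theorem exists_macLaw (hn : 0 < n) (hl : lam ∈ stdSimplex ℝ C) (hα : ∀ c, α c ∈ stdSimplex ℝ A₁)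
    (hβ : ∀ c, β c ∈ stdSimplex ℝ A₂) (hW : ∀ x₁ x₂, W x₁ x₂ ∈ stdSimplex ℝ Y)
    (f₁ : A₁ → C → Fin n → X₁) (f₂ : A₂ → C → Fin n → X₂) :
    ∃ (k : ℕ) (pQ : Fin k → ℝ) (P₁ : Fin k → X₁ → ℝ) (P₂ : Fin k → X₂ → ℝ),
      pQ ∈ stdSimplex ℝ (Fin k) ∧ (∀ q, P₁ q ∈ stdSimplex ℝ X₁) ∧ (∀ q, P₂ q ∈ stdSimplex ℝ X₂) ∧
      condEntropy (codeLaw lam α β W f₁ f₂) (fun x => x.2) (fun x => (f₂ x.1.2.2 x.1.1, x.1.1)) -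
        condEntropy (codeLaw lam α β W f₁ f₂) (fun x => x.2) (fun x => (x.1.2.1, x.1.2.2, x.1.1)) ≤
        n * macInfo₁ W pQ P₁ P₂ ∧
      condEntropy (codeLaw lam α β W f₁ f₂) (fun x => x.2) (fun x => (f₁ x.1.2.1 x.1.1, x.1.1)) -
        condEntropy (codeLaw lam α β W f₁ f₂) (fun x => x.2) (fun x => (x.1.2.1, x.1.2.2, x.1.1)) ≤
        n * macInfo₂ W pQ P₁ P₂ ∧
      condEntropy (codeLaw lam α β W f₁ f₂) (fun x => x.2) (fun x => x.1.1) -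
        condEntropy (codeLaw lam α β W f₁ f₂) (fun x => x.2) (fun x => (x.1.2.1, x.1.2.2, x.1.1)) ≤
        n * macInfo₁₂ W pQ P₁ P₂ := by
  classical
  have hn' : (0 : ℝ) < n := by exact_mod_cast hn
  set w : C × A₁ × A₂ → Fin n → Y → ℝ := fun θ i => W (f₁ θ.2.1 θ.1 i) (f₂ θ.2.2 θ.1 i) with hw
  have hws : ∀ θ i, w θ i ∈ stdSimplex ℝ Y := fun θ i => hW _ _
  set r := codeLaw lam α β W f₁ f₂ with hr
  have hrs : r ∈ stdSimplex ℝ ((C × A₁ × A₂) × (Fin n → Y)) :=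
    outputLaw_mem_stdSimplex (indepLaw_mem_stdSimplex hl hα hβ) hws
  -- The time-sharing variable is the pair of the time and the entire side information block; `P₁`,
  -- `P₂` are the laws of the input letters given it.
  let e := Fintype.equivFin (Fin n × C)
  set P₁ : Fin n × C → X₁ → ℝ := fun q x => ∑ s, α q.2 s * if f₁ s q.2 q.1 = x then 1 else 0 with hP₁
  set P₂ : Fin n × C → X₂ → ℝ := fun q x => ∑ s, β q.2 s * if f₂ s q.2 q.1 = x then 1 else 0 with hP₂
  have hP₁s : ∀ q, P₁ q ∈ stdSimplex ℝ X₁ := fun q => by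
    have : P₁ q = law (α q.2) (fun s => f₁ s q.2 q.1) := by
      funext x; rw [law_eq_sum_mul]
    rw [this]
    exact law_mem_stdSimplex (hα _) _
  have hP₂s : ∀ q, P₂ q ∈ stdSimplex ℝ X₂ := fun q => by
    have : P₂ q = law (β q.2) (fun s => f₂ s q.2 q.1) := by
      funext x; rw [law_eq_sum_mul]
    rw [this]
    exact law_mem_stdSimplex (hβ _) _
  set N : Fin n → (C × A₁ × A₂) × (Fin n → Y) → Fin (Fintype.card (Fin n × C)) × X₁ × X₂ × Y :=
    fun i x => (e (i, x.1.1), f₁ x.1.2.1 x.1.1 i, f₂ x.1.2.2 x.1.1 i, x.2 i) with hN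
  set r' : Fin n × ((C × A₁ × A₂) × (Fin n → Y)) → ℝ :=
    fun x => (fun _ => 1 / (n : ℝ)) x.1 * r x.2 with hr'
  -- `N i` extracts the single-letter variables at time `i`. Its first entry reveals the time, so
  -- only one summand of the mixture survives.
  have hlaw : macLaw W (fun q => 1 / (n : ℝ) * lam (e.symm q).2) (fun q => P₁ (e.symm q))
      (fun q => P₂ (e.symm q)) = law r' (fun x => N x.1 x.2) := by
    funext ⟨q, x₁, x₂, y⟩
    obtain ⟨⟨i, c⟩, rfl⟩ := e.surjective q
    rw [hr', law_mixture (fun _ => 1 / (n : ℝ)) r N, Finset.sum_eq_single i]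
    · have h1 : law r (N i) (e (i, c), x₁, x₂, y) =
          law (outputLaw (indepLaw lam α β) w)
            (fun x => (x.2 i, x.1.1, f₁ x.1.2.1 x.1.1 i, f₂ x.1.2.2 x.1.1 i)) (y, c, x₁, x₂) :=
        law_congr_iff _ fun x => by
          simp only [hN, Prod.mk.injEq, e.apply_eq_iff_eq]; tauto
      rw [h1, law_outputLaw_coord hws
        (D := fun θ => (θ.1, f₁ θ.2.1 θ.1 i, f₂ θ.2.2 θ.1 i)) (K := fun d => W d.2.1 d.2.2)
        (fun θ => rfl), law_indepLaw_inputs lam α β (fun s c => f₁ s c i) (fun s c => f₂ s c i)]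
      simp only [macLaw, Equiv.symm_apply_apply, hP₁, hP₂]
      ring
    · intro j _ hj
      rw [mul_eq_zero]
      right
      rw [law_eq_sum_mul]
      refine Finset.sum_eq_zero fun x _ => ?_
      rw [if_neg, mul_zero]
      simp only [hN, Prod.mk.injEq, e.apply_eq_iff_eq]
      tauto
    · simp
  -- Memorylessness: given everything upstream the output letters are independent, each depending
  -- only on the two input letters. This is an equality, as is needed for the negative term.
  have hout : condEntropy r (fun x => x.2) (fun x => (x.1.2.1, x.1.2.2, x.1.1)) =
      ∑ i, condEntropy r (fun x => x.2 i)
        (fun x => (f₁ x.1.2.1 x.1.1 i, f₂ x.1.2.2 x.1.1 i, x.1.1)) := by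
    rw [hr, codeLaw, condEntropy_outputLaw hws (D := fun θ => (θ.2.1, θ.2.2, θ.1))
      (fun a b h => by simp only [Prod.mk.injEq] at h; ext <;> simp [h])]
    simp only [Finset.mul_sum (Finset.univ : Finset (Fin n))]
    rw [Finset.sum_comm]
    refine Finset.sum_congr rfl fun i _ => ?_
    rw [condEntropy_outputLaw_coord hws (D := fun θ => (f₁ θ.2.1 θ.1 i, f₂ θ.2.2 θ.1 i, θ.1))
      (K := fun d => W d.1 d.2.1) (fun d => (hW _ _).2) (fun θ => rfl)]
  have hr's : ∀ x, 0 ≤ r' x := fun x => mul_nonneg (by positivity) (hrs.1 _)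
  have hcond : condEntropy r' (fun x => x.2.2 x.1) (fun x => ((f₁ x.2.1.2.1 x.2.1.1 x.1,
      f₂ x.2.1.2.2 x.2.1.1 x.1, x.2.1.1), x.1)) * n =
      condEntropy r (fun x => x.2) (fun x => (x.1.2.1, x.1.2.2, x.1.1)) := by
    rw [hout, mul_comm]
    exact nat_mul_condEntropy_mixture hn r (fun i x => x.2 i)
      (fun i x => (f₁ x.1.2.1 x.1.1 i, f₂ x.1.2.2 x.1.1 i, x.1.1))
  refine ⟨_, fun q => 1 / (n : ℝ) * lam (e.symm q).2, fun q => P₁ (e.symm q),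
    fun q => P₂ (e.symm q), ⟨fun q => mul_nonneg (by positivity) (hl.1 _), ?_⟩, fun q => hP₁s _,
    fun q => hP₂s _, ?_, ?_, ?_⟩
  · rw [e.symm.sum_comp (fun q => 1 / (n : ℝ) * lam q.2), Fintype.sum_prod_type]
    simp only [← Finset.mul_sum, hl.2, Finset.sum_const, Finset.card_univ, Fintype.card_fin,
      nsmul_eq_mul]
    field_simp
  · rw [macInfo₁, hlaw, condMutualInfo_law, condMutualInfo_symm, ← hcond, mul_sub]
    refine sub_le_sub ?_ (le_of_eq ?_)
    · rw [condEntropy_congr r' (B := fun x => x.2.2 x.1)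
        (C' := fun x => ((f₂ x.2.1.2.2 x.2.1.1 x.1, x.2.1.1), x.1)) (fun _ _ => Iff.rfl)
        (fun x x' => by simp only [hN, Prod.mk.injEq, e.apply_eq_iff_eq]; tauto),
        nat_mul_condEntropy_mixture hn r (fun i x => x.2 i)
          (fun i x => (f₂ x.1.2.2 x.1.1 i, x.1.1))]
      -- Subadditivity over the output letters; then keeping only the `i`-th input letter of the
      -- other user raises the entropy.
      refine (condEntropy_tuple_le hrs.1 _ _).trans (Finset.sum_le_sum fun i _ => ?_)
      refine condEntropy_le_of_factor hrs.1 _ fun x x' h => ?_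
      simp only [Prod.mk.injEq] at h ⊢
      exact ⟨by rw [h.1], h.2⟩
    · rw [mul_comm]
      congr 1
      exact condEntropy_congr r' (fun _ _ => Iff.rfl)
        (fun x x' => by simp only [hN, Prod.mk.injEq, e.apply_eq_iff_eq]; tauto)
  · rw [macInfo₂, hlaw, condMutualInfo_law, condMutualInfo_symm, ← hcond, mul_sub]
    refine sub_le_sub ?_ (le_of_eq ?_)
    · rw [condEntropy_congr r' (B := fun x => x.2.2 x.1)
        (C' := fun x => ((f₁ x.2.1.2.1 x.2.1.1 x.1, x.2.1.1), x.1)) (fun _ _ => Iff.rfl)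
        (fun x x' => by simp only [hN, Prod.mk.injEq, e.apply_eq_iff_eq]; tauto),
        nat_mul_condEntropy_mixture hn r (fun i x => x.2 i)
          (fun i x => (f₁ x.1.2.1 x.1.1 i, x.1.1))]
      refine (condEntropy_tuple_le hrs.1 _ _).trans (Finset.sum_le_sum fun i _ => ?_)
      refine condEntropy_le_of_factor hrs.1 _ fun x x' h => ?_
      simp only [Prod.mk.injEq] at h ⊢
      exact ⟨by rw [h.1], h.2⟩
    · rw [mul_comm]
      congr 1
      exact condEntropy_congr r' (fun _ _ => Iff.rfl)
        (fun x x' => by simp only [hN, Prod.mk.injEq, e.apply_eq_iff_eq]; tauto)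
  · rw [macInfo₁₂, hlaw, condMutualInfo_law, condMutualInfo_symm, ← hcond, mul_sub]
    refine sub_le_sub ?_ (le_of_eq ?_)
    · rw [condEntropy_congr r' (B := fun x => x.2.2 x.1)
        (C' := fun x => (x.2.1.1, x.1)) (fun _ _ => Iff.rfl)
        (fun x x' => by simp only [hN, Prod.mk.injEq, e.apply_eq_iff_eq]; tauto),
        nat_mul_condEntropy_mixture hn r (fun i x => x.2 i) (fun _ x => x.1.1)]
      exact condEntropy_tuple_le hrs.1 _ _
    · rw [mul_comm]
      congr 1
      exact condEntropy_congr r' (fun _ _ => Iff.rfl)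
        (fun x x' => by simp only [hN, Prod.mk.injEq, e.apply_eq_iff_eq]; tauto)

end MacConverse

/-! ### Converse: single-letter bound for a code -/

section CodeConverse

variable {S₁ S₂ Z X₁ X₂ Y T₁ T₂ : Type*} [Fintype S₁] [Fintype S₂] [Fintype Z]
  [Fintype X₁] [Fintype X₂] [Fintype Y] [Fintype T₁] [Fintype T₂]

/-- Factorization of the source law along the Markov chain `S₁ - Z - S₂`. -/
lemma exists_factorization {p : S₁ × S₂ × Z → ℝ} (hp : p ∈ stdSimplex ℝ (S₁ × S₂ × Z))
    (hM : IsMarkovChain p (fun ω => ω.1) (fun ω => ω.2.2) (fun ω => ω.2.1)) :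
    ∃ (lam : Z → ℝ) (a : Z → S₁ → ℝ) (b : Z → S₂ → ℝ), lam ∈ stdSimplex ℝ Z ∧
      (∀ z, a z ∈ stdSimplex ℝ S₁) ∧ (∀ z, b z ∈ stdSimplex ℝ S₂) ∧
      ∀ s₁ s₂ z, p (s₁, s₂, z) = lam z * a z s₁ * b z s₂ := by
  obtain ⟨⟨s₁, s₂, z⟩⟩ := nonempty_of_mem_stdSimplex hp
  have : Nonempty S₁ := ⟨s₁⟩
  have : Nonempty S₂ := ⟨s₂⟩
  obtain ⟨a, ha, hal⟩ := exists_kernel hp.1 (fun ω => ω.1) (fun ω => ω.2.2)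
  obtain ⟨b, hb, hbl⟩ := exists_kernel hp.1 (fun ω => ω.2.1) (fun ω => ω.2.2)
  refine ⟨law p (fun ω => ω.2.2), a, b, law_mem_stdSimplex hp _, ha, hb, fun s₁ s₂ z => ?_⟩
  have h := hM s₁ z s₂
  have h1 : law p (fun ω => (ω.1, ω.2.2, ω.2.1)) (s₁, z, s₂) = p (s₁, s₂, z) :=
    law_of_injective p (A := fun ω => (ω.1, ω.2.2, ω.2.1))
      (fun x y h => by simp only [Prod.mk.injEq] at h; ext <;> simp [h]) (s₁, s₂, z)
  have h2 : law p (fun ω => (ω.2.2, ω.2.1)) (z, s₂) = law p (fun ω => (ω.2.1, ω.2.2)) (s₂, z) :=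
    law_congr_iff _ fun x => by simp only [Prod.mk.injEq]; tauto
  rw [h1, h2, hal, hbl] at h
  have hle : p (s₁, s₂, z) ≤ law p (fun ω => ω.2.2) z := le_law hp.1 (fun ω => ω.2.2) (s₁, s₂, z)
  -- The Markov identity is divided by `P(z)`; where that is zero, both sides of the factorization
  -- vanish.
  by_cases h0 : law p (fun ω => ω.2.2) z = 0
  · have := hp.1 (s₁, s₂, z)
    rw [h0] at hle ⊢
    simp only [zero_mul]
    linarith
  · exact mul_right_cancel₀ h0 (by linarith)

/-- The block of source triples with the given components. -/
def zipBlock {n : ℕ} (θ : (Fin n → Z) × (Fin n → S₁) × (Fin n → S₂)) : Fin n → S₁ × S₂ × Z :=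
  fun i => (θ.2.1 i, θ.2.2 i, θ.1 i)

lemma sum_sourceProb_mul {p : S₁ × S₂ × Z → ℝ} {lam : Z → ℝ} {a : Z → S₁ → ℝ} {b : Z → S₂ → ℝ}
    (h : ∀ s₁ s₂ z, p (s₁, s₂, z) = lam z * a z s₁ * b z s₂) {n : ℕ}
    (G : (Fin n → S₁ × S₂ × Z) → ℝ) :
    ∑ ω, sourceProb p ω * G ω = ∑ θ, indepLaw (fun z : Fin n → Z => ∏ i, lam (z i))
      (fun z (s : Fin n → S₁) => ∏ i, a (z i) (s i)) (fun z (s : Fin n → S₂) => ∏ i, b (z i) (s i)) θ *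
      G (zipBlock θ) := by
  rw [Fintype.sum_prod_type, Finset.sum_comm, Fintype.sum_prod_type, sum_arrow_prod]
  refine Finset.sum_congr rfl fun s₁ _ => ?_
  rw [sum_arrow_prod]
  refine Finset.sum_congr rfl fun s₂ _ => Finset.sum_congr rfl fun z _ => ?_
  simp only [indepLaw, sourceProb, h, Finset.prod_mul_distrib]
  rfl

/-- Summing out the channel output leaves the source block, whose letterwise image under `g` is
i.i.d.; `g` will select `(S₁, Z)` or `(S₂, Z)`. -/
lemma law_codeLaw_zipBlock {κ : Type*} [Fintype κ] {p : S₁ × S₂ × Z → ℝ} {lam : Z → ℝ}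
    {a : Z → S₁ → ℝ} {b : Z → S₂ → ℝ}
    (h : ∀ s₁ s₂ z, p (s₁, s₂, z) = lam z * a z s₁ * b z s₂) {W : X₁ → X₂ → Y → ℝ}
    (hW : ∀ x₁ x₂, W x₁ x₂ ∈ stdSimplex ℝ Y) {n : ℕ} (f₁ : (Fin n → S₁) → (Fin n → Z) → Fin n → X₁)
    (f₂ : (Fin n → S₂) → (Fin n → Z) → Fin n → X₂) (g : S₁ × S₂ × Z → κ) :
    law (codeLaw (fun z : Fin n → Z => ∏ i, lam (z i)) (fun z (s : Fin n → S₁) => ∏ i, a (z i) (s i))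
      (fun z (s : Fin n → S₂) => ∏ i, b (z i) (s i)) W f₁ f₂) (fun x i => g (zipBlock x.1 i)) =
      fun x => ∏ i, law p g (x i) := by
  funext x
  rw [← law_prod]
  refine (congrFun (law_outputLaw (fun θ i => hW _ _) (fun θ i => g (zipBlock θ i))) x).trans ?_
  rw [law_eq_sum_mul, law_eq_sum_mul]
  exact (sum_sourceProb_mul h fun ω => ind ((fun i => g (ω i)) = x)).symm

/-- Single-letter necessary conditions met by every block code. -/
theorem exists_singleLetter [Nonempty T₁] [Nonempty T₂] {p : S₁ × S₂ × Z → ℝ}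
    (hp : p ∈ stdSimplex ℝ (S₁ × S₂ × Z))
    (hM : IsMarkovChain p (fun ω => ω.1) (fun ω => ω.2.2) (fun ω => ω.2.1))
    {W : X₁ → X₂ → Y → ℝ} (hW : ∀ x₁ x₂, W x₁ x₂ ∈ stdSimplex ℝ Y)
    (d₁ : S₁ → T₁ → ℝ) (d₂ : S₂ → T₂ → ℝ) {n : ℕ} (hn : 0 < n)
    (c : Code n S₁ S₂ Z X₁ X₂ Y T₁ T₂) :
    ∃ (V₁ : S₁ → Z → T₁ → ℝ) (V₂ : S₂ → Z → T₂ → ℝ)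
      (k : ℕ) (pQ : Fin k → ℝ) (P₁ : Fin k → X₁ → ℝ) (P₂ : Fin k → X₂ → ℝ),
      (∀ s z, V₁ s z ∈ stdSimplex ℝ T₁) ∧ (∀ s z, V₂ s z ∈ stdSimplex ℝ T₂) ∧
      pQ ∈ stdSimplex ℝ (Fin k) ∧ (∀ q, P₁ q ∈ stdSimplex ℝ X₁) ∧ (∀ q, P₂ q ∈ stdSimplex ℝ X₂) ∧
      testDist (law p fun ω => (ω.1, ω.2.2)) V₁ d₁ =
        c.expect p W (fun ω y => blockDist d₁ (seq₁ ω) (c.dec₁ y (seqZ ω))) ∧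
      testDist (law p fun ω => (ω.2.1, ω.2.2)) V₂ d₂ =
        c.expect p W (fun ω y => blockDist d₂ (seq₂ ω) (c.dec₂ y (seqZ ω))) ∧
      testInfo (law p fun ω => (ω.1, ω.2.2)) V₁ ≤ macInfo₁ W pQ P₁ P₂ ∧
      testInfo (law p fun ω => (ω.2.1, ω.2.2)) V₂ ≤ macInfo₂ W pQ P₁ P₂ ∧
      testInfo (law p fun ω => (ω.1, ω.2.2)) V₁ + testInfo (law p fun ω => (ω.2.1, ω.2.2)) V₂ ≤
        macInfo₁₂ W pQ P₁ P₂ := by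
  classical
  obtain ⟨lam, a, b, hl, ha, hb, hfac⟩ := exists_factorization hp hM
  set lamn : (Fin n → Z) → ℝ := fun z => ∏ i, lam (z i) with hlamn
  set α : (Fin n → Z) → (Fin n → S₁) → ℝ := fun z s => ∏ i, a (z i) (s i) with hα
  set β : (Fin n → Z) → (Fin n → S₂) → ℝ := fun z s => ∏ i, b (z i) (s i) with hβ
  have hls : lamn ∈ stdSimplex ℝ (Fin n → Z) := prod_mem_stdSimplex fun _ => hl
  have hαs : ∀ z, α z ∈ stdSimplex ℝ (Fin n → S₁) := fun z => prod_mem_stdSimplex fun i => ha (z i)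
  have hβs : ∀ z, β z ∈ stdSimplex ℝ (Fin n → S₂) := fun z => prod_mem_stdSimplex fun i => hb (z i)
  set ρ := indepLaw lamn α β with hρ
  set r := codeLaw lamn α β W c.enc₁ c.enc₂ with hr
  have hws : ∀ (θ : (Fin n → Z) × (Fin n → S₁) × (Fin n → S₂)) (i : Fin n),
    W (c.enc₁ θ.2.1 θ.1 i) (c.enc₂ θ.2.2 θ.1 i) ∈ stdSimplex ℝ Y := fun θ i => hW _ _
  have hrs : r ∈ stdSimplex ℝ (((Fin n → Z) × (Fin n → S₁) × (Fin n → S₂)) × (Fin n → Y)) :=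
    outputLaw_mem_stdSimplex (indepLaw_mem_stdSimplex hls hαs hβs) hws
  have hexp : ∀ F : (Fin n → S₁ × S₂ × Z) → (Fin n → Y) → ℝ,
      c.expect p W F = ∑ x, r x * F (zipBlock x.1) x.2 := by
    intro F
    rw [Code.expect, sum_sourceProb_mul hfac]
    refine Eq.trans ?_ (Fintype.sum_prod_type _).symm
    refine Finset.sum_congr rfl fun θ _ => ?_
    rw [Finset.mul_sum]
    exact Finset.sum_congr rfl fun y _ => (mul_assoc _ _ _).symm
  have hind : condMutualInfo r (fun x => x.1.2.1) (fun x => x.1.2.2) (fun x => x.1.1) = 0 := by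
    rw [← condMutualInfo_indepLaw hls hαs hβs, ← condMutualInfo_law r (fun x => x.1) (fun θ => θ.2.1)
      (fun θ => θ.2.2) (fun θ => θ.1)]
    congr 1
    exact (law_outputLaw hws (fun θ => θ)).trans (law_id _)
  have hind' : condMutualInfo r (fun x => x.1.2.2) (fun x => x.1.2.1) (fun x => x.1.1) = 0 := by
    rw [condMutualInfo_comm, hind]
  obtain ⟨V₁, hV₁, hdist₁, hinfo₁⟩ := exists_testChannel hn hrs (law_mem_stdSimplex hp _)
    (S := fun x => x.1.2.1) (Z := fun x => x.1.1) (Y := fun x => x.2)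
    (T := fun x => c.dec₁ x.2 x.1.1) (law_codeLaw_zipBlock hfac hW _ _ fun ω => (ω.1, ω.2.2))
    (fun x x' h h' => by simp only [h, h'])
  obtain ⟨V₂, hV₂, hdist₂, hinfo₂⟩ := exists_testChannel hn hrs (law_mem_stdSimplex hp _)
    (S := fun x => x.1.2.2) (Z := fun x => x.1.1) (Y := fun x => x.2)
    (T := fun x => c.dec₂ x.2 x.1.1) (law_codeLaw_zipBlock hfac hW _ _ fun ω => (ω.2.1, ω.2.2))
    (fun x x' h h' => by simp only [h, h'])
  obtain ⟨k, pQ, P₁, P₂, hQ, hP₁, hP₂, hm₁, hm₂, hm₁₂⟩ := exists_macLaw hn hls hαs hβs hW c.enc₁ c.enc₂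
  have hn' : (0 : ℝ) < n := by exact_mod_cast hn
  -- These bounds link `n * testInfo ≤ I(S^n; Y^n | Z^n)` to the output entropy differences
  -- single-letterized by `exists_macLaw`.
  have k₁ := condMutualInfo_le_of_indep (Y := fun x => x.2) hrs.1 hind
    (X₂ := fun x => c.enc₂ x.1.2.2 x.1.1) (fun x x' h h' => by simp only [h, h'])
  have k₂ := condMutualInfo_le_of_indep (Y := fun x => x.2) hrs.1 hind'
    (X₂ := fun x => c.enc₁ x.1.2.1 x.1.1) (fun x x' h h' => by simp only [h, h'])
  have k₁₂ := condMutualInfo_add_le_of_indep (Y := fun x => x.2) hrs.1 hind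
  rw [condEntropy_congr r (A := fun x => x.2) (B := fun x => x.2)
    (C := fun x => (x.1.2.2, x.1.2.1, x.1.1)) (C' := fun x => (x.1.2.1, x.1.2.2, x.1.1))
    (fun _ _ => Iff.rfl) (fun x x' => by simp only [Prod.mk.injEq]; tauto)] at k₂
  refine ⟨V₁, V₂, k, pQ, P₁, P₂, hV₁, hV₂, hQ, hP₁, hP₂, ?_, ?_, ?_, ?_, ?_⟩
  · rw [hdist₁, hexp]
    rfl
  · rw [hdist₂, hexp]
    rfl
  · exact le_of_mul_le_mul_left (by linarith) hn'
  · exact le_of_mul_le_mul_left (by linarith) hn'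
  · exact le_of_mul_le_mul_left (by linarith) hn'

end CodeConverse

/-! ### Reduction of the time-sharing alphabet -/

section Caratheodory

variable {X₁ X₂ Y : Type*} [Fintype X₁] [Fintype X₂] [Fintype Y]

/-- `(I(X₁; Y | X₂), I(X₂; Y | X₁), I(X₁, X₂; Y))` for independent inputs. -/
def letterInfo (W : X₁ → X₂ → Y → ℝ) (P₁ : X₁ → ℝ) (P₂ : X₂ → ℝ) : ℝ × ℝ × ℝ :=
  (∑ a : X₁ × X₂ × Y, P₁ a.1 * P₂ a.2.1 * W a.1 a.2.1 a.2.2 *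
      (Real.log (W a.1 a.2.1 a.2.2) - Real.log (outLaw₁ W P₁ a.2.1 a.2.2)),
   ∑ a : X₁ × X₂ × Y, P₁ a.1 * P₂ a.2.1 * W a.1 a.2.1 a.2.2 *
      (Real.log (W a.1 a.2.1 a.2.2) - Real.log (outLaw₂ W P₂ a.1 a.2.2)),
   ∑ a : X₁ × X₂ × Y, P₁ a.1 * P₂ a.2.1 * W a.1 a.2.1 a.2.2 *
      (Real.log (W a.1 a.2.1 a.2.2) - Real.log (outLaw₁₂ W P₁ P₂ a.2.2)))

variable {k : ℕ} {W : X₁ → X₂ → Y → ℝ} {pQ : Fin k → ℝ} {P₁ : Fin k → X₁ → ℝ} {P₂ : Fin k → X₂ → ℝ}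

/-- All three quantities are conditional on `Q`, hence averages over its values. The triple is a
convex combination of points of `ℝ³`. -/
lemma macInfo_eq_sum_letterInfo (hW : ∀ x₁ x₂, W x₁ x₂ ∈ stdSimplex ℝ Y)
    (hQ : pQ ∈ stdSimplex ℝ (Fin k)) (h₁ : ∀ q, P₁ q ∈ stdSimplex ℝ X₁)
    (h₂ : ∀ q, P₂ q ∈ stdSimplex ℝ X₂) :
    (macInfo₁ W pQ P₁ P₂, macInfo₂ W pQ P₁ P₂, macInfo₁₂ W pQ P₁ P₂) =
      ∑ q, pQ q • letterInfo W (P₁ q) (P₂ q) := by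
  rw [macInfo₁_eq_sum hW hQ h₁ h₂, macInfo₂_eq_sum hW hQ h₁ h₂, macInfo₁₂_eq_sum hW hQ h₁ h₂]
  refine Prod.ext ?_ (Prod.ext ?_ ?_) <;>
  · simp only [Prod.fst_sum, Prod.snd_sum, Prod.smul_fst, Prod.smul_snd, letterInfo, smul_eq_mul]
    rw [Fintype.sum_prod_type]
    refine Finset.sum_congr rfl fun q _ => ?_
    rw [Finset.mul_sum]
    exact Finset.sum_congr rfl fun a _ => by rw [macLaw]; ring

/-- Four values of the time-sharing variable suffice. -/
lemma exists_macLaw_four (hW : ∀ x₁ x₂, W x₁ x₂ ∈ stdSimplex ℝ Y)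
    (hQ : pQ ∈ stdSimplex ℝ (Fin k)) (h₁ : ∀ q, P₁ q ∈ stdSimplex ℝ X₁)
    (h₂ : ∀ q, P₂ q ∈ stdSimplex ℝ X₂) :
    ∃ (pQ' : Fin 4 → ℝ) (P₁' : Fin 4 → X₁ → ℝ) (P₂' : Fin 4 → X₂ → ℝ),
      pQ' ∈ stdSimplex ℝ (Fin 4) ∧ (∀ q, P₁' q ∈ stdSimplex ℝ X₁) ∧
      (∀ q, P₂' q ∈ stdSimplex ℝ X₂) ∧ macInfo₁ W pQ' P₁' P₂' = macInfo₁ W pQ P₁ P₂ ∧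
      macInfo₂ W pQ' P₁' P₂' = macInfo₂ W pQ P₁ P₂ ∧
      macInfo₁₂ W pQ' P₁' P₂' = macInfo₁₂ W pQ P₁ P₂ := by
  classical
  have hmem : (macInfo₁ W pQ P₁ P₂, macInfo₂ W pQ P₁ P₂, macInfo₁₂ W pQ P₁ P₂) ∈
      convexHull ℝ (Set.range fun q => letterInfo W (P₁ q) (P₂ q)) :=
    mem_convexHull_of_exists_fintype pQ (fun q => letterInfo W (P₁ q) (P₂ q)) hQ.1 hQ.2
      (fun q => ⟨q, rfl⟩) (macInfo_eq_sum_letterInfo hW hQ h₁ h₂).symm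
  obtain ⟨ι, hι, z, w, hz, haff, hw0, hw1, hsum⟩ := eq_pos_convex_span_of_mem_convexHull hmem
  -- An affinely independent family in a space of dimension three has at most four points.
  have hcard : Fintype.card ι ≤ 4 := by
    refine haff.card_le_finrank_succ.trans (Nat.succ_le_succ ?_)
    refine (Submodule.finrank_le _).trans ?_
    simp
  choose g hg using fun i => hz ⟨i, rfl⟩
  obtain ⟨q₀⟩ := nonempty_of_mem_stdSimplex hQ
  obtain ⟨e⟩ := Function.Embedding.nonempty_of_card_le (α := ι) (β := Fin 4) (by simpa using hcard)
  -- Slots not hit by `e` have weight zero under `law w e`, so their value `q₀` is arbitrary.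
  set h : Fin 4 → Fin k := Function.extend e g (fun _ => q₀) with hh
  have hQ' : law w e ∈ stdSimplex ℝ (Fin 4) := law_mem_stdSimplex ⟨fun i => (hw0 i).le, hw1⟩ e
  refine ⟨law w e, fun j => P₁ (h j), fun j => P₂ (h j), hQ', fun j => h₁ _, fun j => h₂ _, ?_⟩
  have hkey : (macInfo₁ W (law w e) (fun j => P₁ (h j)) (fun j => P₂ (h j)),
      macInfo₂ W (law w e) (fun j => P₁ (h j)) (fun j => P₂ (h j)),
      macInfo₁₂ W (law w e) (fun j => P₁ (h j)) (fun j => P₂ (h j))) =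
      (macInfo₁ W pQ P₁ P₂, macInfo₂ W pQ P₁ P₂, macInfo₁₂ W pQ P₁ P₂) := by
    rw [macInfo_eq_sum_letterInfo hW hQ' (fun j => h₁ _) (fun j => h₂ _), ← hsum]
    have hext : ∀ i, letterInfo W (P₁ (h (e i))) (P₂ (h (e i))) = z i := fun i => by
      rw [hh, e.injective.extend_apply]
      exact hg i
    simp only [← hext]
    refine Prod.ext ?_ (Prod.ext ?_ ?_) <;>
    · simp only [Prod.fst_sum, Prod.snd_sum, Prod.smul_fst, Prod.smul_snd, smul_eq_mul]
      exact sum_law_mul w e _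
  simpa only [Prod.mk.injEq] using hkey

end Caratheodory

/-! ### The rate distortion function and test channels -/

section Bridge

variable {σ ζ τ : Type*} [Fintype σ] [Fintype ζ] [Fintype τ] {r : σ × ζ → ℝ}

/-- The reconstruction itself, relabelled by `Fin`, serves as auxiliary variable, and reading it off
is one of the competing estimators. -/
lemma condRateDistortion_le_testInfo (hr : r ∈ stdSimplex ℝ (σ × ζ)) {V : σ → ζ → τ → ℝ}
    (hV : ∀ s z, V s z ∈ stdSimplex ℝ τ) {d : σ → τ → ℝ} {D : ℝ} (hD : testDist r V d ≤ D) :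
    condRateDistortion r d D ≤ (testInfo r V : EReal) := by
  let e := Fintype.equivFin τ
  have hlaw : testLaw r (fun s z j => V s z (e.symm j)) =
      law (jointLaw r V) (fun a => (a.1, a.2.1, e a.2.2)) := by
    funext ⟨s, z, j⟩
    obtain ⟨t, rfl⟩ := e.surjective j
    refine Eq.trans ?_ (law_of_injective (jointLaw r V) (A := fun a => (a.1, a.2.1, e a.2.2))
      (fun a b h => by
        simp only [Prod.mk.injEq, e.apply_eq_iff_eq] at h
        ext <;> simp [h]) (s, z, t)).symm
    simp [testLaw, jointLaw]
  have hinfo : condMutualInfo (testLaw r (fun s z j => V s z (e.symm j))) (fun a => a.1)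
      (fun a => a.2.2) (fun a => a.2.1) = testInfo r V := by
    rw [hlaw, condMutualInfo_law, testInfo, condMutualInfo, condMutualInfo]
    congr 1
    exact condEntropy_congr _ (fun _ _ => Iff.rfl)
      (fun a b => by simp only [Prod.mk.injEq, e.apply_eq_iff_eq])
  rw [← hinfo]
  have hT : Nonempty τ := by
    obtain ⟨⟨_, _, t⟩⟩ := nonempty_of_mem_stdSimplex (jointLaw_mem_stdSimplex hr hV)
    exact ⟨t⟩
  refine iInf_le_of_le (Fintype.card τ) (iInf_le_of_le (fun s z j => V s z (e.symm j))
    (iInf_le_of_le (fun s z => ⟨fun j => (hV s z).1 _, ?_⟩) (iInf_le_of_le ?_ le_rfl)))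
  · rw [e.symm.sum_comp (V s z)]
    exact (hV s z).2
  · refine (ciInf_le (Set.finite_range _).bddBelow
      (fun x : Fin (Fintype.card τ) × ζ => e.symm x.1)).trans ?_
    rw [hlaw, sum_law_mul _ _ (fun a : σ × ζ × Fin (Fintype.card τ) => d a.1 (e.symm a.2.2))]
    simp only [Equiv.symm_apply_apply]
    exact hD

/-- Replacing the auxiliary variable by the best estimate `f (U, Z)` keeps the distortion and, by
data processing given `Z`, does not raise the information. -/
lemma exists_testChannel_of_condRateDistortion_lt [Nonempty τ] (hr : r ∈ stdSimplex ℝ (σ × ζ))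
    {d : σ → τ → ℝ} {D : ℝ} {c : EReal} (h : condRateDistortion r d D < c) :
    ∃ V : σ → ζ → τ → ℝ, (∀ s z, V s z ∈ stdSimplex ℝ τ) ∧ testDist r V d ≤ D ∧
      (testInfo r V : EReal) < c := by
  simp only [condRateDistortion, iInf_lt_iff] at h
  obtain ⟨k, V, hV, hD, hlt⟩ := h
  obtain ⟨f, hf⟩ := exists_eq_ciInf_of_finite
    (f := fun f : Fin k × ζ → τ => ∑ ω, testLaw r V ω * d ω.1 (f (ω.2.2, ω.2.1)))
  have hfD : ∑ ω, testLaw r V ω * d ω.1 (f (ω.2.2, ω.2.1)) ≤ D := hf.trans_le hD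
  have hV' : ∀ s z, law (V s z) (fun u => f (u, z)) ∈ stdSimplex ℝ τ := fun s z =>
    law_mem_stdSimplex (hV s z) _
  have hlaw : jointLaw r (fun s z => law (V s z) (fun u => f (u, z))) =
      law (testLaw r V) (fun a => (a.1, a.2.1, f (a.2.2, a.2.1))) := by
    classical
    funext ⟨s, z, t⟩
    rw [jointLaw, law_eq_sum_mul, law_eq_sum_mul, Fintype.sum_prod_type, Finset.sum_eq_single s,
      Fintype.sum_prod_type, Finset.sum_eq_single z, Finset.mul_sum]
    · refine Finset.sum_congr rfl fun u _ => ?_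
      simp only [testLaw, Prod.mk.injEq, true_and, mul_assoc]
    · intro z' _ hz; simp [hz]
    · simp
    · intro s' _ hs; simp [hs]
    · simp
  have hnn : ∀ a, 0 ≤ testLaw r V a := fun a => mul_nonneg (hr.1 _) ((hV _ _).1 _)
  refine ⟨fun s z => law (V s z) (fun u => f (u, z)), hV', ?_, lt_of_le_of_lt ?_ hlt⟩
  · rw [testDist, hlaw, sum_law_mul _ _ (fun a : σ × ζ × τ => d a.1 a.2.2)]
    exact hfD
  · rw [testInfo, hlaw, condMutualInfo_law, EReal.coe_le_coe_iff]
    exact condMutualInfo_le_of_factor hnn _ fun a b h h' => by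
      have h1 : a.2.1 = b.2.1 := h'
      have h2 : a.2.2 = b.2.2 := h
      simp only [h1, h2]

/-- Excludes `⊥`, so that a rate lying below a real number is itself real. -/
lemma condRateDistortion_nonneg (hr : ∀ a, 0 ≤ r a) (d : σ → τ → ℝ) (D : ℝ) :
    0 ≤ condRateDistortion r d D :=
  le_iInf fun _ => le_iInf fun _ => le_iInf fun hV => le_iInf fun _ =>
    EReal.coe_nonneg.2 (condMutualInfo_nonneg (fun _ => mul_nonneg (hr _) ((hV _ _).1 _)) _ _ _)

/-- `H(S|Z)` is the same for all test channels, so comparing rates means comparing the uncertainties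
left given the output. -/
lemma testInfo_eq_sub {V : σ → ζ → τ → ℝ} (hV : ∀ s z, V s z ∈ stdSimplex ℝ τ) :
    testInfo r V = condEntropy r (fun a => a.1) (fun a => a.2) -
      condEntropy (jointLaw r V) (fun a => a.1) (fun a => (a.2.2, a.2.1)) := by
  rw [testInfo, condMutualInfo]
  congr 1
  conv_rhs => rw [← law_jointLaw_source (r := r) hV]
  rw [condEntropy_law]

/-- Mixing a test channel with a constant one strictly lowers a positive rate, at an arbitrarily
small cost in distortion. -/
lemma exists_testChannel_lt (hr : r ∈ stdSimplex ℝ (σ × ζ)) {V : σ → ζ → τ → ℝ}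
    (hV : ∀ s z, V s z ∈ stdSimplex ℝ τ) (d : σ → τ → ℝ) {ε : ℝ} (hε : 0 < ε)
    (hpos : 0 < testInfo r V) :
    ∃ V' : σ → ζ → τ → ℝ, (∀ s z, V' s z ∈ stdSimplex ℝ τ) ∧
      testDist r V' d ≤ testDist r V d + ε ∧ testInfo r V' < testInfo r V := by
  classical
  obtain ⟨B, hB0, hB⟩ := exists_distortion_bound d
  have hJ := jointLaw_mem_stdSimplex hr hV
  obtain ⟨⟨_, _, t₀⟩⟩ := nonempty_of_mem_stdSimplex hJ
  -- The switching probability: positive, at most `1`, and with `l * 2B ≤ ε`, the cost of using the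
  -- constant letter `t₀` that often.
  set l := ε / (2 * B + ε + 1) with hl
  have hl0 : 0 < l := by positivity
  have hl1 : l ≤ 1 := by
    rw [hl, div_le_one (by positivity)]
    linarith
  have hlB : l * (2 * B) ≤ ε := by
    rw [hl, div_mul_eq_mul_div, div_le_iff₀ (by positivity)]
    nlinarith
  set w : Bool → ℝ := fun b => if b then l else 1 - l with hw
  have hw0 : ∀ b, 0 ≤ w b := fun b => by cases b <;> simp [hw] <;> linarith
  set T : Bool → σ × ζ × τ → τ := fun b a => if b then t₀ else a.2.2 with hT
  set r' : Bool × (σ × ζ × τ) → ℝ := fun x => w x.1 * jointLaw r V x.2 with hr'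
  have hr'0 : ∀ x, 0 ≤ r' x := fun x => mul_nonneg (hw0 _) (hJ.1 _)
  set V' : σ → ζ → τ → ℝ := fun s z t => (1 - l) * V s z t + l * if t = t₀ then 1 else 0 with hV'
  have hV's : ∀ s z, V' s z ∈ stdSimplex ℝ τ := fun s z => by
    refine ⟨fun t => ?_, ?_⟩
    · have h1 := (hV s z).1 t
      have h2 : (0 : ℝ) ≤ if t = t₀ then 1 else 0 := by split_ifs <;> norm_num
      have h3 : 0 ≤ 1 - l := by linarith
      positivity
    · simp [hV', Finset.sum_add_distrib, ← Finset.mul_sum, (hV s z).2]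
  have hlaw : jointLaw r V' = law r' (fun x => (x.2.1, x.2.2.1, T x.1 x.2)) := by
    funext ⟨s, z, t⟩
    rw [hr', law_mixture w (jointLaw r V) (fun b a => (a.1, a.2.1, T b a)), Fintype.sum_bool]
    have h1 : law (jointLaw r V) (fun a => (a.1, a.2.1, T true a)) (s, z, t) =
        r (s, z) * if t = t₀ then 1 else 0 := by
      by_cases ht : t = t₀
      · rw [if_pos ht, mul_one]
        refine Eq.trans ?_ (congrFun (law_jointLaw_source (r := r) hV) (s, z))
        exact law_congr_iff _ fun a => by simp [hT, ht]
      · rw [if_neg ht, mul_zero, law_eq_sum_mul]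
        refine Finset.sum_eq_zero fun a _ => ?_
        rw [if_neg, mul_zero]
        simp only [hT, Prod.mk.injEq, if_true]
        exact fun h => ht h.2.2.symm
    have h2 : law (jointLaw r V) (fun a => (a.1, a.2.1, T false a)) (s, z, t) =
        r (s, z) * V s z t :=
      congrFun (law_id (jointLaw r V)) (s, z, t)
    rw [h1, h2]
    simp only [jointLaw, hV', hw, if_true, Bool.false_eq_true, if_false]
    ring
  refine ⟨V', hV's, ?_, ?_⟩
  · rw [testDist, hlaw, sum_law_mul _ _ (fun a : σ × ζ × τ => d a.1 a.2.2), Fintype.sum_prod_type,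
      Fintype.sum_bool, testDist, ← Finset.sum_add_distrib]
    have hle : ∀ a : σ × ζ × τ, r' (true, a) * d a.1 (T true a) + r' (false, a) * d a.1 (T false a) ≤
        jointLaw r V a * d a.1 a.2.2 + jointLaw r V a * ε := by
      intro a
      have h1 := abs_le.1 (hB a.1 t₀)
      have h2 := abs_le.1 (hB a.1 a.2.2)
      have h3 : l * (d a.1 t₀ - d a.1 a.2.2) ≤ ε :=
        (mul_le_mul_of_nonneg_left (by linarith) hl0.le).trans hlB
      have h4 := mul_le_mul_of_nonneg_left h3 (hJ.1 a)
      simp only [hr', hw, hT, if_true, Bool.false_eq_true, if_false]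
      linarith
    refine (Finset.sum_le_sum fun a _ => hle a).trans_eq ?_
    rw [Finset.sum_add_distrib, ← Finset.sum_mul, hJ.2, one_mul]
  · have e1 := testInfo_eq_sub (r := r) hV
    have e2 := testInfo_eq_sub (r := r) hV's
    rw [hlaw, condEntropy_law] at e2
    -- Revealing the switch to the receiver only helps. In the constant state nothing is learned
    -- about `S` beyond `Z`, so the new information is at most `(1 - l)` times the old.
    have e3 : condEntropy r' (fun x => x.2.1) (fun x => ((T x.1 x.2, x.2.2.1), x.1)) ≤
        condEntropy r' (fun x => x.2.1) (fun x => (T x.1 x.2, x.2.2.1)) :=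
      condEntropy_le_of_factor hr'0 _ fun x x' hx => (Prod.mk.injEq _ _ _ _ ▸ hx).1
    rw [hr', condEntropy_mixture w (jointLaw r V) (fun _ a => a.1) (fun b a => (T b a, a.2.1)),
      Fintype.sum_bool] at e3
    have e4 : condEntropy (jointLaw r V) (fun a => a.1) (fun a => (T true a, a.2.1)) =
        condEntropy r (fun a => a.1) (fun a => a.2) := by
      conv_rhs => rw [← law_jointLaw_source (r := r) hV]
      rw [condEntropy_law]
      exact condEntropy_congr _ (fun _ _ => Iff.rfl) fun a b => by simp [hT]
    have e5 : condEntropy (jointLaw r V) (fun a => a.1) (fun a => (T false a, a.2.1)) =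
        condEntropy (jointLaw r V) (fun a => a.1) (fun a => (a.2.2, a.2.1)) := rfl
    rw [e4, e5] at e3
    have hw1 : w true = l := rfl
    have hw2 : w false = 1 - l := rfl
    rw [hw1, hw2] at e3
    have e6 : testInfo r V' ≤ (1 - l) * testInfo r V := by
      rw [e2, e1]
      linarith
    nlinarith

end Bridge

/-! ### Matching the rates to the channel region; limits and boundary points -/

section Capacity

variable {S₁ S₂ Z X₁ X₂ Y T₁ T₂ : Type*} [Fintype S₁] [Fintype S₂] [Fintype Z]
  [Fintype X₁] [Fintype X₂] [Fintype Y] [Fintype T₁] [Fintype T₂]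

lemma tendsto_exp_mul_div_exp_mul {x y : ℝ} (h : x < y) :
    Tendsto (fun n : ℕ => Real.exp (n * x) / Real.exp (n * y)) atTop (nhds 0) := by
  have h1 : Tendsto (fun n : ℕ => (n : ℝ) * (y - x)) atTop atTop :=
    tendsto_natCast_atTop_atTop.atTop_mul_const (sub_pos.2 h)
  refine (Real.tendsto_exp_neg_atTop_nhds_zero.comp h1).congr fun n => ?_
  rw [← Real.exp_sub, Function.comp_apply]
  congr 1
  ring

lemma testInfo_nonneg {σ ζ τ : Type*} [Fintype σ] [Fintype ζ] [Fintype τ] {r : σ × ζ → ℝ}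
    (hr : r ∈ stdSimplex ℝ (σ × ζ)) {V : σ → ζ → τ → ℝ} (hV : ∀ s z, V s z ∈ stdSimplex ℝ τ) :
    0 ≤ testInfo r V :=
  condMutualInfo_nonneg (jointLaw_nonneg hr.1 hV) _ _ _

/-- Direct part: a source whose test channel conveys no information needs no rate. -/
theorem separatelyAchievable_of_testInfo {p : S₁ × S₂ × Z → ℝ}
    (hp : p ∈ stdSimplex ℝ (S₁ × S₂ × Z)) {W : X₁ → X₂ → Y → ℝ}
    (hW : ∀ x₁ x₂, W x₁ x₂ ∈ stdSimplex ℝ Y) {d₁ : S₁ → T₁ → ℝ} {d₂ : S₂ → T₂ → ℝ} {D₁ D₂ : ℝ}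
    {V₁ : S₁ → Z → T₁ → ℝ} {V₂ : S₂ → Z → T₂ → ℝ}
    (hV₁ : ∀ s z, V₁ s z ∈ stdSimplex ℝ T₁) (hV₂ : ∀ s z, V₂ s z ∈ stdSimplex ℝ T₂)
    (hD₁ : testDist (law p fun ω => (ω.1, ω.2.2)) V₁ d₁ ≤ D₁)
    (hD₂ : testDist (law p fun ω => (ω.2.1, ω.2.2)) V₂ d₂ ≤ D₂)
    {k : ℕ} {pQ : Fin k → ℝ} {P₁ : Fin k → X₁ → ℝ} {P₂ : Fin k → X₂ → ℝ}
    (hQ : pQ ∈ stdSimplex ℝ (Fin k)) (h₁ : ∀ q, P₁ q ∈ stdSimplex ℝ X₁)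
    (h₂ : ∀ q, P₂ q ∈ stdSimplex ℝ X₂) {I₁ I₂ : ℝ}
    (hI₁ : testInfo (law p fun ω => (ω.1, ω.2.2)) V₁ = I₁)
    (hI₂ : testInfo (law p fun ω => (ω.2.1, ω.2.2)) V₂ = I₂)
    (hR₁ : I₁ = 0 ∨ I₁ < macInfo₁ W pQ P₁ P₂) (hR₂ : I₂ = 0 ∨ I₂ < macInfo₂ W pQ P₁ P₂)
    (hR₁₂ : I₁ = 0 ∨ I₂ = 0 ∨ I₁ + I₂ < macInfo₁₂ W pQ P₁ P₂) :
    SeparatelyAchievable p W d₁ d₂ D₁ D₂ := by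
  have hr₁ := law_mem_stdSimplex hp fun ω => (ω.1, ω.2.2)
  have hr₂ := law_mem_stdSimplex hp fun ω => (ω.2.1, ω.2.2)
  -- The sum constraint needs three margins: one above each source information and one below the
  -- channel information. Without a strict inequality the margin is arbitrary.
  have hgap : ∀ a b : ℝ, ∃ δ > 0, a < b → ∀ δ' ≤ δ, a + 3 * δ' < b := fun a b => by
    by_cases h : a < b
    · exact ⟨(b - a) / 4, by linarith, fun _ δ' h' => by linarith⟩
    · exact ⟨1, one_pos, fun h' => absurd h' h⟩
  obtain ⟨δ₁, hδ₁, hg₁⟩ := hgap I₁ (macInfo₁ W pQ P₁ P₂)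
  obtain ⟨δ₂, hδ₂, hg₂⟩ := hgap I₂ (macInfo₂ W pQ P₁ P₂)
  obtain ⟨δ₃, hδ₃, hg₃⟩ := hgap (I₁ + I₂) (macInfo₁₂ W pQ P₁ P₂)
  set δ := min δ₁ (min δ₂ δ₃) with hδdef
  have hδ : 0 < δ := lt_min hδ₁ (lt_min hδ₂ hδ₃)
  have hl₁ : δ ≤ δ₁ := min_le_left _ _
  have hl₂ : δ ≤ δ₂ := (min_le_right _ _).trans (min_le_left _ _)
  have hl₃ : δ ≤ δ₃ := (min_le_right _ _).trans (min_le_right _ _)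
  have hs₁ : I₁ ≠ 0 → SourceCodable _ d₁ D₁ _ := fun _ =>
    sourceCodable_of_testInfo_lt hr₁ hV₁ (ρ := I₁ + δ) (by linarith) hD₁
  have hs₂ : I₂ ≠ 0 → SourceCodable _ d₂ D₂ _ := fun _ =>
    sourceCodable_of_testInfo_lt hr₂ hV₂ (ρ := I₂ + δ) (by linarith) hD₂
  -- A source with zero information uses a single index, so its own error term and the joint one are
  -- identically zero.
  by_cases h0₁ : I₁ = 0 <;> by_cases h0₂ : I₂ = 0
  · exact separatelyAchievable_of_sourceCodable hp hW
      (sourceCodable_of_testInfo_eq_zero hr₁ hV₁ (hI₁.trans h0₁) hD₁)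
      (sourceCodable_of_testInfo_eq_zero hr₂ hV₂ (hI₂.trans h0₂) hD₂) hQ h₁ h₂ hδ
      (by simp) (by simp) (by simp)
  · refine separatelyAchievable_of_sourceCodable hp hW
      (sourceCodable_of_testInfo_eq_zero hr₁ hV₁ (hI₁.trans h0₁) hD₁)
      (hs₂ h0₂) hQ h₁ h₂ hδ (by simp) (tendsto_exp_mul_div_exp_mul ?_) (by simp)
    linarith [hg₂ (hR₂.resolve_left h0₂) δ hl₂]
  · refine separatelyAchievable_of_sourceCodable hp hW (hs₁ h0₁)
      (sourceCodable_of_testInfo_eq_zero hr₂ hV₂ (hI₂.trans h0₂) hD₂)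
      hQ h₁ h₂ hδ (tendsto_exp_mul_div_exp_mul ?_) (by simp) (by simp)
    linarith [hg₁ (hR₁.resolve_left h0₁) δ hl₁]
  · refine separatelyAchievable_of_sourceCodable hp hW (hs₁ h0₁) (hs₂ h0₂)
      hQ h₁ h₂ hδ (tendsto_exp_mul_div_exp_mul ?_) (tendsto_exp_mul_div_exp_mul ?_) ?_
    · linarith [hg₁ (hR₁.resolve_left h0₁) δ hl₁]
    · linarith [hg₂ (hR₂.resolve_left h0₂) δ hl₂]
    · simp only [← Real.exp_add, ← mul_add]
      refine tendsto_exp_mul_div_exp_mul ?_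
      linarith [hg₃ ((hR₁₂.resolve_left h0₁).resolve_left h0₂) δ hl₃]

lemma continuous_testInfo {σ ζ τ X : Type*} [Fintype σ] [Fintype ζ] [Fintype τ]
    [TopologicalSpace X] (r : σ × ζ → ℝ) {V : X → σ → ζ → τ → ℝ} (hV : Continuous V) :
    Continuous fun x => testInfo r (V x) := by
  refine continuous_condMutualInfo (continuous_pi fun a => ?_) _ _ _
  simp only [jointLaw]
  fun_prop

lemma continuous_testDist {σ ζ τ X : Type*} [Fintype σ] [Fintype ζ] [Fintype τ]
    [TopologicalSpace X] (r : σ × ζ → ℝ) {V : X → σ → ζ → τ → ℝ} (hV : Continuous V)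
    (d : σ → τ → ℝ) : Continuous fun x => testDist r (V x) d := by
  simp only [testDist, jointLaw]
  fun_prop

lemma continuous_macLaw {k : ℕ} {X : Type*} [TopologicalSpace X] (W : X₁ → X₂ → Y → ℝ)
    {pQ : X → Fin k → ℝ} {P₁ : X → Fin k → X₁ → ℝ} {P₂ : X → Fin k → X₂ → ℝ}
    (hQ : Continuous pQ) (h₁ : Continuous P₁) (h₂ : Continuous P₂) :
    Continuous fun x => macLaw W (pQ x) (P₁ x) (P₂ x) := by
  refine continuous_pi fun a => ?_
  simp only [macLaw]
  fun_prop

/-- Converse part: achievable distortions are attained by test channels whose informations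
lie in the multiple access region. -/
theorem Achievable.exists_testChannels [Nonempty T₁] [Nonempty T₂] {p : S₁ × S₂ × Z → ℝ}
    (hp : p ∈ stdSimplex ℝ (S₁ × S₂ × Z))
    (hM : IsMarkovChain p (fun ω => ω.1) (fun ω => ω.2.2) (fun ω => ω.2.1))
    {W : X₁ → X₂ → Y → ℝ} (hW : ∀ x₁ x₂, W x₁ x₂ ∈ stdSimplex ℝ Y)
    {d₁ : S₁ → T₁ → ℝ} {d₂ : S₂ → T₂ → ℝ} {D₁ D₂ : ℝ} (h : Achievable p W d₁ d₂ D₁ D₂) :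
    ∃ (V₁ : S₁ → Z → T₁ → ℝ) (V₂ : S₂ → Z → T₂ → ℝ)
      (pQ : Fin 4 → ℝ) (P₁ : Fin 4 → X₁ → ℝ) (P₂ : Fin 4 → X₂ → ℝ),
      (∀ s z, V₁ s z ∈ stdSimplex ℝ T₁) ∧ (∀ s z, V₂ s z ∈ stdSimplex ℝ T₂) ∧
      pQ ∈ stdSimplex ℝ (Fin 4) ∧ (∀ q, P₁ q ∈ stdSimplex ℝ X₁) ∧ (∀ q, P₂ q ∈ stdSimplex ℝ X₂) ∧
      testDist (law p fun ω => (ω.1, ω.2.2)) V₁ d₁ ≤ D₁ ∧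
      testDist (law p fun ω => (ω.2.1, ω.2.2)) V₂ d₂ ≤ D₂ ∧
      testInfo (law p fun ω => (ω.1, ω.2.2)) V₁ ≤ macInfo₁ W pQ P₁ P₂ ∧
      testInfo (law p fun ω => (ω.2.1, ω.2.2)) V₂ ≤ macInfo₂ W pQ P₁ P₂ ∧
      testInfo (law p fun ω => (ω.1, ω.2.2)) V₁ + testInfo (law p fun ω => (ω.2.1, ω.2.2)) V₂ ≤
        macInfo₁₂ W pQ P₁ P₂ := by
  set r₁ := law p fun ω => (ω.1, ω.2.2)
  set r₂ := law p fun ω => (ω.2.1, ω.2.2)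
  -- Taking outputs in the reconstruction alphabets and four time-sharing values makes this space
  -- independent of the block length; `K` is a product of simplices, hence compact.
  let E := (S₁ → Z → T₁ → ℝ) × (S₂ → Z → T₂ → ℝ) × (Fin 4 → ℝ) × (Fin 4 → X₁ → ℝ) ×
    (Fin 4 → X₂ → ℝ)
  let K : Set E := (Set.univ.pi fun _ => Set.univ.pi fun _ => stdSimplex ℝ T₁) ×ˢ
    (Set.univ.pi fun _ => Set.univ.pi fun _ => stdSimplex ℝ T₂) ×ˢ stdSimplex ℝ (Fin 4) ×ˢ
    (Set.univ.pi fun _ => stdSimplex ℝ X₁) ×ˢ (Set.univ.pi fun _ => stdSimplex ℝ X₂)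
  have hK : IsCompact K :=
    (isCompact_univ_pi fun _ => isCompact_univ_pi fun _ => isCompact_stdSimplex ℝ _).prod
      ((isCompact_univ_pi fun _ => isCompact_univ_pi fun _ => isCompact_stdSimplex ℝ _).prod
        ((isCompact_stdSimplex ℝ _).prod ((isCompact_univ_pi fun _ => isCompact_stdSimplex ℝ _).prod
          (isCompact_univ_pi fun _ => isCompact_stdSimplex ℝ _))))
  let C : Set E := {x | testInfo r₁ x.1 ≤ macInfo₁ W x.2.2.1 x.2.2.2.1 x.2.2.2.2 ∧
    testInfo r₂ x.2.1 ≤ macInfo₂ W x.2.2.1 x.2.2.2.1 x.2.2.2.2 ∧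
    testInfo r₁ x.1 + testInfo r₂ x.2.1 ≤ macInfo₁₂ W x.2.2.1 x.2.2.2.1 x.2.2.2.2}
  have hmac : Continuous fun x : E => macLaw W x.2.2.1 x.2.2.2.1 x.2.2.2.2 :=
    continuous_macLaw W (by fun_prop) (by fun_prop) (by fun_prop)
  have hc₁ : Continuous fun x : E => testInfo r₁ x.1 := continuous_testInfo r₁ continuous_fst
  have hc₂ : Continuous fun x : E => testInfo r₂ x.2.1 :=
    continuous_testInfo r₂ (continuous_fst.comp continuous_snd)
  have hC : IsClosed C :=
    (isClosed_le hc₁ (continuous_condMutualInfo hmac _ _ _)).inter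
      ((isClosed_le hc₂ (continuous_condMutualInfo hmac _ _ _)).inter
        (isClosed_le (hc₁.add hc₂) (continuous_condMutualInfo hmac _ _ _)))
  let F : ℕ → Set E := fun m => {x | testDist r₁ x.1 d₁ ≤ D₁ + 1 / ((m : ℝ) + 1) ∧
    testDist r₂ x.2.1 d₂ ≤ D₂ + 1 / ((m : ℝ) + 1)}
  have hF : ∀ m, IsClosed (F m) := fun m =>
    (isClosed_le (continuous_testDist r₁ continuous_fst d₁) continuous_const).inter
      (isClosed_le (continuous_testDist r₂ (continuous_fst.comp continuous_snd) d₂)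
        continuous_const)
  -- Cantor's intersection theorem: for each `m` a single code with slack `1 / (m + 1)` provides a
  -- point, and a common point has no slack left.
  obtain ⟨x, hx⟩ := IsCompact.nonempty_iInter_of_sequence_nonempty_isCompact_isClosed
    (fun m => K ∩ (C ∩ F m)) (fun m x hx => by
      have hle : 1 / (((m + 1 : ℕ) : ℝ) + 1) ≤ 1 / ((m : ℝ) + 1) :=
        one_div_le_one_div_of_le (by positivity) (by push_cast; linarith)
      exact ⟨hx.1, hx.2.1, hx.2.2.1.trans (by linarith), hx.2.2.2.trans (by linarith)⟩)
    (fun m => by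
      obtain ⟨n, ⟨c, hc⟩, hn⟩ :=
        ((h (1 / ((m : ℝ) + 1)) (by positivity)).and (eventually_gt_atTop 0)).exists
      obtain ⟨V₁, V₂, k, pQ, P₁, P₂, hV₁, hV₂, hQ, h₁, h₂, hD₁, hD₂, hI₁, hI₂, hI₁₂⟩ :=
        exists_singleLetter hp hM hW d₁ d₂ hn c
      obtain ⟨pQ', P₁', P₂', hQ', h₁', h₂', e₁, e₂, e₁₂⟩ := exists_macLaw_four hW hQ h₁ h₂
      exact ⟨(V₁, V₂, pQ', P₁', P₂'), ⟨fun s _ z _ => hV₁ s z, fun s _ z _ => hV₂ s z, hQ',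
        fun q _ => h₁' q, fun q _ => h₂' q⟩, ⟨hI₁.trans e₁.ge, hI₂.trans e₂.ge,
        hI₁₂.trans e₁₂.ge⟩, hD₁.trans_le hc.1, hD₂.trans_le hc.2⟩)
    (hK.inter_right (hC.inter (hF 0)))
    (fun m => hK.isClosed.inter (hC.inter (hF m)))
  rw [Set.mem_iInter] at hx
  have hlim : ∀ a D : ℝ, (∀ m : ℕ, a ≤ D + 1 / ((m : ℝ) + 1)) → a ≤ D := fun a D ha => by
    have ht := tendsto_one_div_add_atTop_nhds_zero_nat (𝕜 := ℝ).const_add D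
    rw [add_zero] at ht
    exact ge_of_tendsto' ht ha
  obtain ⟨⟨hV₁, hV₂, hQ, h₁, h₂⟩, ⟨hI₁, hI₂, hI₁₂⟩, -⟩ := hx 0
  exact ⟨x.1, x.2.1, x.2.2.1, x.2.2.2.1, x.2.2.2.2, fun s z => hV₁ s trivial z trivial,
    fun s z => hV₂ s trivial z trivial, hQ, fun q => h₁ q trivial, fun q => h₂ q trivial,
    hlim _ _ fun m => (hx m).2.2.1, hlim _ _ fun m => (hx m).2.2.2, hI₁, hI₂, hI₁₂⟩

/-- Zero information cannot be lowered, but needs no rate; either alternative is enough for the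
direct part. -/
lemma exists_testChannel_lt_or_eq_zero {σ ζ τ : Type*} [Fintype σ] [Fintype ζ] [Fintype τ]
    {r : σ × ζ → ℝ} (hr : r ∈ stdSimplex ℝ (σ × ζ)) {V : σ → ζ → τ → ℝ}
    (hV : ∀ s z, V s z ∈ stdSimplex ℝ τ) (d : σ → τ → ℝ) {ε : ℝ} (hε : 0 < ε) :
    ∃ V' : σ → ζ → τ → ℝ, (∀ s z, V' s z ∈ stdSimplex ℝ τ) ∧
      testDist r V' d ≤ testDist r V d + ε ∧ (testInfo r V' = 0 ∨ testInfo r V' < testInfo r V) := by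
  rcases (testInfo_nonneg hr hV).eq_or_lt with h | h
  · exact ⟨V, hV, by linarith, Or.inl h.symm⟩
  · obtain ⟨V', h1, h2, h3⟩ := exists_testChannel_lt hr hV d hε h
    exact ⟨V', h1, h2, Or.inr h3⟩

/-- The converse may land on the boundary of the region. After perturbation each user has zero or
strictly smaller information; if neither is zero, the two strict inequalities add up to a strict sum
constraint. -/
theorem Achievable.separatelyAchievable [Nonempty T₁] [Nonempty T₂] {p : S₁ × S₂ × Z → ℝ}
    (hp : p ∈ stdSimplex ℝ (S₁ × S₂ × Z))
    (hM : IsMarkovChain p (fun ω => ω.1) (fun ω => ω.2.2) (fun ω => ω.2.1))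
    {W : X₁ → X₂ → Y → ℝ} (hW : ∀ x₁ x₂, W x₁ x₂ ∈ stdSimplex ℝ Y)
    {d₁ : S₁ → T₁ → ℝ} {d₂ : S₂ → T₂ → ℝ} {D₁ D₂ : ℝ} (h : Achievable p W d₁ d₂ D₁ D₂) :
    SeparatelyAchievable p W d₁ d₂ D₁ D₂ := by
  obtain ⟨V₁, V₂, pQ, P₁, P₂, hV₁, hV₂, hQ, h₁, h₂, hD₁, hD₂, hI₁, hI₂, hI₁₂⟩ :=
    h.exists_testChannels hp hM hW
  refine separatelyAchievable_of_forall fun ε hε => ?_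
  obtain ⟨U₁, hU₁, hE₁, hJ₁⟩ := exists_testChannel_lt_or_eq_zero
    (law_mem_stdSimplex hp fun ω => (ω.1, ω.2.2)) hV₁ d₁ hε
  obtain ⟨U₂, hU₂, hE₂, hJ₂⟩ := exists_testChannel_lt_or_eq_zero
    (law_mem_stdSimplex hp fun ω => (ω.2.1, ω.2.2)) hV₂ d₂ hε
  refine separatelyAchievable_of_testInfo hp hW hU₁ hU₂ (by linarith) (by linarith) hQ h₁ h₂
    rfl rfl (hJ₁.imp_right fun h => h.trans_le hI₁) (hJ₂.imp_right fun h => h.trans_le hI₂) ?_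
  rcases hJ₁ with h | hJ₁
  · exact Or.inl h
  · exact Or.inr (hJ₂.imp_right fun hJ₂ => by linarith)

theorem achievable_of_condRateDistortion_lt [Nonempty T₁] [Nonempty T₂] {p : S₁ × S₂ × Z → ℝ}
    (hp : p ∈ stdSimplex ℝ (S₁ × S₂ × Z))
    {W : X₁ → X₂ → Y → ℝ} (hW : ∀ x₁ x₂, W x₁ x₂ ∈ stdSimplex ℝ Y)
    {d₁ : S₁ → T₁ → ℝ} {d₂ : S₂ → T₂ → ℝ} {D₁ D₂ : ℝ}
    {k : ℕ} {pQ : Fin k → ℝ} {P₁ : Fin k → X₁ → ℝ} {P₂ : Fin k → X₂ → ℝ}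
    (hQ : pQ ∈ stdSimplex ℝ (Fin k)) (h₁ : ∀ q, P₁ q ∈ stdSimplex ℝ X₁)
    (h₂ : ∀ q, P₂ q ∈ stdSimplex ℝ X₂)
    (hR₁ : rateDist₁ p d₁ D₁ < (macInfo₁ W pQ P₁ P₂ : EReal))
    (hR₂ : rateDist₂ p d₂ D₂ < (macInfo₂ W pQ P₁ P₂ : EReal))
    (hR₁₂ : rateDist₁ p d₁ D₁ + rateDist₂ p d₂ D₂ < (macInfo₁₂ W pQ P₁ P₂ : EReal)) :
    Achievable p W d₁ d₂ D₁ D₂ := by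
  have hr₁ := law_mem_stdSimplex hp fun ω => (ω.1, ω.2.2)
  have hr₂ := law_mem_stdSimplex hp fun ω => (ω.2.1, ω.2.2)
  have hlift : ∀ {a : EReal} {b : ℝ}, 0 ≤ a → a < b → ∃ x : ℝ, a = x := fun {a b} h0 hb =>
    ⟨a.toReal, (EReal.coe_toReal (hb.trans (EReal.coe_lt_top b)).ne
      ((EReal.bot_lt_zero.trans_le h0).ne')).symm⟩
  obtain ⟨x₁, hx₁⟩ := hlift (condRateDistortion_nonneg hr₁.1 d₁ D₁) hR₁
  obtain ⟨x₂, hx₂⟩ := hlift (condRateDistortion_nonneg hr₂.1 d₂ D₂) hR₂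
  rw [rateDist₁, hx₁] at hR₁ hR₁₂
  rw [rateDist₂, hx₂] at hR₂ hR₁₂
  rw [EReal.coe_lt_coe_iff] at hR₁ hR₂
  rw [← EReal.coe_add, EReal.coe_lt_coe_iff] at hR₁₂
  -- Half the slack in the sum constraint for each user: test channels within `η` of their infima
  -- still satisfy it strictly.
  set η := (macInfo₁₂ W pQ P₁ P₂ - x₁ - x₂) / 2 with hη
  have hη0 : 0 < η := by rw [hη]; linarith
  obtain ⟨V₁, hV₁, hD₁, hI₁⟩ := exists_testChannel_of_condRateDistortion_lt hr₁ (d := d₁) (D := D₁)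
    (c := (min (macInfo₁ W pQ P₁ P₂) (x₁ + η) : ℝ))
    (by rw [hx₁, EReal.coe_lt_coe_iff]; exact lt_min hR₁ (by linarith))
  obtain ⟨V₂, hV₂, hD₂, hI₂⟩ := exists_testChannel_of_condRateDistortion_lt hr₂ (d := d₂) (D := D₂)
    (c := (min (macInfo₂ W pQ P₁ P₂) (x₂ + η) : ℝ))
    (by rw [hx₂, EReal.coe_lt_coe_iff]; exact lt_min hR₂ (by linarith))
  rw [EReal.coe_lt_coe_iff, lt_min_iff] at hI₁ hI₂
  exact (separatelyAchievable_of_testInfo hp hW hV₁ hV₂ hD₁ hD₂ hQ h₁ h₂ rfl rfl (Or.inr hI₁.1)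
    (Or.inr hI₂.1) (Or.inr (Or.inr (by linarith)))).achievable

end Capacity

end LossyMAC

end

theorem mainTheorem1 {S₁ S₂ Z X₁ X₂ Y T₁ T₂ : Type*}
    [Fintype S₁] [Fintype S₂] [Fintype Z] [Fintype X₁] [Fintype X₂] [Fintype Y]
    [Fintype T₁] [Fintype T₂] [Nonempty T₁] [Nonempty T₂]
    (p : S₁ × S₂ × Z → ℝ) (hp : p ∈ stdSimplex ℝ (S₁ × S₂ × Z))
    (W : X₁ → X₂ → Y → ℝ) (hW : ∀ x₁ x₂, W x₁ x₂ ∈ stdSimplex ℝ Y)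
    (d₁ : S₁ → T₁ → ℝ) (d₂ : S₂ → T₂ → ℝ)
    (hMarkov : LossyMAC.IsMarkovChain p (fun ω => ω.1) (fun ω => ω.2.2) (fun ω => ω.2.1))
    (D₁ D₂ : ℝ) :
    -- separate source and channel coding is optimal
    (LossyMAC.Achievable p W d₁ d₂ D₁ D₂ ↔ LossyMAC.SeparatelyAchievable p W d₁ d₂ D₁ D₂) ∧
    -- sufficiency
    ((∃ (k : ℕ) (pQ : Fin k → ℝ) (P₁ : Fin k → X₁ → ℝ) (P₂ : Fin k → X₂ → ℝ),
        pQ ∈ stdSimplex ℝ (Fin k) ∧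
        (∀ q, P₁ q ∈ stdSimplex ℝ X₁) ∧ (∀ q, P₂ q ∈ stdSimplex ℝ X₂) ∧
        LossyMAC.rateDist₁ p d₁ D₁ < (LossyMAC.macInfo₁ W pQ P₁ P₂ : EReal) ∧
        LossyMAC.rateDist₂ p d₂ D₂ < (LossyMAC.macInfo₂ W pQ P₁ P₂ : EReal) ∧
        LossyMAC.rateDist₁ p d₁ D₁ + LossyMAC.rateDist₂ p d₂ D₂
          < (LossyMAC.macInfo₁₂ W pQ P₁ P₂ : EReal)) →
      LossyMAC.Achievable p W d₁ d₂ D₁ D₂) ∧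
    -- necessity
    (LossyMAC.Achievable p W d₁ d₂ D₁ D₂ →
      ∃ (k : ℕ) (pQ : Fin k → ℝ) (P₁ : Fin k → X₁ → ℝ) (P₂ : Fin k → X₂ → ℝ),
        pQ ∈ stdSimplex ℝ (Fin k) ∧
        (∀ q, P₁ q ∈ stdSimplex ℝ X₁) ∧ (∀ q, P₂ q ∈ stdSimplex ℝ X₂) ∧
        LossyMAC.rateDist₁ p d₁ D₁ ≤ (LossyMAC.macInfo₁ W pQ P₁ P₂ : EReal) ∧
        LossyMAC.rateDist₂ p d₂ D₂ ≤ (LossyMAC.macInfo₂ W pQ P₁ P₂ : EReal) ∧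
        LossyMAC.rateDist₁ p d₁ D₁ + LossyMAC.rateDist₂ p d₂ D₂
          ≤ (LossyMAC.macInfo₁₂ W pQ P₁ P₂ : EReal)) := by
  refine ⟨⟨fun h => h.separatelyAchievable hp hMarkov hW, fun h => h.achievable⟩, ?_, fun h => ?_⟩
  · rintro ⟨k, pQ, P₁, P₂, hQ, h₁, h₂, hR₁, hR₂, hR₁₂⟩
    exact LossyMAC.achievable_of_condRateDistortion_lt hp hW hQ h₁ h₂ hR₁ hR₂ hR₁₂
  · obtain ⟨V₁, V₂, pQ, P₁, P₂, hV₁, hV₂, hQ, h₁, h₂, hD₁, hD₂, hI₁, hI₂, hI₁₂⟩ :=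
      h.exists_testChannels hp hMarkov hW
    have hR₁ := LossyMAC.condRateDistortion_le_testInfo
      (LossyMAC.law_mem_stdSimplex hp fun ω => (ω.1, ω.2.2)) hV₁ hD₁
    have hR₂ := LossyMAC.condRateDistortion_le_testInfo
      (LossyMAC.law_mem_stdSimplex hp fun ω => (ω.2.1, ω.2.2)) hV₂ hD₂
    refine ⟨4, pQ, P₁, P₂, hQ, h₁, h₂, hR₁.trans (EReal.coe_le_coe_iff.2 hI₁),
      hR₂.trans (EReal.coe_le_coe_iff.2 hI₂), (add_le_add hR₁ hR₂).trans ?_⟩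
    rw [← EReal.coe_add]
    exact EReal.coe_le_coe_iff.2 hI₁₂
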